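/- **Theorem (existence of a self-similar solution).** For real parameters $\alpha>0$, $m>0$, $\kappa>0$, $a>0$ consider the problem of finding a positive classical solution $f\in C^4([0,\infty))$, $f>0$, of $$\alpha\,(f-yf_y)+(f^m f_{yyy})_y=0\quad\text{for } y\in(0,\infty),\qquad f(0)=1,\ f_y(0)=0,\ f_{yy}(0)=\kappa,\ f_{yyy}(0)=0,\qquad \lim_{y\to\infty}\frac{f(y)}{y}=a. \tag{P}$$ (i) Let $m\in(0,4)$ and $\alpha=\frac1{4-m}$. Then there exist $\kappa\in(0,\sqrt{12\alpha})$ and $a>0$ such that problem (P) has a solution. (ii) Let $m=4$, let $b>0$ and $\alpha=b$. Then there exist $\kappa\in(0,\sqrt{12\alpha})$ and $a>0$ such that problem (P) has a solution $f$ that satisfies $$f(y)=ay+\operatorname{Re}\big[K\,y^{1+z_0}\big]+o\big(y^{1+\operatorname{Re}z_0}\big)\quad\text{as } y\to\infty$$ for some $K,z_0\in\mathbb C$ with $\operatorname{Re}z_0<-1$. Here $z_0$ is the root of $(1-z^2)(2+z)+\frac{b}{a^4}$ with the largest real part among the roots with negative real part and, for definiteness, with $\operatorname{Im}z_0\ge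 0$. -/

import Mathlib

open Set Filter Topology Asymptotics

/-- `f` (only its values on `[0,∞)` matter) is a positive classical solution, `C⁴` up to `y = 0`, of
`α (f - y f') + (f ^ m f''')' = 0` on `(0,∞)` with `f 0 = 1`, `f' 0 = 0`, `f'' 0 = κ`, `f''' 0 = 0`
(one-sided derivatives at `0`) and `f y / y → a` as `y → ∞`. -/
structure IsSelfSimilarProfile (α m κ a : ℝ) (f : ℝ → ℝ) : Prop where
  contDiffOn : ContDiffOn ℝ 4 f (Ici 0)
  pos : ∀ y : ℝ, 0 ≤ y → 0 < f y
  ode : ∀ y : ℝ, 0 < y →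
    α * (f y - y * deriv f y) + deriv (fun s : ℝ => f s ^ m * iteratedDeriv 3 f s) y = 0
  init_zero : f 0 = 1
  init_one : iteratedDerivWithin 1 f (Ici 0) 0 = 0
  init_two : iteratedDerivWithin 2 f (Ici 0) 0 = κ
  init_three : iteratedDerivWithin 3 f (Ici 0) 0 = 0
  linear_growth : Tendsto (fun y : ℝ => f y / y) atTop (𝓝 a)

/-- `z₀` is the root of `(1 - z ^ 2) (2 + z) + c` with the largest negative real part, normalized
by `0 ≤ Im z₀`. -/
structure IsLeadingRoot (c : ℝ) (z₀ : ℂ) : Prop where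
  root : (1 - z₀ ^ 2) * (2 + z₀) + (c : ℂ) = 0
  re_neg : z₀.re < 0
  re_max : ∀ z : ℂ, (1 - z ^ 2) * (2 + z) + (c : ℂ) = 0 → z.re < 0 → z.re ≤ z₀.re
  im_nonneg : 0 ≤ z₀.im

/-! The scaling `f (l * y)` with `l ^ 4 = α` reduces the problem to `α = 1`: `κ` becomes `l ^ 2 *
κ`, the slope `a` becomes `l * a`, and the ratio `α / a ^ 4` that determines `z₀` is preserved.

With `p = f'`, `u = f''`, `g = f ^ m f'''`, `h = t f' - f` and `r = f ^ (-m)` the equation is the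
cyclic system `h' = t u`, `u' = r g`, `g' = h`, started at `(h, u, g) = (-1, κ, 0)`. Positive
feedback makes the positive and the negative octant of `(h, u, g)` forward invariant. For `κ = 0`
the orbit falls into the negative octant and `f'` becomes negative; for `κ = √12` it reaches the
positive octant while `f' > 0`. Both outcomes are open in `κ` and exclude each other, so by
connectedness some `κ` in between has neither (`exists_neutral_profileFlow`). To have global
trajectories for every `κ`, `f ^ (-m)` is frozen below `f = 1`; the selected orbit has `f ≥ 1` and
never notices.

Along a neutral orbit the function `lyap` is nondecreasing. A positive value would drive the orbit
into an octant (`IsTriad.not_lyap_pos`), so `lyap ≤ 0`. Its derivative dominates `t ^ 2 * u ^ 2`,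
whence `f'` converges (`exists_tendsto_p`). The limit is positive: the orbit starts in the phase `h
< 0 < u`, `g < 0`, where `f'` increases. If this phase ends, at a time `T`, then `lyap T = -T E`
with `E ≤ 2/3 f'(T) ^ 2` (`firstPhase_lyap`), and `f'` varies afterwards by at most `√E < f'(T)`
(`abs_p_sub_le_sqrt`).

For `m = 4` the variables `f / y`, `h / y`, `y f''`, `g / y ^ 2` solve an autonomous system in `s =
log y`. Its linearization at the limit `f / y = a` is governed by `(z ^ 2 - 1) * (z + 2) = 1 / a ^
4`, which has one root `μ > 1`. The other two have real part `-(2 + μ) / 2 < -1` when they are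
nonreal. This is ensured by the quantitative estimate `limit_pow_four_le`, `a ^ 4 ≤ 1.58`, which in
particular excludes a double root. The rate `e ^ (-s / 2)` from `exists_decay` is then doubled
repeatedly, until the quadratic error decays faster than `e ^ (z₀ s)` and the expansion can be read
off. -/

/-! ### Global flows of vector fields of linear growth. -/

section GlobalFlow

variable {E : Type*} [NormedAddCommGroup E] [NormedSpace ℝ E]

/-- A time-dependent vector field on `[0,∞)` that is continuous in time, Lipschitz in space on
bounded sets, and of linear growth, locally uniformly in time. -/
structure IsLinearGrowthField (v : ℝ → E → E) : Prop where
  continuous_time : ∀ x, Continuous fun t => v t x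
  lipschitz : ∀ T R : ℝ, ∃ K : NNReal, ∀ t ∈ Icc 0 T, LipschitzOnWith K (v t) (Metric.closedBall 0 R)
  growth : ∀ T : ℝ, ∃ C : ℝ, 0 ≤ C ∧ ∀ t ∈ Icc 0 T, ∀ x, ‖v t x‖ ≤ C * ‖x‖

variable {v : ℝ → E → E}

lemma hasDerivWithinAt_Ici_of_Icc {X : ℝ → E} {X' : E} {T t : ℝ} (ht : t ∈ Ico 0 T)
    (h : HasDerivWithinAt X X' (Icc 0 T) t) : HasDerivWithinAt X X' (Ici t) t := by
  have h1 : HasDerivWithinAt X X' (Icc t T) t := h.mono (Icc_subset_Icc_left ht.1)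
  exact h1.mono_of_mem_nhdsWithin (Icc_mem_nhdsGE ht.2)

/-- Grönwall bound for a trajectory of a field of linear growth. -/
lemma norm_le_of_linear_growth {X : ℝ → E} {w : ℝ → E → E} {C T : ℝ}
    (hC : ∀ t ∈ Icc 0 T, ∀ x, ‖w t x‖ ≤ C * ‖x‖) (hC0 : 0 ≤ C)
    (hX : ∀ t ∈ Icc 0 T, HasDerivWithinAt X (w t (X t)) (Icc 0 T) t) :
    ∀ t ∈ Icc 0 T, ‖X t‖ ≤ ‖X 0‖ * Real.exp (C * T) := by
  intro t ht
  have := norm_le_gronwallBound_of_norm_deriv_right_le (f := X) (f' := fun t => w t (X t))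
    (δ := ‖X 0‖) (K := C) (ε := 0) (a := 0) (b := T)
    (fun t ht => (hX t ht).continuousWithinAt)
    (fun t ht => hasDerivWithinAt_Ici_of_Icc ht (hX t (Ico_subset_Icc_self ht))) le_rfl
    (fun t ht => by simpa using hC t (Ico_subset_Icc_self ht) (X t)) t ht
  rw [gronwallBound_ε0] at this
  refine this.trans ?_
  gcongr
  linarith [ht.2]

/-- Lipschitz dependence on initial data, uniformly on bounded sets. -/
lemma IsLinearGrowthField.exists_dist_le (hv : IsLinearGrowthField v) (T R : ℝ) :
    ∃ L : ℝ, 0 < L ∧ ∀ X Y : ℝ → E, ‖X 0‖ ≤ R → ‖Y 0‖ ≤ R → ∀ S ≤ T,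
      (∀ t ∈ Icc 0 S, HasDerivWithinAt X (v t (X t)) (Icc 0 S) t) →
      (∀ t ∈ Icc 0 S, HasDerivWithinAt Y (v t (Y t)) (Icc 0 S) t) →
      ∀ t ∈ Icc 0 S, dist (X t) (Y t) ≤ L * dist (X 0) (Y 0) := by
  obtain ⟨C, hC0, hC⟩ := hv.growth T
  obtain ⟨K, hK⟩ := hv.lipschitz T (R * Real.exp (C * T))
  refine ⟨Real.exp (K * T), Real.exp_pos _, fun X Y hX0 hY0 S hS hX hY t ht => ?_⟩
  have bd : ∀ Z : ℝ → E, ‖Z 0‖ ≤ R →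
      (∀ t ∈ Icc 0 S, HasDerivWithinAt Z (v t (Z t)) (Icc 0 S) t) →
      ∀ t ∈ Icc 0 S, Z t ∈ Metric.closedBall (0 : E) (R * Real.exp (C * T)) := by
    intro Z hZ0 hZ t ht
    rw [mem_closedBall_zero_iff]
    refine (norm_le_of_linear_growth (fun t ht => hC t ⟨ht.1, ht.2.trans hS⟩) hC0 hZ t ht).trans ?_
    gcongr
    exact (norm_nonneg _).trans hZ0
  have := dist_le_of_trajectories_ODE_of_mem (v := v)
    (s := fun _ => Metric.closedBall (0 : E) (R * Real.exp (C * T))) (f := X) (g := Y) (a := 0)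
    (b := S) (K := K) (δ := dist (X 0) (Y 0))
    (fun t ht => hK t ⟨ht.1, ht.2.le.trans hS⟩)
    (fun t ht => (hX t ht).continuousWithinAt)
    (fun t ht => hasDerivWithinAt_Ici_of_Icc ht (hX t (Ico_subset_Icc_self ht)))
    (fun t ht => bd X hX0 hX t (Ico_subset_Icc_self ht))
    (fun t ht => (hY t ht).continuousWithinAt)
    (fun t ht => hasDerivWithinAt_Ici_of_Icc ht (hY t (Ico_subset_Icc_self ht)))
    (fun t ht => bd Y hY0 hY t (Ico_subset_Icc_self ht)) le_rfl t ht
  refine this.trans ?_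
  rw [mul_comm]
  gcongr
  linarith [ht.2]

/-- `P` is a `1`-Lipschitz retraction of `E` onto a subset of the ball of radius `R` that fixes
the points of that ball. -/
structure IsBallRetraction (R : ℝ) (P : E → E) : Prop where
  lipschitz : LipschitzWith 1 P
  norm_le : ∀ x, ‖P x‖ ≤ R
  eq_self : ∀ x, ‖x‖ ≤ R → P x = x

/-- Picard–Lindelöf is applied to the truncated field `v t (P x)`, which is bounded and Lipschitz on
the whole space. Truncation keeps the linear growth, so Grönwall confines the solution to the ball
fixed by `P`, where both fields agree. -/
lemma IsLinearGrowthField.exists_solution_Icc [CompleteSpace E] (hv : IsLinearGrowthField v)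
    (hP : ∀ R : ℝ, 0 < R → ∃ P : E → E, IsBallRetraction R P) (x₀ : E) {T : ℝ} (hT : 0 ≤ T) :
    ∃ X : ℝ → E, X 0 = x₀ ∧ ∀ t ∈ Icc 0 T, HasDerivWithinAt X (v t (X t)) (Icc 0 T) t := by
  obtain ⟨C, hC0, hC⟩ := hv.growth T
  set R : ℝ := ‖x₀‖ * Real.exp (C * T) + 1 with hR
  have hRpos : 0 < R := by positivity
  obtain ⟨P, hP1, hP2, hP3⟩ := hP R hRpos
  obtain ⟨K, hK⟩ := hv.lipschitz T R
  have hP0 : ∀ x, ‖P x‖ ≤ ‖x‖ := by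
    intro x
    have h0 : P 0 = 0 := hP3 0 (by simpa using hRpos.le)
    have := hP1.dist_le_mul x 0
    simpa [h0] using this
  have hw : ∀ t ∈ Icc 0 T, ∀ x, ‖v t (P x)‖ ≤ C * ‖x‖ := fun t ht x =>
    (hC t ht _).trans (by gcongr; exact hP0 x)
  have hPL : IsPicardLindelof (fun t x => v t (P x)) (tmin := 0) (tmax := T)
      ⟨0, le_rfl, hT⟩ x₀ (C * R * T).toNNReal 0 (C * R).toNNReal K := by
    refine ⟨fun t ht => ?_, fun x _ => (hv.continuous_time _).continuousOn, fun t ht x _ => ?_, ?_⟩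
    · have h1 := (hK t ht).comp (hP1.lipschitzOnWith
          (s := Metric.closedBall x₀ ((C * R * T).toNNReal : ℝ))) (fun x _ => by rw [mem_closedBall_zero_iff]; exact hP2 x)
      rw [mul_one] at h1
      exact h1
    · rw [Real.coe_toNNReal _ (by positivity)]
      exact (hC t ht _).trans (by gcongr; exact hP2 x)
    · rw [Real.coe_toNNReal _ (by positivity), Real.coe_toNNReal _ (by positivity)]
      simp [hT]
  obtain ⟨X, hX0, hX⟩ := hPL.exists_eq_forall_mem_Icc_hasDerivWithinAt₀
  refine ⟨X, hX0, fun t ht => ?_⟩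
  have hb := norm_le_of_linear_growth (w := fun t x => v t (P x)) hw hC0 hX t ht
  have h0 : X 0 = x₀ := hX0
  have : P (X t) = X t := hP3 _ (by rw [h0] at hb; linarith)
  have h2 := hX t ht
  rw [this] at h2
  exact h2

lemma IsLinearGrowthField.exists_flow [CompleteSpace E] (hv : IsLinearGrowthField v)
    (hP : ∀ R : ℝ, 0 < R → ∃ P : E → E, IsBallRetraction R P) :
    ∃ X : E → ℝ → E, (∀ x, X x 0 = x) ∧ (∀ x t, 0 ≤ t → HasDerivAt (X x) (v t (X x t)) t) ∧
      ∀ T R : ℝ, ∃ L : ℝ, 0 < L ∧ ∀ x y, ‖x‖ ≤ R → ‖y‖ ≤ R → ∀ t ∈ Icc 0 T,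
        dist (X x t) (X y t) ≤ L * dist x y := by
  choose Z hZ0 hZ using fun (x : E) (n : ℕ) => hv.exists_solution_Icc hP x (T := (n : ℝ)) n.cast_nonneg
  have huniq : ∀ x (n k : ℕ) t, t ∈ Icc (0 : ℝ) n → t ∈ Icc (0 : ℝ) k → Z x n t = Z x k t := by
    intro x n k t hn hk
    obtain ⟨L, hL, h⟩ := hv.exists_dist_le t ‖x‖
    have := h (Z x n) (Z x k) (by rw [hZ0]) (by rw [hZ0]) t le_rfl
      (fun s hs => (hZ x n s ⟨hs.1, hs.2.trans hn.2⟩).mono (Icc_subset_Icc_right hn.2))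
      (fun s hs => (hZ x k s ⟨hs.1, hs.2.trans hk.2⟩).mono (Icc_subset_Icc_right hk.2))
      t ⟨hn.1, le_rfl⟩
    rw [hZ0, hZ0, dist_self, mul_zero] at this
    exact dist_le_zero.mp this
  -- For negative times the tangent line is used, so that the derivative at `0` is two-sided.
  let X : E → ℝ → E := fun x t => if 0 ≤ t then Z x (⌈t⌉₊) t else x + t • v 0 x
  have hXZ : ∀ x (n : ℕ) t, t ∈ Icc (0 : ℝ) n → X x t = Z x n t := by
    intro x n t ht
    have : X x t = Z x (⌈t⌉₊) t := by simp only [X, if_pos ht.1]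
    rw [this]
    exact huniq x _ _ t ⟨ht.1, Nat.le_ceil t⟩ ht
  have hX0 : ∀ x, X x 0 = x := fun x => by rw [hXZ x 0 0 (by simp), hZ0]
  have hXIcc : ∀ x (n : ℕ), ∀ t ∈ Icc (0 : ℝ) n,
      HasDerivWithinAt (X x) (v t (X x t)) (Icc 0 (n : ℝ)) t := by
    intro x n t ht
    have := hZ x n t ht
    rw [← hXZ x n t ht] at this
    exact this.congr (fun s hs => hXZ x n s hs) (hXZ x n t ht)
  refine ⟨X, hX0, fun x t ht => ?_, fun T R => ?_⟩
  · rcases ht.eq_or_lt with rfl | ht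
    · have h1 : HasDerivWithinAt (X x) (v 0 (X x 0)) (Ici 0) 0 := by
        have := hXIcc x 1 0 (by simp)
        refine hasDerivWithinAt_Ici_of_Icc (T := ((1 : ℕ) : ℝ)) (by simp) this
      have h2 : HasDerivWithinAt (X x) (v 0 (X x 0)) (Iic 0) 0 := by
        have h3 : HasDerivWithinAt (fun t : ℝ => x + t • v 0 x) (v 0 x) (Iic 0) 0 := by
          have := ((hasDerivAt_id (0 : ℝ)).smul_const (v 0 x)).const_add x
          simpa using this.hasDerivWithinAt
        rw [hX0]
        refine h3.congr (fun s hs => ?_) (by simp [hX0])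
        rcases (show s ≤ 0 from hs).eq_or_lt with rfl | hs
        · simp [hX0]
        · simp only [X, if_neg (not_le.mpr hs)]
      simpa using h1.union h2
    · have hlt : t < ((⌈t⌉₊ + 1 : ℕ) : ℝ) := by
        push_cast; linarith [Nat.le_ceil t]
      exact (hXIcc x (⌈t⌉₊ + 1) t ⟨ht.le, hlt.le⟩).hasDerivAt (Icc_mem_nhds ht hlt)
  · obtain ⟨L, hL, h⟩ := hv.exists_dist_le (⌈T⌉₊ : ℝ) R
    refine ⟨L, hL, fun x y hx hy t ht => ?_⟩
    have := h (X x) (X y) (by rwa [hX0]) (by rwa [hX0]) _ le_rfl (hXIcc x _) (hXIcc y _) t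
      ⟨ht.1, ht.2.trans (Nat.le_ceil T)⟩
    rwa [hX0, hX0] at this

end GlobalFlow

/-! ### The frozen first-order system and continuous dependence on `κ`. -/

section ProfileField

/-- The first-order system for `(f, f', f'', f ^ m f''')`, with `f ^ (-m)` frozen for `f ≤ 1`. -/
noncomputable def profileField (m t : ℝ) (X : ℝ × ℝ × ℝ × ℝ) : ℝ × ℝ × ℝ × ℝ :=
  (X.2.1, X.2.2.1, X.2.2.2 * (max X.1 1) ^ (-m), t * X.2.1 - X.1)

lemma abs_rpow_neg_sub_le {m x y : ℝ} (hm : 0 ≤ m) (hx : 1 ≤ x) (hy : 1 ≤ y) :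
    |x ^ (-m) - y ^ (-m)| ≤ m * |x - y| := by
  have := (convex_Ici (1 : ℝ)).norm_image_sub_le_of_norm_hasDerivWithin_le
    (f := fun x : ℝ => x ^ (-m)) (f' := fun x => -m * x ^ (-m - 1)) (C := m) (s := Ici 1)
    (x := y) (y := x) (fun z hz => by
      have hz : (1 : ℝ) ≤ z := hz
      exact (Real.hasDerivAt_rpow_const (Or.inl (by positivity))).hasDerivWithinAt)
    (fun z hz => by
      have hz : (1 : ℝ) ≤ z := hz
      rw [norm_mul, norm_neg, Real.norm_of_nonneg hm, Real.norm_of_nonneg (by positivity)]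
      exact mul_le_of_le_one_right hm (Real.rpow_le_one_of_one_le_of_nonpos hz (by linarith)))
    hy hx
  simpa using this

lemma rpow_neg_max_one_mem {m : ℝ} (hm : 0 ≤ m) (x : ℝ) :
    0 < (max x 1) ^ (-m) ∧ (max x 1) ^ (-m) ≤ 1 :=
  ⟨by positivity, Real.rpow_le_one_of_one_le_of_nonpos (le_max_right _ _) (by linarith)⟩

lemma norm_prod_four_le {a b c d r : ℝ} (ha : |a| ≤ r) (hb : |b| ≤ r) (hc : |c| ≤ r)
    (hd : |d| ≤ r) : ‖(a, b, c, d)‖ ≤ r := by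
  simp only [Prod.norm_def, Real.norm_eq_abs]
  exact max_le ha (max_le hb (max_le hc hd))

lemma abs_components_le (X : ℝ × ℝ × ℝ × ℝ) :
    |X.1| ≤ ‖X‖ ∧ |X.2.1| ≤ ‖X‖ ∧ |X.2.2.1| ≤ ‖X‖ ∧ |X.2.2.2| ≤ ‖X‖ := by
  simp only [Prod.norm_def, Real.norm_eq_abs]
  refine ⟨le_max_left _ _, ?_, ?_, ?_⟩ <;> simp

lemma profileField_isLinearGrowthField {m : ℝ} (hm : 0 ≤ m) :
    IsLinearGrowthField (profileField m) := by
  refine ⟨fun x => by unfold profileField; fun_prop, fun T R => ?_, fun T => ?_⟩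
  · refine ⟨(1 + |T| + |R| * m).toNNReal, fun t ht => LipschitzOnWith.of_dist_le_mul ?_⟩
    intro X hX Y hY
    rw [mem_closedBall_zero_iff] at hX hY
    rw [Real.coe_toNNReal _ (by positivity), dist_eq_norm, dist_eq_norm]
    obtain ⟨h1, h2, h3, h4⟩ := abs_components_le (X - Y)
    have hR : |Y.2.2.2| ≤ |R| := ((abs_components_le Y).2.2.2.trans hY).trans (le_abs_self R)
    simp only [Prod.fst_sub, Prod.snd_sub] at h1 h2 h3 h4
    set D := ‖X - Y‖
    have hD : 0 ≤ D := norm_nonneg _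
    have hT : |t| ≤ |T| := abs_le_abs_of_nonneg ht.1 ht.2
    have hTD : 0 ≤ |T| * D := by positivity
    have hRD : 0 ≤ |R| * m * D := by positivity
    refine norm_prod_four_le (a := X.2.1 - Y.2.1) (b := X.2.2.1 - Y.2.2.1)
      (c := X.2.2.2 * (max X.1 1) ^ (-m) - Y.2.2.2 * (max Y.1 1) ^ (-m))
      (d := (t * X.2.1 - X.1) - (t * Y.2.1 - Y.1)) ?_ ?_ ?_ ?_
    · nlinarith
    · nlinarith
    · have hr := abs_rpow_neg_sub_le hm (le_max_right X.1 1) (le_max_right Y.1 1)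
      have hmax : |max X.1 1 - max Y.1 1| ≤ |X.1 - Y.1| := abs_max_sub_max_le_abs _ _ _
      have hρ := rpow_neg_max_one_mem hm X.1
      have e : X.2.2.2 * (max X.1 1) ^ (-m) - Y.2.2.2 * (max Y.1 1) ^ (-m)
          = (X.2.2.2 - Y.2.2.2) * (max X.1 1) ^ (-m)
            + Y.2.2.2 * ((max X.1 1) ^ (-m) - (max Y.1 1) ^ (-m)) := by ring
      rw [e]
      refine (abs_add_le _ _).trans ?_
      rw [abs_mul, abs_mul, abs_of_pos hρ.1]
      have i1 : |X.2.2.2 - Y.2.2.2| * (max X.1 1) ^ (-m) ≤ D * 1 := by gcongr; exact hρ.2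
      have i2 : |Y.2.2.2| * |(max X.1 1) ^ (-m) - (max Y.1 1) ^ (-m)| ≤ |R| * (m * D) := by
        gcongr
        exact hr.trans (by gcongr; exact hmax.trans h1)
      nlinarith
    · have e : (t * X.2.1 - X.1) - (t * Y.2.1 - Y.1) = t * (X.2.1 - Y.2.1) - (X.1 - Y.1) := by ring
      rw [e]
      refine (abs_sub _ _).trans ?_
      rw [abs_mul]
      have i1 : |t| * |X.2.1 - Y.2.1| ≤ |T| * D := by gcongr
      nlinarith
  · refine ⟨1 + |T|, by positivity, fun t ht X => ?_⟩
    obtain ⟨h1, h2, h3, h4⟩ := abs_components_le X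
    have hD : 0 ≤ ‖X‖ := norm_nonneg _
    have hT : |t| ≤ |T| := abs_le_abs_of_nonneg ht.1 ht.2
    have hTD : 0 ≤ |T| * ‖X‖ := by positivity
    refine norm_prod_four_le ?_ ?_ ?_ ?_
    · nlinarith
    · nlinarith
    · have hρ := rpow_neg_max_one_mem hm X.1
      rw [abs_mul, abs_of_pos hρ.1]
      have : |X.2.2.2| * (max X.1 1) ^ (-m) ≤ ‖X‖ * 1 := by gcongr; exact hρ.2
      nlinarith
    · refine (abs_sub _ _).trans ?_
      rw [abs_mul]
      have i1 : |t| * |X.2.1| ≤ |T| * ‖X‖ := by gcongr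
      nlinarith

lemma exists_ballRetraction_prod_four (R : ℝ) (hR : 0 < R) :
    ∃ P : ℝ × ℝ × ℝ × ℝ → ℝ × ℝ × ℝ × ℝ, IsBallRetraction R P := by
  let c : ℝ → ℝ := fun x => max (-R) (min R x)
  have hc : LipschitzWith 1 c := (LipschitzWith.id.const_min R).const_max (-R)
  have hcR : ∀ x, |c x| ≤ R := fun x =>
    abs_le.mpr ⟨le_max_left _ _, max_le (by linarith) (min_le_left _ _)⟩
  have hcx : ∀ x, |x| ≤ R → c x = x := fun x hx => by
    obtain ⟨h1, h2⟩ := abs_le.mp hx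
    simp [c, h1, h2]
  refine ⟨fun X => (c X.1, c X.2.1, c X.2.2.1, c X.2.2.2), ?_, fun X => ?_, fun X hX => ?_⟩
  · refine LipschitzWith.of_dist_le_mul fun X Y => ?_
    rw [NNReal.coe_one, one_mul, dist_eq_norm, dist_eq_norm]
    obtain ⟨h1, h2, h3, h4⟩ := abs_components_le (X - Y)
    have hl : ∀ x y, |c x - c y| ≤ |x - y| := fun x y => by
      simpa [Real.dist_eq] using hc.dist_le_mul x y
    exact norm_prod_four_le ((hl _ _).trans h1) ((hl _ _).trans h2) ((hl _ _).trans h3)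
      ((hl _ _).trans h4)
  · exact norm_prod_four_le (hcR _) (hcR _) (hcR _) (hcR _)
  · obtain ⟨h1, h2, h3, h4⟩ := abs_components_le X
    ext
    · exact hcx _ (h1.trans hX)
    · exact hcx _ (h2.trans hX)
    · exact hcx _ (h3.trans hX)
    · exact hcx _ (h4.trans hX)

/-- `(f, p, u, g)` is a trajectory on `[0,∞)` of the frozen system with `f'' 0 = κ`. -/
structure IsProfileFlow (m κ : ℝ) (f p u g : ℝ → ℝ) : Prop where
  hf : ∀ t, 0 ≤ t → HasDerivAt f (p t) t
  hp : ∀ t, 0 ≤ t → HasDerivAt p (u t) t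
  hu : ∀ t, 0 ≤ t → HasDerivAt u (g t * (max (f t) 1) ^ (-m)) t
  hg : ∀ t, 0 ≤ t → HasDerivAt g (t * p t - f t) t
  f0 : f 0 = 1
  p0 : p 0 = 0
  u0 : u 0 = κ
  g0 : g 0 = 0

/-- Trajectories exist for every `κ` and depend continuously on it, uniformly on `[0,T]`. -/
lemma exists_profileFlow {m : ℝ} (hm : 0 ≤ m) :
    ∃ f p u g : ℝ → ℝ → ℝ, (∀ κ, IsProfileFlow m κ (f κ) (p κ) (u κ) (g κ)) ∧
      ∀ T κ₀ ε : ℝ, 0 < ε → ∀ᶠ κ in 𝓝 κ₀, ∀ t ∈ Icc 0 T,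
        |f κ t - f κ₀ t| < ε ∧ |p κ t - p κ₀ t| < ε ∧ |u κ t - u κ₀ t| < ε ∧
          |g κ t - g κ₀ t| < ε := by
  obtain ⟨X, hX0, hX, hL⟩ :=
    (profileField_isLinearGrowthField hm).exists_flow exists_ballRetraction_prod_four
  let x : ℝ → ℝ × ℝ × ℝ × ℝ := fun κ => (1, 0, κ, 0)
  refine ⟨fun κ t => (X (x κ) t).1, fun κ t => (X (x κ) t).2.1, fun κ t => (X (x κ) t).2.2.1,
    fun κ t => (X (x κ) t).2.2.2, fun κ => ⟨fun t ht => ?_, fun t ht => ?_, fun t ht => ?_,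
    fun t ht => ?_, ?_, ?_, ?_, ?_⟩, ?_⟩
  · exact (hX (x κ) t ht).fst
  · exact (hX (x κ) t ht).snd.fst
  · exact (hX (x κ) t ht).snd.snd.fst
  · exact (hX (x κ) t ht).snd.snd.snd
  · simp [hX0, x]
  · simp [hX0, x]
  · simp [hX0, x]
  · simp [hX0, x]
  · intro T κ₀ ε hε
    obtain ⟨L, hLpos, hL⟩ := hL T (|κ₀| + 2)
    filter_upwards [Metric.ball_mem_nhds κ₀ (show 0 < min 1 (ε / L) by positivity)] with κ hκ t ht
    rw [Metric.mem_ball, Real.dist_eq, lt_min_iff] at hκ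
    have hn : ∀ k : ℝ, |k| ≤ |κ₀| + 1 → ‖x k‖ ≤ |κ₀| + 2 := fun k hk =>
      norm_prod_four_le (by simpa using by linarith [abs_nonneg κ₀])
        (by simpa using by linarith [abs_nonneg κ₀]) (by linarith)
        (by simpa using by linarith [abs_nonneg κ₀])
    have h1 : |κ| ≤ |κ₀| + 1 := by
      have := abs_sub_abs_le_abs_sub κ κ₀
      linarith [hκ.1]
    have h := hL (x κ) (x κ₀) (hn κ h1) (hn κ₀ (by linarith)) t ht
    have hd : dist (x κ) (x κ₀) ≤ |κ - κ₀| := by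
      rw [dist_eq_norm]
      exact norm_prod_four_le (by change |(1 : ℝ) - 1| ≤ _; simp) (by change |(0 : ℝ) - 0| ≤ _; simp)
        le_rfl (by change |(0 : ℝ) - 0| ≤ _; simp)
    rw [dist_eq_norm] at h
    have hlt : L * dist (x κ) (x κ₀) < ε := by
      calc L * dist (x κ) (x κ₀) ≤ L * |κ - κ₀| := by gcongr
        _ < L * (ε / L) := by gcongr; exact hκ.2
        _ = ε := by field_simp
    obtain ⟨h1, h2, h3, h4⟩ := abs_components_le (X (x κ) t - X (x κ₀) t)
    have hlt' := h.trans_lt hlt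
    exact ⟨h1.trans_lt hlt', h2.trans_lt hlt', h3.trans_lt hlt', h4.trans_lt hlt'⟩

end ProfileField

/-! ### Monotonicity and first zeros. -/

section Calculus

variable {φ φ' : ℝ → ℝ} {a b : ℝ}

lemma le_of_hasDerivAt_nonneg (hab : a ≤ b) (hd : ∀ t ∈ Icc a b, HasDerivAt φ (φ' t) t)
    (h : ∀ t ∈ Ioo a b, 0 ≤ φ' t) : φ a ≤ φ b := by
  have : MonotoneOn φ (Icc a b) := by
    refine monotoneOn_of_hasDerivWithinAt_nonneg (f' := φ') (convex_Icc a b)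
      (fun t ht => (hd t ht).continuousAt.continuousWithinAt) (fun t ht => ?_) (fun t ht => ?_)
    · rw [interior_Icc] at ht
      exact (hd t (Ioo_subset_Icc_self ht)).hasDerivWithinAt
    · rw [interior_Icc] at ht; exact h t ht
  exact this (left_mem_Icc.mpr hab) (right_mem_Icc.mpr hab) hab

lemma lt_of_hasDerivAt_pos (hab : a < b) (hd : ∀ t ∈ Icc a b, HasDerivAt φ (φ' t) t)
    (h : ∀ t ∈ Ioo a b, 0 < φ' t) : φ a < φ b := by
  have : StrictMonoOn φ (Icc a b) := by
    refine strictMonoOn_of_hasDerivWithinAt_pos (f' := φ') (convex_Icc a b)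
      (fun t ht => (hd t ht).continuousAt.continuousWithinAt) (fun t ht => ?_) (fun t ht => ?_)
    · rw [interior_Icc] at ht
      exact (hd t (Ioo_subset_Icc_self ht)).hasDerivWithinAt
    · rw [interior_Icc] at ht; exact h t ht
  exact this (left_mem_Icc.mpr hab.le) (right_mem_Icc.mpr hab.le) hab

/-- A function positive at `a` but not at `b` has a first zero in between. -/
lemma exists_first_zero (hc : ContinuousOn φ (Icc a b)) (hab : a ≤ b) (ha : 0 < φ a)
    (hb : φ b ≤ 0) : ∃ c ∈ Ioc a b, φ c = 0 ∧ ∀ t ∈ Ico a c, 0 < φ t := by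
  let S : Set ℝ := Icc a b ∩ φ ⁻¹' Iic 0
  have hS : IsClosed S := hc.preimage_isClosed_of_isClosed isClosed_Icc isClosed_Iic
  have hne : S.Nonempty := ⟨b, right_mem_Icc.mpr hab, hb⟩
  have hbdd : BddBelow S := ⟨a, fun x hx => hx.1.1⟩
  have hc' := hS.csInf_mem hne hbdd
  set c := sInf S
  have hpos : ∀ t ∈ Ico a c, 0 < φ t := by
    intro t ht
    by_contra hle
    have : t ∈ S := ⟨⟨ht.1, ht.2.le.trans hc'.1.2⟩, not_lt.mp hle⟩
    exact absurd (csInf_le hbdd this) (not_le.mpr ht.2)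
  have hac : a < c := lt_of_le_of_ne hc'.1.1 (fun h => by
    have := hc'.2
    rw [← h] at this
    exact absurd ha (not_lt.mpr this))
  refine ⟨c, ⟨hac, hc'.1.2⟩, le_antisymm hc'.2 ?_, hpos⟩
  have hcw : ContinuousWithinAt φ (Ico a c) c :=
    (hc c hc'.1).mono (fun t ht => ⟨ht.1, ht.2.le.trans hc'.1.2⟩)
  have : (𝓝[Ico a c] c).NeBot := by
    rw [← mem_closure_iff_nhdsWithin_neBot, closure_Ico hac.ne]
    exact right_mem_Icc.mpr hac.le
  exact ge_of_tendsto hcw (by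
    filter_upwards [self_mem_nhdsWithin] with t ht using (hpos t ht).le)

/-- Continuous induction for positivity. -/
lemma pos_of_bootstrap (hc : ContinuousOn φ (Icc a b)) (ha : 0 < φ a)
    (step : ∀ t ∈ Ioc a b, (∀ s ∈ Ico a t, 0 < φ s) → 0 < φ t) : ∀ t ∈ Icc a b, 0 < φ t := by
  intro t ht
  by_contra hle
  obtain ⟨c, hc1, hc2, hc3⟩ := exists_first_zero (hc.mono (Icc_subset_Icc_right ht.2)) ht.1 ha
    (not_lt.mp hle)
  have := step c ⟨hc1.1, hc1.2.trans ht.2⟩ hc3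
  linarith

end Calculus

/-! ### Invariant octants of the cyclic system. -/

section Triad

/-- The cyclic positive-feedback system `h' = t u`, `u' = r g`, `g' = h` on `[0,∞)` with `r > 0`. -/
structure IsTriad (r h u g : ℝ → ℝ) : Prop where
  hr : ∀ t, 0 ≤ t → 0 < r t
  hh : ∀ t, 0 ≤ t → HasDerivAt h (t * u t) t
  hu : ∀ t, 0 ≤ t → HasDerivAt u (g t * r t) t
  hg : ∀ t, 0 ≤ t → HasDerivAt g (h t) t

variable {r h u g : ℝ → ℝ} {T t : ℝ}

lemma IsTriad.neg (H : IsTriad r h u g) : IsTriad r (-h) (-u) (-g) where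
  hr := H.hr
  hh t ht := by simpa using (H.hh t ht).neg
  hu t ht := by simpa using (H.hu t ht).neg
  hg t ht := by simpa using (H.hg t ht).neg

lemma IsTriad.continuousOn (H : IsTriad r h u g) {s : Set ℝ} (hs : s ⊆ Ici 0) :
    ContinuousOn h s ∧ ContinuousOn u s ∧ ContinuousOn g s :=
  ⟨fun t ht => (H.hh t (hs ht)).continuousAt.continuousWithinAt,
    fun t ht => (H.hu t (hs ht)).continuousAt.continuousWithinAt,
    fun t ht => (H.hg t (hs ht)).continuousAt.continuousWithinAt⟩

/-- The positive octant is forward invariant, and the three components increase in it. -/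
lemma IsTriad.mono_of_pos (H : IsTriad r h u g) (hT : 0 ≤ T) (h0 : 0 < h T) (u0 : 0 < u T)
    (g0 : 0 < g T) (ht : T ≤ t) : h T ≤ h t ∧ u T ≤ u t ∧ g T ≤ g t := by
  have key : ∀ s, T ≤ s → (∀ x ∈ Ioo T s, 0 < h x ∧ 0 < u x ∧ 0 < g x) →
      h T ≤ h s ∧ u T ≤ u s ∧ g T ≤ g s := by
    intro s hs hx
    have hI : ∀ x ∈ Icc T s, 0 ≤ x := fun x hx => hT.trans hx.1
    refine ⟨le_of_hasDerivAt_nonneg hs (fun x hx => H.hh x (hI x hx)) fun x hx' => ?_,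
      le_of_hasDerivAt_nonneg hs (fun x hx => H.hu x (hI x hx)) fun x hx' => ?_,
      le_of_hasDerivAt_nonneg hs (fun x hx => H.hg x (hI x hx)) fun x hx' => ?_⟩
    · exact mul_nonneg (hT.trans hx'.1.le) (hx x hx').2.1.le
    · exact mul_nonneg (hx x hx').2.2.le (H.hr x (hT.trans hx'.1.le)).le
    · exact (hx x hx').1.le
  have hcont := H.continuousOn (s := Icc T t) (fun x hx => hT.trans hx.1)
  have hpos := pos_of_bootstrap (φ := fun s => min (h s) (min (u s) (g s))) (a := T) (b := t)
    (ContinuousOn.inf hcont.1 (ContinuousOn.inf hcont.2.1 hcont.2.2)) (by simp [h0, u0, g0]) (fun s hs hx => by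
      have := key s hs.1.le (fun x hx' => by simpa using hx x ⟨hx'.1.le, hx'.2⟩)
      simp only [lt_min_iff]
      exact ⟨by linarith, by linarith, by linarith⟩)
  exact key t ht (fun x hx => by simpa using hpos x ⟨hx.1.le, hx.2.le⟩)

/-- From the closed octant minus the origin a trajectory enters the open octant at once. -/
lemma IsTriad.pos_of_nonneg (H : IsTriad r h u g) (hT : 0 ≤ T) (h0 : 0 ≤ h T) (u0 : 0 ≤ u T)
    (g0 : 0 ≤ g T) (hne : 0 < h T ∨ 0 < u T ∨ 0 < g T) (ht : T < t) :
    0 < h t ∧ 0 < u t ∧ 0 < g t := by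
  have pos_near : ∀ φ : ℝ → ℝ, ContinuousAt φ T → 0 < φ T →
      ∃ d > T, d ≤ t ∧ ∀ x ∈ Icc T d, 0 < φ x := by
    intro φ hφ hpos
    obtain ⟨ε, hε, hball⟩ := Metric.eventually_nhds_iff.mp (hφ.eventually (lt_mem_nhds hpos))
    refine ⟨min t (T + ε / 2), lt_min ht (by linarith), min_le_left _ _, fun x hx => hball ?_⟩
    rw [Real.dist_eq, abs_of_nonneg (by linarith [hx.1])]
    linarith [hx.2, min_le_right t (T + ε / 2)]
  have stepH : ∀ d > T, (∀ x ∈ Ioc T d, 0 < u x) → ∀ x ∈ Ioc T d, 0 < h x := fun d hd hx x hxd =>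
    h0.trans_lt (lt_of_hasDerivAt_pos hxd.1 (fun y hy => H.hh y (hT.trans hy.1)) fun y hy =>
      mul_pos (hT.trans_lt hy.1) (hx y ⟨hy.1, hy.2.le.trans hxd.2⟩))
  have stepU : ∀ d > T, (∀ x ∈ Ioc T d, 0 < g x) → ∀ x ∈ Ioc T d, 0 < u x := fun d hd hx x hxd =>
    u0.trans_lt (lt_of_hasDerivAt_pos hxd.1 (fun y hy => H.hu y (hT.trans hy.1)) fun y hy =>
      mul_pos (hx y ⟨hy.1, hy.2.le.trans hxd.2⟩) (H.hr y (hT.trans hy.1.le)))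
  have stepG : ∀ d > T, (∀ x ∈ Ioc T d, 0 < h x) → ∀ x ∈ Ioc T d, 0 < g x := fun d hd hx x hxd =>
    g0.trans_lt (lt_of_hasDerivAt_pos hxd.1 (fun y hy => H.hg y (hT.trans hy.1)) fun y hy =>
      hx y ⟨hy.1, hy.2.le.trans hxd.2⟩)
  -- One positive component suffices: positivity passes around the cycle `h → g → u → h`.
  have main : ∃ d > T, d ≤ t ∧ 0 < h d ∧ 0 < u d ∧ 0 < g d := by
    rcases hne with hh | hu | hg
    · obtain ⟨d, hd, hdt, hx⟩ := pos_near h (H.hh T hT).continuousAt hh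
      have h1 : ∀ x ∈ Ioc T d, 0 < h x := fun x hx' => hx x ⟨hx'.1.le, hx'.2⟩
      have h2 := stepG d hd h1
      exact ⟨d, hd, hdt, h1 d ⟨hd, le_rfl⟩, stepU d hd h2 d ⟨hd, le_rfl⟩, h2 d ⟨hd, le_rfl⟩⟩
    · obtain ⟨d, hd, hdt, hx⟩ := pos_near u (H.hu T hT).continuousAt hu
      have h1 : ∀ x ∈ Ioc T d, 0 < u x := fun x hx' => hx x ⟨hx'.1.le, hx'.2⟩
      have h2 := stepH d hd h1
      exact ⟨d, hd, hdt, h2 d ⟨hd, le_rfl⟩, h1 d ⟨hd, le_rfl⟩, stepG d hd h2 d ⟨hd, le_rfl⟩⟩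
    · obtain ⟨d, hd, hdt, hx⟩ := pos_near g (H.hg T hT).continuousAt hg
      have h1 : ∀ x ∈ Ioc T d, 0 < g x := fun x hx' => hx x ⟨hx'.1.le, hx'.2⟩
      have h2 := stepU d hd h1
      exact ⟨d, hd, hdt, stepH d hd h2 d ⟨hd, le_rfl⟩, h2 d ⟨hd, le_rfl⟩, h1 d ⟨hd, le_rfl⟩⟩
  obtain ⟨d, hd, hdt, hhd, hud, hgd⟩ := main
  have := H.mono_of_pos (hT.trans hd.le) hhd hud hgd hdt
  exact ⟨by linarith, by linarith, by linarith⟩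

lemma IsTriad.neg_of_nonpos (H : IsTriad r h u g) (hT : 0 ≤ T) (h0 : h T ≤ 0) (u0 : u T ≤ 0)
    (g0 : g T ≤ 0) (hne : h T < 0 ∨ u T < 0 ∨ g T < 0) (ht : T < t) :
    h t < 0 ∧ u t < 0 ∧ g t < 0 := by
  have := H.neg.pos_of_nonneg hT (by simpa using h0) (by simpa using u0) (by simpa using g0)
    (by simpa using hne) ht
  simpa using this

end Triad

/-! ### Shooting in `κ`. -/

section Shooting

variable {m κ : ℝ} {f p u g : ℝ → ℝ}

lemma IsProfileFlow.triad (H : IsProfileFlow m κ f p u g) :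
    IsTriad (fun t => (max (f t) 1) ^ (-m)) (fun t => t * p t - f t) u g where
  hr t _ := by positivity
  hh t ht := by
    have := ((hasDerivAt_id t).mul (H.hp t ht)).sub (H.hf t ht)
    refine this.congr_deriv ?_
    simp
  hu t ht := H.hu t ht
  hg t ht := H.hg t ht

lemma IsProfileFlow.h0 (H : IsProfileFlow m κ f p u g) : 0 * p 0 - f 0 = -1 := by
  rw [H.f0]; ring

/-- The initial lower bounds, valid as long as the bound for `f''` is positive. -/
lemma IsProfileFlow.initial_bounds (H : IsProfileFlow m κ f p u g) (hm : 0 ≤ m) (hκ : 0 < κ)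
    {t : ℝ} (ht0 : 0 ≤ t) (ht : t ^ 2 < 2 * κ) :
    0 < u t ∧ κ - t ^ 2 / 2 ≤ u t ∧ -1 + κ * t ^ 2 / 2 - t ^ 4 / 8 ≤ t * p t - f t ∧
      -t + κ * t ^ 3 / 6 - t ^ 5 / 40 ≤ g t := by
  have tri := H.triad
  -- As long as `u > 0`, `h` increases from `-1`; hence `g ≥ -t`, and `u' ≥ -t` because `r ≤ 1`.
  have ubd : ∀ s, 0 ≤ s → s ≤ t → (∀ x ∈ Ico 0 s, 0 < u x) → κ - s ^ 2 / 2 ≤ u s := by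
    intro s hs hst hx
    have hh : ∀ x ∈ Icc 0 s, -1 ≤ x * p x - f x := by
      intro x hxs
      rw [← H.h0]
      exact le_of_hasDerivAt_nonneg hxs.1 (fun y hy => tri.hh y hy.1) fun y hy =>
        mul_nonneg hy.1.le (hx y ⟨hy.1.le, hy.2.trans_le hxs.2⟩).le
    have hg : ∀ x ∈ Icc 0 s, -x ≤ g x := by
      intro x hxs
      have := le_of_hasDerivAt_nonneg (φ := fun y => g y + y) hxs.1
        (fun y hy => (H.hg y hy.1).add (hasDerivAt_id y)) fun y hy => by
          linarith [hh y ⟨hy.1.le, hy.2.le.trans hxs.2⟩]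
      simp only [H.g0] at this
      linarith
    have := le_of_hasDerivAt_nonneg (φ := fun y => u y + y ^ 2 / 2) hs
      (fun y hy => (H.hu y hy.1).add ((hasDerivAt_pow 2 y).div_const 2)) fun y hy => by
        have hρ := rpow_neg_max_one_mem hm (f y)
        have := hg y ⟨hy.1.le, hy.2.le⟩
        have h3 : 0 < y := hy.1
        simp only [Nat.cast_ofNat, Nat.reduceSub, pow_one]
        nlinarith
    simp only [H.u0] at this
    linarith
  have upos : ∀ s ∈ Icc 0 t, 0 < u s := by
    refine pos_of_bootstrap (tri.continuousOn (fun x hx => hx.1)).2.1 (by rw [H.u0]; exact hκ) ?_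
    intro s hs hx
    have := ubd s hs.1.le hs.2 hx
    have : s ^ 2 ≤ t ^ 2 := by nlinarith [hs.1, hs.2]
    linarith
  have ubd' : ∀ s ∈ Icc 0 t, κ - s ^ 2 / 2 ≤ u s := fun s hs =>
    ubd s hs.1 hs.2 (fun x hx => upos x ⟨hx.1, hx.2.le.trans hs.2⟩)
  have hbd : ∀ s ∈ Icc 0 t, -1 + κ * s ^ 2 / 2 - s ^ 4 / 8 ≤ s * p s - f s := by
    intro s hs
    have := le_of_hasDerivAt_nonneg (φ := fun y => (y * p y - f y) - (κ / 2 * y ^ 2 - y ^ 4 / 8)) hs.1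
      (fun y hy => (tri.hh y hy.1).sub (((hasDerivAt_pow 2 y).const_mul (κ / 2)).sub
        ((hasDerivAt_pow 4 y).div_const 8))) fun y hy => by
        have := ubd' y ⟨hy.1.le, hy.2.le.trans hs.2⟩
        have h3 : 0 < y := hy.1
        norm_num
        nlinarith
    simp only [H.h0] at this
    norm_num at this
    linarith
  have gbd : -t + κ * t ^ 3 / 6 - t ^ 5 / 40 ≤ g t := by
    have := le_of_hasDerivAt_nonneg (φ := fun y => g y - (κ / 6 * y ^ 3 - y ^ 5 / 40 - y)) ht0
      (fun y hy => (H.hg y hy.1).sub ((((hasDerivAt_pow 3 y).const_mul (κ / 6)).sub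
        ((hasDerivAt_pow 5 y).div_const 40)).sub (hasDerivAt_id y))) fun y hy => by
        have := hbd y ⟨hy.1.le, hy.2.le⟩
        norm_num
        linarith
    simp only [H.g0] at this
    norm_num at this
    linarith
  exact ⟨upos t ⟨ht0, le_rfl⟩, ubd' t ⟨ht0, le_rfl⟩, hbd t ⟨ht0, le_rfl⟩, gbd⟩

/-- The two shooting conditions both fail for some `κ ∈ (0,√12)`. -/
lemma exists_neutral_profileFlow (hm : 0 < m) :
    ∃ κ ∈ Ioo 0 (Real.sqrt 12), ∃ f p u g : ℝ → ℝ, IsProfileFlow m κ f p u g ∧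
      (∀ t, 0 ≤ t → 0 ≤ p t) ∧
      ∀ T > 0, (∀ t ∈ Ioc 0 T, 0 < p t) → ¬ (0 < T * p T - f T ∧ 0 < u T ∧ 0 < g T) := by
  obtain ⟨f, p, u, g, H, hcont⟩ := exists_profileFlow hm.le
  let A : Set ℝ := {κ | ∃ T > 0, p κ T < 0}
  let B : Set ℝ := {κ | 0 < κ ∧ ∃ T > 0, (∀ t ∈ Ioc 0 T, 0 < p κ t) ∧
    (0 < T * p κ T - f κ T ∧ 0 < u κ T ∧ 0 < g κ T)}
  have hA : IsOpen A := by
    rw [isOpen_iff_mem_nhds]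
    rintro κ₀ ⟨T, hT, hp⟩
    filter_upwards [hcont T κ₀ (-p κ₀ T) (by linarith)] with κ hκ
    refine ⟨T, hT, ?_⟩
    have := (abs_lt.mp (hκ T ⟨hT.le, le_rfl⟩).2.1).2
    linarith
  have hB : IsOpen B := by
    rw [isOpen_iff_mem_nhds]
    rintro κ₀ ⟨hκ₀, T, hT, hp, hh, hu, hg⟩
    have hH := H κ₀
    -- Since `p 0 = 0`, positivity of `p` near `0` has to come from a lower bound for `u`; a uniform
    -- bound for `p` is available only on `[d, T]`.
    obtain ⟨δ, hδ, hball⟩ := Metric.eventually_nhds_iff.mp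
      ((hH.hu 0 le_rfl).continuousAt.eventually (lt_mem_nhds (show κ₀ / 2 < u κ₀ 0 by
        rw [hH.u0]; linarith)))
    set d := min T (δ / 2)
    have hd : 0 < d := lt_min hT (by linarith)
    have hdT : d ≤ T := min_le_left _ _
    have hud : ∀ t ∈ Icc 0 d, κ₀ / 2 < u κ₀ t := fun t ht => hball (by
      rw [Real.dist_eq, sub_zero, abs_of_nonneg ht.1]
      linarith [ht.2, min_le_right T (δ / 2)])
    obtain ⟨η, hη, hpη⟩ : ∃ η > 0, ∀ t ∈ Icc d T, η ≤ p κ₀ t := by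
      obtain ⟨x, hx, hmin⟩ := isCompact_Icc.exists_isMinOn (nonempty_Icc.mpr hdT)
        (fun t (ht : t ∈ Icc d T) => (hH.hp t (hd.le.trans ht.1)).continuousAt.continuousWithinAt)
      exact ⟨p κ₀ x, hp x ⟨hd.trans_le hx.1, hx.2⟩, fun t ht => hmin ht⟩
    -- A perturbation of `p` and `f` by `ε` moves `T * p T - f T` by at most `(T + 1) * ε`.
    set ε := min (min η (κ₀ / 2)) (min (u κ₀ T) (min (g κ₀ T) ((T * p κ₀ T - f κ₀ T) / (T + 1))))
    have hε : 0 < ε := by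
      refine lt_min (lt_min hη (by linarith)) (lt_min hu (lt_min hg (by positivity)))
    have e1 : ε ≤ η := (min_le_left _ _).trans (min_le_left _ _)
    have e2 : ε ≤ κ₀ / 2 := (min_le_left _ _).trans (min_le_right _ _)
    have e3 : ε ≤ u κ₀ T := (min_le_right _ _).trans (min_le_left _ _)
    have e4 : ε ≤ g κ₀ T := (min_le_right _ _).trans ((min_le_right _ _).trans (min_le_left _ _))
    have e5 : ε ≤ (T * p κ₀ T - f κ₀ T) / (T + 1) :=
      (min_le_right _ _).trans ((min_le_right _ _).trans (min_le_right _ _))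
    rw [le_div_iff₀ (by linarith)] at e5
    filter_upwards [hcont T κ₀ ε hε, lt_mem_nhds hκ₀] with κ hκ hκpos
    have hHκ := H κ
    refine ⟨hκpos, T, hT, fun t ht => ?_, ?_⟩
    · rcases le_or_gt t d with htd | htd
      · have := lt_of_hasDerivAt_pos ht.1 (fun y hy => hHκ.hp y hy.1) fun y hy => by
          have h1 := hud y ⟨hy.1.le, hy.2.le.trans htd⟩
          have h2 := (abs_lt.mp (hκ y ⟨hy.1.le, hy.2.le.trans ht.2⟩).2.2.1).1
          linarith
        rwa [hHκ.p0] at this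
      · have h1 := hpη t ⟨htd.le, ht.2⟩
        have h2 := (abs_lt.mp (hκ t ⟨ht.1.le, ht.2⟩).2.1).1
        linarith
    · obtain ⟨k1, k2, k3, k4⟩ := hκ T ⟨hT.le, le_rfl⟩
      rw [abs_lt] at k1 k2 k3 k4
      refine ⟨?_, by linarith, by linarith⟩
      have hT' : 0 < T := hT
      nlinarith
  have hAB : Disjoint A B := by
    rw [Set.disjoint_left]
    rintro κ ⟨T, hT, hpT⟩ ⟨hκ, S, hS, hp, hh, hu, hg⟩
    have hHκ := H κ
    rcases le_or_gt T S with hTS | hTS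
    · exact absurd (hp T ⟨hT, hTS⟩) (not_lt.mpr hpT.le)
    · have := le_of_hasDerivAt_nonneg hTS.le (fun y hy => hHκ.hp y (hS.le.trans hy.1)) fun y hy => by
        have := (hHκ.triad.mono_of_pos hS.le hh hu hg hy.1.le).2.1
        linarith
      have := hp S ⟨hS, le_rfl⟩
      linarith
  -- For `κ = 0` the orbit starts at `(-1, 0, 0)`, on the boundary of the negative octant.
  have h0A : (0 : ℝ) ∈ A := by
    refine ⟨1, one_pos, ?_⟩
    have hH0 := H 0
    have hn : ∀ t > 0, u 0 t < 0 := fun t ht =>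
      (hH0.triad.neg_of_nonpos le_rfl (by rw [hH0.h0]; norm_num) (by rw [hH0.u0])
        (by rw [hH0.g0]) (Or.inl (by rw [hH0.h0]; norm_num)) ht).2.1
    have := lt_of_hasDerivAt_pos (φ := fun t => -p 0 t) (one_pos (α := ℝ))
      (fun y hy => (hH0.hp y hy.1).neg) fun y hy => by linarith [hn y hy.1]
    simp only [hH0.p0] at this
    linarith
  have hsq : Real.sqrt 12 ^ 2 = 12 := Real.sq_sqrt (by norm_num)
  have hs0 : 0 < Real.sqrt 12 := by positivity
  have hB12 : Real.sqrt 12 ∈ B := by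
    set k := Real.sqrt 12
    have hHk := H k
    -- With `T ^ 2 = k` and `k ^ 2 = 12`, the initial bounds give `h T ≥ 7 / 2` and `g T ≥ 7 / 10 *
    -- T`.
    set T := Real.sqrt k
    have hT : 0 < T := Real.sqrt_pos.mpr hs0
    have hT2 : T ^ 2 = k := Real.sq_sqrt hs0.le
    obtain ⟨b1, b2, b3, b4⟩ := hHk.initial_bounds hm.le hs0 hT.le (by rw [hT2]; linarith)
    refine ⟨hs0, T, hT, fun t ht => ?_, ?_, b1, ?_⟩
    · have := lt_of_hasDerivAt_pos ht.1 (fun y hy => hHk.hp y hy.1) fun y hy =>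
        (hHk.initial_bounds hm.le hs0 hy.1.le (by nlinarith [hy.1, hy.2, ht.2])).1
      rwa [hHk.p0] at this
    · have e4 : T ^ 4 = 12 := by rw [← hsq, ← hT2]; ring
      rw [hT2, e4] at b3
      nlinarith
    · have e5 : T ^ 5 = 12 * T := by rw [← hsq, ← hT2]; ring
      have e3 : k * T ^ 3 = 12 * T := by rw [← hsq, ← hT2]; ring
      rw [e3, e5] at b4
      linarith
  by_contra hcon
  have hcover : Icc 0 (Real.sqrt 12) ⊆ A ∪ B := by
    intro κ hκ
    by_contra hn
    rw [mem_union, not_or] at hn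
    have hne0 : κ ≠ 0 := fun h => hn.1 (h ▸ h0A)
    have hne1 : κ ≠ Real.sqrt 12 := fun h => hn.2 (h ▸ hB12)
    have hκ0 : 0 < κ := lt_of_le_of_ne hκ.1 (Ne.symm hne0)
    refine hcon ⟨κ, ⟨hκ0, lt_of_le_of_ne hκ.2 hne1⟩, f κ, p κ, u κ, g κ,
      H κ, fun t ht => ?_, fun T hT hp hoct => hn.2 ⟨hκ0, T, hT, hp, hoct⟩⟩
    by_contra hneg
    rcases ht.eq_or_lt with h | h
    · rw [← h, (H κ).p0] at hneg; exact hneg le_rfl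
    · exact hn.1 ⟨t, h, not_le.mp hneg⟩
  have := isPreconnected_Icc.subset_or_subset hA hB hAB hcover
  rcases this with h | h
  · exact Set.disjoint_left.mp hAB (h ⟨hs0.le, le_rfl⟩) hB12
  · exact Set.disjoint_left.mp hAB h0A (h ⟨le_rfl, hs0.le⟩)

end Shooting

/-! ### Neutral trajectories and the Lyapunov function. -/

section Neutral

/-- A trajectory with `f' ≥ 0` that does not enter the positive octant of `(h, u, g)` while
`f' > 0`. Here `p = f'`, `u = f''`, `r = f ^ (-m)`, `g = f ^ m f'''` and `h = t f' - f`. -/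
structure IsNeutral (m κ : ℝ) (f p u g h r : ℝ → ℝ) : Prop where
  hm : 0 < m
  hκ : 0 < κ
  hf : ∀ t, 0 ≤ t → HasDerivAt f (p t) t
  hp : ∀ t, 0 ≤ t → HasDerivAt p (u t) t
  hu : ∀ t, 0 ≤ t → HasDerivAt u (g t * r t) t
  hg : ∀ t, 0 ≤ t → HasDerivAt g (h t) t
  h_eq : ∀ t, h t = t * p t - f t
  r_eq : ∀ t, r t = f t ^ (-m)
  f0 : f 0 = 1
  p0 : p 0 = 0
  u0 : u 0 = κ
  g0 : g 0 = 0
  p_nonneg : ∀ t, 0 ≤ t → 0 ≤ p t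
  no_pos : ∀ T > 0, (∀ t ∈ Ioc 0 T, 0 < p t) → ¬ (0 < h T ∧ 0 < u T ∧ 0 < g T)

/-- The Lyapunov function. -/
noncomputable def lyap (u g h r : ℝ → ℝ) (t : ℝ) : ℝ :=
  t * (h t * u t - g t ^ 2 * r t / 2) - 3 / 4 * h t ^ 2 / t + u t * g t / 2

lemma exists_isNeutral {m : ℝ} (hm : 0 < m) :
    ∃ κ ∈ Ioo 0 (Real.sqrt 12), ∃ f p u g h r : ℝ → ℝ, IsNeutral m κ f p u g h r := by
  obtain ⟨κ, hκ, f, p, u, g, H, hp, hn⟩ := exists_neutral_profileFlow hm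
  refine ⟨κ, hκ, f, p, u, g, fun t => t * p t - f t, fun t => f t ^ (-m),
    ⟨hm, hκ.1, H.hf, H.hp, fun t ht => ?_, H.hg, fun _ => rfl, fun _ => rfl, H.f0, H.p0, H.u0, H.g0,
      hp, hn⟩⟩
  have h1 : f 0 ≤ f t := le_of_hasDerivAt_nonneg ht (fun y hy => H.hf y hy.1) fun y hy => hp y hy.1.le
  rw [H.f0] at h1
  have := H.hu t ht
  rwa [max_eq_left h1] at this

namespace IsNeutral

variable {m κ : ℝ} {f p u g h r : ℝ → ℝ} {t T : ℝ}

lemma hh (H : IsNeutral m κ f p u g h r) (ht : 0 ≤ t) : HasDerivAt h (t * u t) t := by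
  have : h = fun t => t * p t - f t := funext H.h_eq
  rw [this]
  have := ((hasDerivAt_id t).mul (H.hp t ht)).sub (H.hf t ht)
  refine this.congr_deriv ?_
  simp

lemma one_le_f (H : IsNeutral m κ f p u g h r) (ht : 0 ≤ t) : 1 ≤ f t := by
  have h1 : f 0 ≤ f t :=
    le_of_hasDerivAt_nonneg ht (fun y hy => H.hf y hy.1) fun y hy => H.p_nonneg y hy.1.le
  rwa [H.f0] at h1

lemma f_mono (H : IsNeutral m κ f p u g h r) (ht : 0 ≤ t) (hT : t ≤ T) : f t ≤ f T :=
  le_of_hasDerivAt_nonneg hT (fun y hy => H.hf y (ht.trans hy.1)) fun y hy =>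
    H.p_nonneg y (ht.trans hy.1.le)

lemma r_pos (H : IsNeutral m κ f p u g h r) (ht : 0 ≤ t) : 0 < r t := by
  rw [H.r_eq]
  exact Real.rpow_pos_of_pos (by linarith [H.one_le_f ht]) _

lemma r_anti (H : IsNeutral m κ f p u g h r) (ht : 0 ≤ t) (hT : t ≤ T) : r T ≤ r t := by
  rw [H.r_eq, H.r_eq]
  exact Real.rpow_le_rpow_of_nonpos (by linarith [H.one_le_f ht]) (H.f_mono ht hT)
    (by linarith [H.hm])

lemma r_le_one (H : IsNeutral m κ f p u g h r) (ht : 0 ≤ t) : r t ≤ 1 := by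
  rw [H.r_eq]
  exact Real.rpow_le_one_of_one_le_of_nonpos (H.one_le_f ht) (by linarith [H.hm])

lemma hr (H : IsNeutral m κ f p u g h r) (ht : 0 ≤ t) :
    HasDerivAt r (-(m * r t * (p t / f t))) t := by
  have e : r = fun t => f t ^ (-m) := funext H.r_eq
  have hf := H.one_le_f ht
  rw [e]
  have := (H.hf t ht).rpow_const (p := -m) (Or.inl (by linarith))
  refine this.congr_deriv ?_
  rw [Real.rpow_sub_one (by linarith)]
  ring

lemma triad (H : IsNeutral m κ f p u g h r) : IsTriad r h u g :=
  ⟨fun _ ht => H.r_pos ht, fun _ ht => H.hh ht, H.hu, H.hg⟩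

lemma h0 (H : IsNeutral m κ f p u g h r) : h 0 = -1 := by rw [H.h_eq, H.f0]; ring

/-- The `h g r` terms inside the bracket cancel, and the coefficients `3 / 4` and `1 / 2` in `lyap`
are those for which the remaining `h u` and `g ^ 2 r` terms cancel too. Only squares are left, with
`r' ≤ 0` contributing the last one. -/
lemma hasDerivAt_lyap (H : IsNeutral m κ f p u g h r) (ht : 0 < t) :
    HasDerivAt (lyap u g h r)
      (t ^ 2 * u t ^ 2 + 3 / 4 * (h t ^ 2 / t ^ 2) + m / 2 * t * r t * (p t / f t) * g t ^ 2) t := by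
  have hh := H.hh ht.le
  have hu := H.hu t ht.le
  have hg := H.hg t ht.le
  have hr := H.hr ht.le
  have := (((hasDerivAt_id t).mul ((hh.mul hu).sub (((hg.pow 2).mul hr).div_const 2))).sub
    ((((hh.pow 2).const_mul (3 / 4)).div (hasDerivAt_id t) ht.ne'))).add ((hu.mul hg).div_const 2)
  refine this.congr_deriv ?_
  simp only [id, Pi.mul_apply, Pi.pow_apply, Pi.sub_apply]
  field_simp
  ring

lemma lyap_deriv_nonneg (H : IsNeutral m κ f p u g h r) (ht : 0 < t) :
    0 ≤ m / 2 * t * r t * (p t / f t) * g t ^ 2 := by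
  have := H.one_le_f ht.le
  have := H.p_nonneg t ht.le
  have := H.r_pos ht.le
  have := H.hm
  positivity

lemma lyap_mono (H : IsNeutral m κ f p u g h r) (ht : 0 < t) (hT : t ≤ T) :
    lyap u g h r t ≤ lyap u g h r T :=
  le_of_hasDerivAt_nonneg hT (fun y hy => H.hasDerivAt_lyap (ht.trans_le hy.1)) fun y hy => by
    have := H.lyap_deriv_nonneg (ht.trans hy.1)
    positivity

/-- The variation of `f'` is controlled by that of the Lyapunov function. -/
lemma abs_p_sub_le (H : IsNeutral m κ f p u g h r) (ht : 0 < t) (hT : t ≤ T) {l : ℝ} (hl : 0 < l) :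
    |p T - p t| ≤ (lyap u g h r T - lyap u g h r t) / (2 * l) + l / 2 * (1 / t - 1 / T) := by
  -- By Young's inequality `|u| ≤ y ^ 2 * u ^ 2 / (2 * l) + l / (2 * y ^ 2)`, and the first term is
  -- at most `lyap' / (2 * l)`. The cases `c = 1` and `c = -1` give the two signs.
  have key : ∀ c : ℝ, |c| ≤ 1 →
      c * p t + lyap u g h r t / (2 * l) - l / 2 * t⁻¹
        ≤ c * p T + lyap u g h r T / (2 * l) - l / 2 * T⁻¹ := by
    intro c hc
    refine le_of_hasDerivAt_nonneg (φ := fun s => c * p s + lyap u g h r s / (2 * l) - l / 2 * s⁻¹)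
      hT (fun y hy => (((H.hp y (ht.le.trans hy.1)).const_mul c).add
        ((H.hasDerivAt_lyap (ht.trans_le hy.1)).div_const _)).sub
        ((hasDerivAt_inv (ht.trans_le hy.1).ne').const_mul _)) fun y hy => ?_
    have hy0 : 0 < y := ht.trans hy.1
    have h1 := H.lyap_deriv_nonneg hy0
    have h2 : 0 ≤ 3 / 4 * (h y ^ 2 / y ^ 2) := by positivity
    have h3 : -(c * u y) ≤ (y ^ 2 * u y ^ 2) / (2 * l) + l / 2 * (y ^ 2)⁻¹ := by
      have e : (y ^ 2 * u y ^ 2) / (2 * l) + l / 2 * (y ^ 2)⁻¹ - |u y|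
          = (y * |u y| - l / y) ^ 2 / (2 * l) := by
        rw [← sq_abs (u y)]
        field_simp
        ring
      have h4 : 0 ≤ (y * |u y| - l / y) ^ 2 / (2 * l) := by positivity
      have h5 : -(c * u y) ≤ |u y| := by
        calc -(c * u y) ≤ |c * u y| := neg_le_abs _
          _ = |c| * |u y| := abs_mul _ _
          _ ≤ 1 * |u y| := by gcongr
          _ = |u y| := one_mul _
      linarith
    have h6 : (y ^ 2 * u y ^ 2) / (2 * l) ≤ (y ^ 2 * u y ^ 2 + 3 / 4 * (h y ^ 2 / y ^ 2) +
        m / 2 * y * r y * (p y / f y) * g y ^ 2) / (2 * l) := by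
      gcongr
      linarith
    linarith
  have k1 := key 1 (by simp)
  have k2 := key (-1) (by simp)
  have e : (lyap u g h r T - lyap u g h r t) / (2 * l) + l / 2 * (1 / t - 1 / T)
      = lyap u g h r T / (2 * l) - lyap u g h r t / (2 * l) + (l / 2 * t⁻¹ - l / 2 * T⁻¹) := by
    rw [one_div, one_div]; ring
  rw [e, abs_le]
  constructor <;> linarith

end IsNeutral

/-! ### Estimates in the first phase. -/

/-- On `(0,T)` the trajectory is in its initial octant. -/
def IsFirstPhase (u g h : ℝ → ℝ) (T : ℝ) : Prop :=
  0 < T ∧ ∀ t ∈ Ioo 0 T, h t < 0 ∧ 0 < u t ∧ g t < 0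

lemma IsFirstPhase.mono {u g h : ℝ → ℝ} {s T : ℝ} (P : IsFirstPhase u g h T) (hs : 0 < s)
    (hsT : s ≤ T) : IsFirstPhase u g h s :=
  ⟨hs, fun t ht => P.2 t ⟨ht.1, ht.2.trans_le hsT⟩⟩

namespace IsNeutral

variable {m κ : ℝ} {f p u g h r : ℝ → ℝ} {t T : ℝ}

lemma firstPhase_g_le (H : IsNeutral m κ f p u g h r) (P : IsFirstPhase u g h T) :
    g T ≤ T * h T := by
  have := le_of_hasDerivAt_nonneg (φ := fun s => s * h s - g s) P.1.le
    (fun y hy => ((hasDerivAt_id y).mul (H.hh hy.1)).sub (H.hg y hy.1)) fun y hy => by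
      have := (P.2 y hy).2.1
      have h0 : 0 < y := hy.1
      simp only [id, one_mul]
      nlinarith [mul_pos h0 (mul_pos h0 this)]
  simp only [H.g0] at this
  linarith

/-- `-g / t` decreases during the first phase. -/
lemma firstPhase_g_div (H : IsNeutral m κ f p u g h r) (P : IsFirstPhase u g h T) (ht : 0 < t)
    (htT : t ≤ T) : g t * T ≤ g T * t := by
  have := le_of_hasDerivAt_nonneg (φ := fun s => g s / s) htT
    (fun y hy => (H.hg y (ht.le.trans hy.1)).div (hasDerivAt_id y) (ht.trans_le hy.1).ne')
    fun y hy => by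
      have h0 : 0 < y := ht.trans hy.1
      have := H.firstPhase_g_le (P.mono h0 hy.2.le)
      simp only [mul_one]
      apply div_nonneg _ (by positivity)
      linarith
  rwa [div_le_div_iff₀ ht (ht.trans_le htT)] at this

lemma firstPhase_g_nonpos (H : IsNeutral m κ f p u g h r) (P : IsFirstPhase u g h T) : g T ≤ 0 := by
  have := le_of_hasDerivAt_nonneg (φ := fun s => - g s) P.1.le (fun y hy => (H.hg y hy.1).neg)
    fun y hy => by linarith [(P.2 y hy).1]
  simp only [H.g0] at this
  linarith

/-- `-u' / t` decreases during the first phase. -/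
lemma firstPhase_gr_div (H : IsNeutral m κ f p u g h r) (P : IsFirstPhase u g h T) (ht : 0 < t)
    (htT : t ≤ T) : g t * r t * T ≤ g T * r T * t := by
  have h1 := H.firstPhase_g_div P ht htT
  have h2 := H.r_anti ht.le htT
  have h3 := H.firstPhase_g_nonpos P
  have h4 := H.r_pos ht.le
  have h5 : g t * T * r t ≤ g T * t * r t := by gcongr
  have h6 : g T * t * r t ≤ g T * t * r T :=
    mul_le_mul_of_nonpos_left h2 (mul_nonpos_of_nonpos_of_nonneg h3 ht.le)
  nlinarith

lemma firstPhase_sq_mul_u_le (H : IsNeutral m κ f p u g h r) (P : IsFirstPhase u g h T) :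
    T ^ 2 * u T / 2 ≤ 1 + h T := by
  have := le_of_hasDerivAt_nonneg (φ := fun s => h s - s ^ 2 * u s / 2) P.1.le
    (fun y hy => (H.hh hy.1).sub ((((hasDerivAt_pow 2 y).mul (H.hu y hy.1))).div_const 2))
    fun y hy => by
      have h1 := (P.2 y hy).2.2
      have h2 := H.r_pos (t := y) hy.1.le
      have : 0 ≤ y ^ 2 * (-g y * r y) := by
        have : 0 ≤ -g y := by linarith
        positivity
      norm_num
      nlinarith
  simp only [H.h0] at this
  norm_num at this
  linarith

/-- The left side is `∫ s ^ 2 u` and `1 + h T = ∫ s u` over `[0, T]`; as `u` decreases, the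
inequality is of Chebyshev type, with equality for constant `u`. -/
lemma firstPhase_neg_g_le (H : IsNeutral m κ f p u g h r) (P : IsFirstPhase u g h T) :
    -g T + T * h T ≤ 2 / 3 * T * (1 + h T) := by
  have := le_of_hasDerivAt_nonneg
    (φ := fun s => 2 / 3 * (s * (1 + h s)) - (s * h s - g s)) P.1.le
    (fun y hy => ((((hasDerivAt_id y).mul ((H.hh hy.1).const_add 1)).const_mul (2 / 3))).sub
      (((hasDerivAt_id y).mul (H.hh hy.1)).sub (H.hg y hy.1)))
    fun y hy => by
      have := H.firstPhase_sq_mul_u_le (P.mono hy.1 hy.2.le)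
      simp only [id, one_mul]
      nlinarith
  simp only [H.g0] at this
  linarith

/-- Again Chebyshev for the decreasing `u`: `∫ s u ≤ T / 2 * ∫ u`. -/
lemma firstPhase_two_le (H : IsNeutral m κ f p u g h r) (P : IsFirstPhase u g h T) :
    2 * (1 + h T) ≤ T * p T := by
  have hN : ∀ s, 0 < s → s ≤ T → s * u s ≤ p s := by
    intro s hs hsT
    have := le_of_hasDerivAt_nonneg (φ := fun s => p s - s * u s) hs.le
      (fun y hy => (H.hp y hy.1).sub ((hasDerivAt_id y).mul (H.hu y hy.1)))
      fun y hy => by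
        have h1 := (P.2 y ⟨hy.1, hy.2.trans_le hsT⟩).2.2
        have h2 := H.r_pos (t := y) hy.1.le
        have : 0 ≤ y * (-g y * r y) := by
          have : 0 ≤ -g y := by linarith
          have := hy.1.le
          positivity
        simp only [id, one_mul]
        linarith
    simp only [H.p0] at this
    linarith
  have := le_of_hasDerivAt_nonneg (φ := fun s => s * p s - 2 * h s) P.1.le
    (fun y hy => ((hasDerivAt_id y).mul (H.hp y hy.1)).sub ((H.hh hy.1).const_mul 2))
    fun y hy => by
      have := hN y hy.1 hy.2.le
      simp only [id, one_mul]
      linarith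
  simp only [H.h0] at this
  linarith

/-- The convexity bound: `u` is convex as a function of `t ^ 2`. -/
lemma firstPhase_convex (H : IsNeutral m κ f p u g h r) (P : IsFirstPhase u g h T) :
    u T * T ^ 2 / 2 + (-g T * r T) * T ^ 3 / 8 ≤ 1 + h T := by
  have hT := P.1
  -- `-σ / 2` is the slope at `T` of `u` as a function of `t ^ 2`. The tangent line there lies below
  -- `u`, and it is integrated against `s`.
  obtain ⟨σ, hσ⟩ : ∃ σ, σ * T = -g T * r T := ⟨-g T * r T / T, by field_simp⟩
  have hu : ∀ s, 0 ≤ s → s ≤ T → u T + σ / 2 * (T ^ 2 - s ^ 2) ≤ u s := by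
    intro s hs hsT
    have := le_of_hasDerivAt_nonneg (φ := fun s => - (u s + σ / 2 * s ^ 2)) hsT
      (fun y hy => ((H.hu y (hs.trans hy.1)).add ((hasDerivAt_pow 2 y).const_mul (σ / 2))).neg)
      fun y hy => by
        have hy0 : 0 < y := hs.trans_lt hy.1
        have h1 := H.firstPhase_gr_div P hy0 hy.2.le
        have : (g y * r y + σ * y) * T ≤ 0 := by
          have : (g y * r y + σ * y) * T = g y * r y * T + σ * T * y := by ring
          rw [this, hσ]; linarith
        have : g y * r y + σ * y ≤ 0 := by
          by_contra hc
          push Not at hc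
          linarith [mul_pos hc hT]
        norm_num
        linarith
    linarith
  have := le_of_hasDerivAt_nonneg
    (φ := fun s => h s - ((u T + σ / 2 * T ^ 2) / 2 * s ^ 2 - σ / 8 * s ^ 4)) hT.le
    (fun y hy => (H.hh hy.1).sub (((hasDerivAt_pow 2 y).const_mul _).sub
      ((hasDerivAt_pow 4 y).const_mul _)))
    fun y hy => by
      have h1 := hu y hy.1.le hy.2.le
      have := mul_le_mul_of_nonneg_left h1 hy.1.le
      norm_num
      linarith
  simp only [H.h0] at this
  norm_num at this
  have e : (-g T * r T) * T ^ 3 = σ * T ^ 4 := by rw [← hσ]; ring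
  rw [e]
  linarith

/-- At the end of the first phase the Lyapunov function is small compared with `f' ^ 2`. -/
lemma firstPhase_lyap (H : IsNeutral m κ f p u g h r) (P : IsFirstPhase u g h T) (hT : h T = 0)
    (hu : 0 ≤ u T) :
    0 < p T ∧ lyap u g h r T = -(T * (g T ^ 2 * r T / 2 + u T * (-g T) / (2 * T))) ∧
      g T ^ 2 * r T / 2 + u T * (-g T) / (2 * T) ≤ 2 / 3 * p T ^ 2 := by
  have hT0 := P.1
  have h1 := H.firstPhase_neg_g_le P
  have h2 := H.firstPhase_two_le P
  have h3 := H.firstPhase_convex P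
  have h4 := H.firstPhase_g_nonpos P
  have h5 := H.r_pos hT0.le
  simp only [hT] at h1 h2 h3
  refine ⟨?_, ?_, ?_⟩
  · by_contra hc
    push Not at hc
    nlinarith
  · simp only [lyap, hT]
    field_simp
    ring
  · have hs : 0 ≤ -g T * r T := by
      have : 0 ≤ -g T := by linarith
      positivity
    -- At `h T = 0` the phase estimates read `-g ≤ 2 / 3 * T`, `T p ≥ 2` and `u T ^ 2 / 2 + (-g r) T
    -- ^ 3 / 8 ≤ 1`. With `E` the quantity to be bounded, they give `T ^ 2 * E ≤ 8 / 3`, while `T ^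
    -- 2 * p ^ 2 ≥ 4`.
    have a1 : g T ^ 2 * r T / 2 ≤ T / 3 * (-g T * r T) := by nlinarith
    have a2 : u T * (-g T) / (2 * T) ≤ u T / 3 := by
      rw [div_le_iff₀ (by positivity)]
      nlinarith
    have a3 : T ^ 2 * (g T ^ 2 * r T / 2 + u T * (-g T) / (2 * T)) ≤ 8 / 3 := by
      have := mul_le_mul_of_nonneg_left (add_le_add a1 a2) (sq_nonneg T)
      have e : 0 ≤ u T * T ^ 2 := by positivity
      nlinarith
    have a4 : 4 ≤ T ^ 2 * p T ^ 2 := by nlinarith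
    have : T ^ 2 * (g T ^ 2 * r T / 2 + u T * (-g T) / (2 * T)) ≤ T ^ 2 * (2 / 3 * p T ^ 2) := by
      linarith
    exact le_of_mul_le_mul_left this (by positivity)

/-- After the first phase `f'` stays away from zero as long as the Lyapunov function is `≤ 0`. -/
lemma abs_p_sub_le_sqrt (H : IsNeutral m κ f p u g h r) {E Y : ℝ} (hT : 0 < T) (hY : T ≤ Y)
    (hE : lyap u g h r T = -(T * E)) (hYl : lyap u g h r Y ≤ 0) : |p Y - p T| ≤ Real.sqrt E := by
  have hE0 : 0 ≤ E := by
    have := H.lyap_mono hT hY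
    by_contra hc
    push Not at hc
    nlinarith
  have hY0 : 0 < Y := hT.trans_le hY
  -- The best parameter in `abs_p_sub_le` is `l = T * √E`, which makes each of the two terms at most
  -- `√E / 2`; `ε` keeps `l` positive when `E = 0`.
  refine le_of_forall_pos_le_add fun ε hε => ?_
  set s := Real.sqrt E + ε
  have hs : 0 < s := by positivity
  have hEs : E ≤ s ^ 2 := by
    have := Real.sq_sqrt hE0
    nlinarith [Real.sqrt_nonneg E]
  have h1 := H.abs_p_sub_le hT hY (l := T * s) (by positivity)
  have h2 : (lyap u g h r Y - lyap u g h r T) / (2 * (T * s)) ≤ s / 2 := by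
    rw [div_le_iff₀ (by positivity), hE]
    nlinarith
  have h3 : T * s / 2 * (1 / T - 1 / Y) ≤ s / 2 := by
    have e : T * s / 2 * (1 / T - 1 / Y) = s / 2 - T * s / 2 * (1 / Y) := by field_simp
    rw [e]
    have : 0 ≤ T * s / 2 * (1 / Y) := by positivity
    linarith
  linarith

end IsNeutral

end Neutral

/-! ### Growth from bounds on the derivative. -/

section Calculus

variable {φ φ' : ℝ → ℝ} {T t : ℝ}

lemma add_mul_le_of_le_hasDerivAt {c : ℝ} (hT : T ≤ t)
    (hd : ∀ s ∈ Icc T t, HasDerivAt φ (φ' s) s) (h : ∀ s ∈ Ioo T t, c ≤ φ' s) :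
    φ T + c * (t - T) ≤ φ t := by
  have := le_of_hasDerivAt_nonneg (φ := fun s => φ s - c * s) hT
    (fun s hs => (hd s hs).sub ((hasDerivAt_id s).const_mul c)) fun s hs => by linarith [h s hs]
  linarith

lemma exists_pos_of_le_hasDerivAt {c : ℝ} (hc : 0 < c) (hd : ∀ s ≥ T, HasDerivAt φ (φ' s) s)
    (h : ∀ s ≥ T, c ≤ φ' s) : ∃ t ≥ T, 0 < φ t := by
  refine ⟨T + (|φ T| + 1) / c, by
    have : 0 ≤ (|φ T| + 1) / c := by positivity
    linarith, ?_⟩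
  have h0 : 0 ≤ (|φ T| + 1) / c := by positivity
  have := add_mul_le_of_le_hasDerivAt (c := c) (t := T + (|φ T| + 1) / c) (by linarith)
    (fun s hs => hd s hs.1) (fun s hs => h s hs.1.le)
  have e : c * (T + (|φ T| + 1) / c - T) = |φ T| + 1 := by field_simp; ring
  rw [e] at this
  linarith [neg_abs_le (φ T)]

lemma pos_of_continuousOn_ne_zero (hc : ContinuousOn φ (Ici T)) (hT : 0 < φ T) (hne : ∀ s ≥ T, φ s ≠ 0)
    (ht : T ≤ t) : 0 < φ t := by
  by_contra hle
  obtain ⟨c, hc1, hc2, -⟩ := exists_first_zero (hc.mono fun x hx => hx.1) ht hT (not_lt.mp hle)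
  exact hne c hc1.1.le hc2

lemma tendsto_div_id_of_tendsto_deriv {a : ℝ} (hd : ∀ t ≥ T, HasDerivAt φ (φ' t) t)
    (h : Tendsto φ' atTop (𝓝 a)) : Tendsto (fun t => φ t / t) atTop (𝓝 a) := by
  rw [Metric.tendsto_atTop] at h ⊢
  intro ε hε
  obtain ⟨N, hN⟩ := h (ε / 2) (by linarith)
  set M := max (max N T) 1
  have hM1 : 1 ≤ M := le_max_right _ _
  have hMN : N ≤ M := (le_max_left _ _).trans (le_max_left _ _)
  have hMT : T ≤ M := (le_max_right _ _).trans (le_max_left _ _)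
  have hb : ∀ s ≥ M, |φ' s - a| < ε / 2 := fun s hs => hN s (hMN.trans hs)
  set D := |φ M - a * M|
  refine ⟨M + 2 * D / ε + 1, fun t ht => ?_⟩
  have hD0 : 0 ≤ 2 * D / ε := by positivity
  have htM : M ≤ t := by linarith
  have ht0 : 0 < t := by linarith
  have h1 := add_mul_le_of_le_hasDerivAt (c := a - ε / 2) htM
    (fun s hs => hd s (hMT.trans hs.1)) fun s hs => by linarith [(abs_lt.mp (hb s hs.1.le)).1]
  have h2 := add_mul_le_of_le_hasDerivAt (φ := fun s => -φ s) (c := -(a + ε / 2)) htM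
    (fun s hs => (hd s (hMT.trans hs.1)).neg) fun s hs => by
      linarith [(abs_lt.mp (hb s hs.1.le)).2]
  have h3 : D < ε / 2 * t := by
    have : 2 * D / ε < t := by linarith
    rw [div_lt_iff₀ hε] at this
    linarith
  have h4 : -D ≤ φ M - a * M := neg_abs_le _
  have h5 : φ M - a * M ≤ D := le_abs_self _
  have h6 : 0 < ε / 2 * M := by positivity
  rw [Real.dist_eq, abs_lt]
  constructor
  · rw [neg_lt_sub_iff_lt_add, ← sub_lt_iff_lt_add', lt_div_iff₀ ht0]
    nlinarith
  · rw [sub_lt_iff_lt_add', div_lt_iff₀ ht0]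
    nlinarith

end Calculus

/-! ### A positive Lyapunov function forces entry into an octant. -/

section Triad

variable {r h u g : ℝ → ℝ} {T : ℝ}

lemma lyap_neg (u g h r : ℝ → ℝ) : lyap (-u) (-g) (-h) r = lyap u g h r := by
  funext t
  simp [lyap]

/-- A trajectory that avoids both octants cannot have a positive Lyapunov function for ever. -/
lemma IsTriad.not_lyap_pos (H : IsTriad r h u g) (hT : 0 < T)
    (hpos : ∀ t ≥ T, ¬ (0 ≤ h t ∧ 0 ≤ u t ∧ 0 ≤ g t ∧ (0 < h t ∨ 0 < u t ∨ 0 < g t)))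
    (hneg : ∀ t ≥ T, ¬ (h t ≤ 0 ∧ u t ≤ 0 ∧ g t ≤ 0 ∧ (h t < 0 ∨ u t < 0 ∨ g t < 0)))
    (hl : ∀ t ≥ T, 0 < lyap u g h r t) : False := by
  -- Where `u = 0`, every remaining term of `lyap` is nonpositive.
  have une : ∀ t ≥ T, u t ≠ 0 := by
    intro t ht h0
    have := hl t ht
    have ht0 : 0 < t := hT.trans_le ht
    have hr := H.hr t ht0.le
    simp only [lyap, h0] at this
    have h1 : 0 ≤ t * (g t ^ 2 * r t / 2) := by positivity
    have h2 : 0 ≤ 3 / 4 * h t ^ 2 / t := by positivity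
    linarith
  have hgne : ∀ t ≥ T, h t ≠ 0 ∧ g t ≠ 0 := by
    intro t ht
    have hlt := hl t ht
    have ht0 : 0 < t := hT.trans_le ht
    have hr := H.hr t ht0.le
    have h1 : 0 ≤ t * (g t ^ 2 * r t / 2) := by positivity
    have h2 : 0 ≤ 3 / 4 * h t ^ 2 / t := by positivity
    constructor
    · intro h0
      have hug : 0 < u t * g t := by
        simp only [lyap, h0] at hlt
        norm_num at hlt
        linarith
      rcases pos_and_pos_or_neg_and_neg_of_mul_pos hug with ⟨a, b⟩ | ⟨a, b⟩
      · exact hpos t ht ⟨h0.ge, a.le, b.le, Or.inr (Or.inl a)⟩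
      · exact hneg t ht ⟨h0.le, a.le, b.le, Or.inr (Or.inl a)⟩
    · intro g0
      have hug : 0 < h t * u t := by
        simp only [lyap, g0] at hlt
        norm_num at hlt
        have : 0 < t * (h t * u t) := by linarith
        exact pos_of_mul_pos_right this ht0.le
      rcases pos_and_pos_or_neg_and_neg_of_mul_pos hug with ⟨a, b⟩ | ⟨a, b⟩
      · exact hpos t ht ⟨a.le, b.le, g0.ge, Or.inl a⟩
      · exact hneg t ht ⟨a.le, b.le, g0.le, Or.inl a⟩
  -- With `h`, `u`, `g` of constant sign and `u > 0`, the signs `h, g < 0` make `lyap` negative. If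
  -- `h < 0 < g`, then `h` grows at least linearly and changes sign; if `g < 0 < h`, then `g` does.
  wlog hu : 0 < u T generalizing h u g with X
  · refine X H.neg (fun t ht hc => hneg t ht ?_) (fun t ht hc => hpos t ht ?_)
      (by rwa [lyap_neg]) (fun t ht => by simpa using une t ht)
      (fun t ht => by simpa using hgne t ht) ?_
    · simpa using hc
    · simpa using hc
    · have := lt_of_le_of_ne (not_lt.mp hu) (une T le_rfl)
      simpa using this
  have cont := H.continuousOn (s := Ici T) (fun x hx => hT.le.trans hx)
  have uT : ∀ t ≥ T, 0 < u t := fun t ht => pos_of_continuousOn_ne_zero cont.2.1 hu une ht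
  have h0 : ∀ t ≥ T, 0 ≤ t := fun t ht => hT.le.trans ht
  rcases (hgne T le_rfl).1.lt_or_gt with hh | hh
  · have hT' : ∀ t ≥ T, h t < 0 := fun t ht => by
      have := pos_of_continuousOn_ne_zero (φ := -h) cont.1.neg (by simpa using hh)
        (fun s hs => by simpa using (hgne s hs).1) ht
      simpa using this
    rcases (hgne T le_rfl).2.lt_or_gt with hg | hg
    · have h1 := mul_neg_of_neg_of_pos hh hu
      have h2 := mul_neg_of_pos_of_neg hu hg
      have h3 : 0 ≤ g T ^ 2 * r T / 2 := by have := H.hr T hT.le; positivity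
      have h4 : 0 ≤ 3 / 4 * h T ^ 2 / T := by positivity
      have h5 := hl T le_rfl
      simp only [lyap] at h5
      have : T * (h T * u T - g T ^ 2 * r T / 2) ≤ 0 :=
        mul_nonpos_of_nonneg_of_nonpos hT.le (by linarith)
      linarith
    · have gT : ∀ t ≥ T, 0 < g t := fun t ht =>
        pos_of_continuousOn_ne_zero cont.2.2 hg (fun s hs => (hgne s hs).2) ht
      have um : ∀ t ≥ T, u T ≤ u t := fun t ht =>
        le_of_hasDerivAt_nonneg ht (fun s hs => H.hu s (h0 s hs.1)) fun s hs =>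
          (mul_pos (gT s hs.1.le) (H.hr s (h0 s hs.1.le))).le
      obtain ⟨t, ht, hp⟩ := exists_pos_of_le_hasDerivAt (mul_pos hT hu)
        (fun s hs => H.hh s (h0 s hs)) fun s hs =>
          mul_le_mul hs (um s hs) hu.le (h0 s hs)
      exact lt_asymm hp (hT' t ht)
  · have hT' : ∀ t ≥ T, 0 < h t := fun t ht =>
      pos_of_continuousOn_ne_zero cont.1 hh (fun s hs => (hgne s hs).1) ht
    rcases (hgne T le_rfl).2.lt_or_gt with hg | hg
    · have gT : ∀ t ≥ T, g t < 0 := fun t ht => by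
        have := pos_of_continuousOn_ne_zero (φ := -g) cont.2.2.neg (by simpa using hg)
          (fun s hs => by simpa using (hgne s hs).2) ht
        simpa using this
      have hm : ∀ t ≥ T, h T ≤ h t := fun t ht =>
        le_of_hasDerivAt_nonneg ht (fun s hs => H.hh s (h0 s hs.1)) fun s hs =>
          (mul_pos (hT.trans hs.1) (uT s hs.1.le)).le
      obtain ⟨t, ht, hp⟩ := exists_pos_of_le_hasDerivAt hh (fun s hs => H.hg s (h0 s hs)) hm
      exact lt_asymm hp (gT t ht)
    · exact hpos T le_rfl ⟨hh.le, hu.le, hg.le, Or.inl hh⟩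

end Triad

/-! ### Nonpositivity of the Lyapunov function and convergence of `f'`. -/

namespace IsNeutral

variable {m κ : ℝ} {f p u g h r : ℝ → ℝ} {t T : ℝ}

lemma isFirstPhase_of_h_neg (H : IsNeutral m κ f p u g h r) (hT : 0 < T)
    (hh : ∀ t ∈ Ioo 0 T, h t < 0) (hn : ∀ t ∈ Ioo 0 T, ¬ (h t < 0 ∧ u t ≤ 0 ∧ g t < 0)) :
    IsFirstPhase u g h T := by
  refine ⟨hT, fun t ht => ?_⟩
  have hg : g t < 0 := by
    have := lt_of_hasDerivAt_pos (φ := fun s => -g s) ht.1 (fun s hs => (H.hg s hs.1).neg)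
      fun s hs => by linarith [hh s ⟨hs.1, hs.2.trans ht.2⟩]
    simp only [H.g0] at this
    linarith
  refine ⟨hh t ht, ?_, hg⟩
  by_contra hu
  exact hn t ht ⟨hh t ht, not_lt.mp hu, hg⟩

lemma exists_p_pos (H : IsNeutral m κ f p u g h r) : ∃ d > 0, ∀ t ∈ Ioc 0 d, 0 < p t := by
  have hκ := H.hκ
  obtain ⟨δ, hδ, hball⟩ := Metric.eventually_nhds_iff.mp
    ((H.hu 0 le_rfl).continuousAt.eventually (lt_mem_nhds (show 0 < u 0 by rw [H.u0]; exact hκ)))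
  refine ⟨δ / 2, by linarith, fun t ht => ?_⟩
  have := lt_of_hasDerivAt_pos ht.1 (fun s hs => H.hp s hs.1) fun s hs => hball (by
    rw [Real.dist_eq, sub_zero, abs_of_pos hs.1]
    linarith [hs.2, ht.2])
  rwa [H.p0] at this

lemma sqrt_le_of_le_two_thirds_sq {E x : ℝ} (hx : 0 < x) (hE : E ≤ 2 / 3 * x ^ 2) :
    Real.sqrt E ≤ 9 / 10 * x := by
  rw [Real.sqrt_le_left (by positivity)]
  nlinarith [sq_nonneg x]

/-- At a first zero `Y` of `p`, the nonnegative function `p` has a minimum, so `u Y = 0` and `lyap Y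
≤ 0`. The first phase has ended before `Y`, since `p` increases during it; but from its end on, `p`
has lost at most nine tenths of its value. -/
lemma p_pos (H : IsNeutral m κ f p u g h r) (hT : 0 < T) : 0 < p T := by
  by_contra hc
  obtain ⟨d, hd, hpd⟩ := H.exists_p_pos
  have hdT : d < T := by
    by_contra hle
    exact hc (hpd T ⟨hT, not_lt.mp hle⟩)
  obtain ⟨Y, hY, hpY, hpY'⟩ := exists_first_zero (φ := p)
    (fun s hs => (H.hp s (hd.le.trans hs.1)).continuousAt.continuousWithinAt) hdT.le
    (hpd d ⟨hd, le_rfl⟩) (not_lt.mp hc)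
  have hY0 : 0 < Y := hd.trans hY.1
  have huY : u Y = 0 := by
    refine IsLocalMin.hasDerivAt_eq_zero ?_ (H.hp Y hY0.le)
    filter_upwards [lt_mem_nhds hY0] with s hs
    rw [hpY]
    exact H.p_nonneg s (le_of_lt hs)
  have hn : ∀ t, 0 < t → t < Y → ¬ (h t ≤ 0 ∧ u t ≤ 0 ∧ g t ≤ 0 ∧ (h t < 0 ∨ u t < 0 ∨ g t < 0)) :=
    fun t ht htY hc => by
      have := (H.triad.neg_of_nonpos ht.le hc.1 hc.2.1 hc.2.2.1 hc.2.2.2 htY).2.1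
      linarith
  by_cases hh : ∀ t ∈ Ioo 0 Y, h t < 0
  · have P := H.isFirstPhase_of_h_neg hY0 hh fun t ht hc =>
      hn t ht.1 ht.2 ⟨hc.1.le, hc.2.1, hc.2.2.le, Or.inl hc.1⟩
    have := lt_of_hasDerivAt_pos hY0 (fun s hs => H.hp s hs.1) fun s hs => (P.2 s hs).2.1
    rw [H.p0, hpY] at this
    exact lt_irrefl _ this
  · push Not at hh
    obtain ⟨t, ht, htn⟩ := hh
    obtain ⟨y, hy, hhy, hy'⟩ := exists_first_zero (φ := fun s => -h s) (a := 0) (b := t)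
      (fun s hs => (H.hh hs.1).continuousAt.continuousWithinAt.neg) ht.1.le
      (by simp [H.h0]) (by simpa using htn)
    have hyY : y < Y := hy.2.trans_lt ht.2
    have hhy0 : h y = 0 := by linarith
    have P := H.isFirstPhase_of_h_neg hy.1 (fun s hs => by linarith [hy' s ⟨hs.1.le, hs.2⟩])
      fun s hs hc => hn s hs.1 (hs.2.trans hyY) ⟨hc.1.le, hc.2.1, hc.2.2.le, Or.inl hc.1⟩
    have huy : 0 ≤ u y := by
      by_contra hneg
      push Not at hneg
      exact hn y hy.1 hyY ⟨hhy0.le, hneg.le, H.firstPhase_g_nonpos P, Or.inr (Or.inl hneg)⟩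
    obtain ⟨k1, k2, k3⟩ := H.firstPhase_lyap P hhy0 huy
    have hl : lyap u g h r Y ≤ 0 := by
      have hr := H.r_pos hY0.le
      have h1 : 0 ≤ Y * (g Y ^ 2 * r Y / 2) := by positivity
      have h2 : 0 ≤ 3 / 4 * h Y ^ 2 / Y := by positivity
      simp only [lyap, huY]
      linarith
    have := H.abs_p_sub_le_sqrt hy.1 hyY.le k2 hl
    rw [hpY, zero_sub, abs_neg, abs_of_pos k1] at this
    linarith [sqrt_le_of_le_two_thirds_sq k1 k3]

lemma not_nonneg (H : IsNeutral m κ f p u g h r) (hT : 0 < T) :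
    ¬ (0 ≤ h T ∧ 0 ≤ u T ∧ 0 ≤ g T ∧ (0 < h T ∨ 0 < u T ∨ 0 < g T)) := fun hc =>
  H.no_pos (T + 1) (by linarith) (fun t ht => H.p_pos ht.1)
    (H.triad.pos_of_nonneg hT.le hc.1 hc.2.1 hc.2.2.1 hc.2.2.2 (by linarith))

/-- Inside the negative octant `u` stays below a negative constant, so `p` would become negative. -/
lemma not_nonpos (H : IsNeutral m κ f p u g h r) (hT : 0 < T) :
    ¬ (h T ≤ 0 ∧ u T ≤ 0 ∧ g T ≤ 0 ∧ (h T < 0 ∨ u T < 0 ∨ g T < 0)) := by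
  intro hc
  obtain ⟨k1, k2, k3⟩ :=
    H.triad.neg_of_nonpos hT.le hc.1 hc.2.1 hc.2.2.1 hc.2.2.2 (t := T + 1) (by linarith)
  have h0 : ∀ t ≥ T + 1, 0 ≤ t := fun t ht => by linarith
  obtain ⟨t, ht, hp⟩ := exists_pos_of_le_hasDerivAt (φ := fun s => -p s) (T := T + 1)
    (c := -u (T + 1)) (by linarith) (fun s hs => (H.hp s (h0 s hs)).neg) fun s hs => by
      have := (H.triad.neg.mono_of_pos (h0 _ le_rfl) (by simpa using k1) (by simpa using k2)
        (by simpa using k3) hs).2.1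
      simpa using this
  linarith [H.p_nonneg t (h0 t ht)]

lemma lyap_nonpos (H : IsNeutral m κ f p u g h r) (hT : 0 < T) : lyap u g h r T ≤ 0 := by
  by_contra hc
  push Not at hc
  exact H.triad.not_lyap_pos hT (fun t ht => H.not_nonneg (hT.trans_le ht))
    (fun t ht => H.not_nonpos (hT.trans_le ht)) fun t ht => hc.trans_le (H.lyap_mono hT ht)

/-- Either the first phase lasts for ever or it ends with `h = 0`, `u > 0`, `g < 0`. -/
lemma firstPhase_dichotomy (H : IsNeutral m κ f p u g h r) :
    (∀ T > 0, IsFirstPhase u g h T) ∨ ∃ T, IsFirstPhase u g h T ∧ h T = 0 ∧ 0 < u T ∧ g T < 0 := by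
  have hn : ∀ t, 0 < t → ¬ (h t < 0 ∧ u t ≤ 0 ∧ g t < 0) := fun t ht hc =>
    H.not_nonpos ht ⟨hc.1.le, hc.2.1, hc.2.2.le, Or.inl hc.1⟩
  by_cases hh : ∀ t > 0, h t < 0
  · exact Or.inl fun T hT => H.isFirstPhase_of_h_neg hT (fun t ht => hh t ht.1) fun t ht => hn t ht.1
  · right
    push Not at hh
    obtain ⟨t, ht, htn⟩ := hh
    obtain ⟨y, hy, hhy, hy'⟩ := exists_first_zero (φ := fun s => -h s) (a := 0) (b := t)
      (fun s hs => (H.hh hs.1).continuousAt.continuousWithinAt.neg) ht.le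
      (by simp [H.h0]) (by simpa using htn)
    have hy0 : 0 < y := hy.1
    have hhy0 : h y = 0 := by linarith
    have P := H.isFirstPhase_of_h_neg hy.1 (fun s hs => by linarith [hy' s ⟨hs.1.le, hs.2⟩])
      fun s hs => hn s hs.1
    have hg : g y < 0 := by
      have := lt_of_hasDerivAt_pos (φ := fun s => -g s) hy0 (fun s hs => (H.hg s hs.1).neg)
        fun s hs => by linarith [(P.2 s hs).1]
      simp only [H.g0] at this
      linarith
    refine ⟨y, P, hhy0, ?_, hg⟩
    by_contra hu
    exact H.not_nonpos hy0 ⟨hhy0.le, not_lt.mp hu, hg.le, Or.inr (Or.inr hg)⟩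

/-- The limit of `f'`. -/
lemma exists_tendsto_p (H : IsNeutral m κ f p u g h r) : ∃ a > 0, Tendsto p atTop (𝓝 a) := by
  obtain ⟨a, ha⟩ : ∃ a, Tendsto p atTop (𝓝 a) := by
    have hm1 : ∀ t : ℝ, (0 : ℝ) < max t 1 := fun t => by positivity
    have mono1 : Monotone fun t => lyap u g h r (max t 1) := fun s t hst =>
      H.lyap_mono (hm1 s) (max_le_max hst le_rfl)
    -- By `abs_p_sub_le` with `l = 1`, `p` is, up to the explicit term in `1 / t`, a difference of
    -- two bounded monotone functions. Replacing `t` by `max t 1` makes them monotone on the whole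
    -- line.
    have mono2 : Monotone fun t => p (max t 1) + lyap u g h r (max t 1) / 2
        - 1 / 2 * (1 / max t 1) := fun s t hst => by
      have := (abs_le.mp (H.abs_p_sub_le (hm1 s) (max_le_max hst le_rfl) one_pos)).1
      simp only
      linarith
    have b1 : BddAbove (range fun t => lyap u g h r (max t 1)) :=
      ⟨0, by rintro _ ⟨t, rfl⟩; exact H.lyap_nonpos (hm1 t)⟩
    have b2 : BddAbove (range fun t => p (max t 1) + lyap u g h r (max t 1) / 2
        - 1 / 2 * (1 / max t 1)) := by
      refine ⟨p 1 - lyap u g h r 1 / 2 + 1 / 2, ?_⟩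
      rintro _ ⟨t, rfl⟩
      have h1 := (abs_le.mp (H.abs_p_sub_le one_pos (le_max_right t 1) one_pos)).2
      have h2 := H.lyap_nonpos (hm1 t)
      have h3 : 0 < 1 / max t 1 := one_div_pos.mpr (hm1 t)
      simp only
      linarith
    have t1 := tendsto_atTop_ciSup mono1 b1
    have t2 := tendsto_atTop_ciSup mono2 b2
    have t3 : Tendsto (fun t : ℝ => 1 / 2 * (1 / t)) atTop (𝓝 (1 / 2 * 0)) :=
      (tendsto_const_nhds.div_atTop tendsto_id).const_mul _
    refine ⟨_, ((t2.sub (t1.div_const 2)).add t3).congr' ?_⟩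
    filter_upwards [eventually_ge_atTop 1] with t ht
    rw [max_eq_left ht]
    ring
  refine ⟨a, ?_, ha⟩
  rcases H.firstPhase_dichotomy with hph | ⟨T, P, hT, hu, hg⟩
  · have h1 : p 1 ≤ a := ge_of_tendsto ha (by
      filter_upwards [eventually_ge_atTop 1] with t ht
      exact le_of_hasDerivAt_nonneg ht (fun s hs => H.hp s (by linarith [hs.1])) fun s hs =>
        ((hph t (by linarith)).2 s ⟨by linarith [hs.1], hs.2⟩).2.1.le)
    linarith [H.p_pos one_pos]
  · obtain ⟨k1, k2, k3⟩ := H.firstPhase_lyap P hT hu.le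
    have : p T / 10 ≤ a := ge_of_tendsto ha (by
      filter_upwards [eventually_ge_atTop T] with t ht
      have := (abs_le.mp (H.abs_p_sub_le_sqrt P.1 ht k2 (H.lyap_nonpos (P.1.trans_le ht)))).1
      linarith [sqrt_le_of_le_two_thirds_sq k1 k3])
    linarith

end IsNeutral

/-! ### Smallness of `f / t` in the first phase for `m = 4`. -/

namespace IsNeutral

variable {m κ : ℝ} {f p u g h r : ℝ → ℝ} {s t T : ℝ}

lemma hasDerivAt_f_div (H : IsNeutral m κ f p u g h r) (ht : 0 < t) :
    HasDerivAt (fun s => f s / s) (h t / t ^ 2) t := by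
  refine ((H.hf t ht.le).div (hasDerivAt_id t) ht.ne').congr_deriv ?_
  rw [H.h_eq]
  simp only [id]
  ring

lemma f_div_le_of_h_nonneg (H : IsNeutral m κ f p u g h r) (ht : 0 < t) (htT : t ≤ T)
    (hh : ∀ s ∈ Ioo t T, 0 ≤ h s) : f t / t ≤ f T / T :=
  le_of_hasDerivAt_nonneg htT (fun s hs => H.hasDerivAt_f_div (ht.trans_le hs.1)) fun s hs =>
    div_nonneg (hh s hs) (by positivity)

lemma f_div_le_of_h_nonpos (H : IsNeutral m κ f p u g h r) (ht : 0 < t) (htT : t ≤ T)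
    (hh : ∀ s ∈ Ioo t T, h s ≤ 0) : f T / T ≤ f t / t := by
  have := le_of_hasDerivAt_nonneg (φ := fun s => -(f s / s)) htT
    (fun s hs => (H.hasDerivAt_f_div (ht.trans_le hs.1)).neg) fun s hs => by
      have := div_nonneg (neg_nonneg.mpr (hh s hs)) (sq_nonneg s)
      rw [neg_div] at this
      exact this
  linarith

lemma r_eq_inv (H : IsNeutral 4 κ f p u g h r) (ht : 0 ≤ t) : r t = (f t ^ 4)⁻¹ := by
  have := H.one_le_f ht
  rw [H.r_eq, Real.rpow_neg (by linarith)]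
  norm_cast

lemma r_le_of_pow_le (H : IsNeutral 4 κ f p u g h r) {C : ℝ} (ht : 0 < t)
    (hC : t ^ 4 ≤ C * f t ^ 4) : r t ≤ C / t ^ 4 := by
  have := H.one_le_f ht.le
  rw [H.r_eq_inv ht.le, le_div_iff₀ (by positivity), inv_mul_le_iff₀ (by positivity)]
  linarith

/-- At the end of the first phase `u` is controlled by `g`. -/
lemma cube_mul_u_le (H : IsNeutral 4 κ f p u g h r) {C : ℝ} (hC : 0 < C) (hT : 0 < T)
    (hhT : h T = 0) (huT : 0 < u T) (hgT : g T < 0) (hv : T ^ 4 ≤ 3 * C * f T ^ 4) :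
    T ^ 3 * u T ≤ C * (-g T) := by
  by_contra hcon
  push Not at hcon
  -- If the bound fails, `u + C * g / t ^ 3` is positive at `T`. It is nondecreasing while `g ≤ 0 ≤
  -- h`, because `f / t` then increases and `r ≤ 3 * C / t ^ 4` persists. So `u` stays positive
  -- until `g` vanishes, and at that moment the forbidden octant is reached.
  have hε : 0 < u T + C * (g T / T ^ 3) := by
    have : u T + C * (g T / T ^ 3) = (T ^ 3 * u T - C * (-g T)) / T ^ 3 := by field_simp; ring
    rw [this]
    apply div_pos _ (by positivity)
    linarith
  have key : ∀ Y > T, (∀ t ∈ Ico T Y, g t < 0) → g Y ≤ 0 →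
      (∀ t ∈ Icc T Y, 0 < u t) := by
    intro Y hY hgn hgY
    refine pos_of_bootstrap (H.triad.continuousOn fun x hx => hT.le.trans hx.1).2.1 huT ?_
    intro s hs hus
    have hh : ∀ t ∈ Icc T s, 0 ≤ h t := fun t ht => by
      rw [← hhT]
      exact le_of_hasDerivAt_nonneg ht.1 (fun y hy => H.hh (hT.le.trans hy.1)) fun y hy =>
        mul_nonneg (hT.le.trans hy.1.le) (hus y ⟨hy.1.le, hy.2.trans_le ht.2⟩).le
    have := le_of_hasDerivAt_nonneg (φ := fun t => u t + C * (g t / t ^ 3)) hs.1.le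
      (fun y hy => (H.hu y (hT.le.trans hy.1)).add (((H.hg y (hT.le.trans hy.1)).div
        (hasDerivAt_pow 3 y) (pow_ne_zero 3 (hT.trans_le hy.1).ne')).const_mul C))
      fun y hy => by
        have hy0 : 0 < y := hT.trans hy.1
        have hvy : f T / T ≤ f y / y := H.f_div_le_of_h_nonneg hT hy.1.le fun x hx =>
          hh x ⟨hx.1.le, hx.2.le.trans hy.2.le⟩
        have hf := H.one_le_f hT.le
        have h4 : (f T / T) ^ 4 ≤ (f y / y) ^ 4 := by gcongr
        have hy4 : y ^ 4 ≤ 3 * C * f y ^ 4 := by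
          have h1 : 1 ≤ 3 * C * (f T / T) ^ 4 := by
            rw [div_pow, ← mul_div_assoc, le_div_iff₀ (by positivity)]; linarith
          have h2 : 1 ≤ 3 * C * (f y / y) ^ 4 := h1.trans (by gcongr)
          rw [div_pow, ← mul_div_assoc, le_div_iff₀ (by positivity)] at h2
          linarith
        have hr := H.r_le_of_pow_le hy0 hy4
        have h5 := hh y ⟨hy.1.le, hy.2.le⟩
        have h6 := hgn y ⟨hy.1.le, hy.2.trans_le hs.2⟩
        have e : C * ((h y * y ^ 3 - g y * (((3 : ℕ) : ℝ) * y ^ (3 - 1))) / (y ^ 3) ^ 2)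
            = C * h y / y ^ 3 + 3 * C / y ^ 4 * (-g y) := by
          push_cast
          field_simp
          ring
        rw [e]
        have h7 : 0 ≤ C * h y / y ^ 3 := by positivity
        nlinarith
    have hgs : g s ≤ 0 := by
      rcases hs.2.eq_or_lt with h | h
      · rwa [h]
      · exact (hgn s ⟨hs.1.le, h⟩).le
    have h8 : C * (g s / s ^ 3) ≤ 0 := mul_nonpos_of_nonneg_of_nonpos hC.le
      (div_nonpos_of_nonpos_of_nonneg hgs (pow_nonneg (hT.le.trans hs.1.le) 3))
    linarith
  by_cases hg : ∀ t ≥ T, g t < 0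
  · have hu : ∀ t ≥ T, 0 < u t := fun t ht =>
      key (t + 1) (by linarith [show t ≥ T from ht]) (fun x hx => hg x hx.1) (hg _ (by linarith)).le t
        ⟨ht, by linarith⟩
    have hh1 : 0 < h (T + 1) := by
      rw [← hhT]
      exact lt_of_hasDerivAt_pos (by linarith) (fun y hy => H.hh (hT.le.trans hy.1)) fun y hy =>
        mul_pos (hT.trans hy.1) (hu y hy.1.le)
    obtain ⟨t, ht, hp⟩ := exists_pos_of_le_hasDerivAt (φ := g) (T := T + 1) hh1
      (fun s hs => H.hg s (by linarith)) fun s hs =>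
        le_of_hasDerivAt_nonneg hs (fun y hy => H.hh (by linarith [hy.1])) fun y hy =>
          mul_nonneg (by linarith [hy.1]) (hu y (by linarith [hy.1])).le
    exact lt_asymm hp (hg t (by linarith))
  · push Not at hg
    obtain ⟨t, ht, hgt⟩ := hg
    obtain ⟨Y, hY, hgY, hY'⟩ := exists_first_zero (φ := fun s => -g s)
      (fun s hs => (H.hg s (hT.le.trans hs.1)).continuousAt.continuousWithinAt.neg) ht
      (by simpa using hgT) (by simpa using hgt)
    have hgY0 : g Y = 0 := by linarith
    have hu := key Y hY.1 (fun s hs => by linarith [hY' s hs]) hgY0.le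
    have hhY : 0 ≤ h Y := by
      rw [← hhT]
      exact le_of_hasDerivAt_nonneg hY.1.le (fun y hy => H.hh (hT.le.trans hy.1)) fun y hy =>
        mul_nonneg (hT.le.trans hy.1.le) (hu y ⟨hy.1.le, hy.2.le⟩).le
    have huY := hu Y ⟨hY.1.le, le_rfl⟩
    exact H.not_nonneg (hT.trans hY.1) ⟨hhY, huY.le, hgY0.ge, Or.inr (Or.inl huY)⟩

lemma firstPhase_neg_one_le_h (H : IsNeutral m κ f p u g h r) (P : IsFirstPhase u g h T) :
    -1 ≤ h T := by
  rw [← H.h0]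
  exact le_of_hasDerivAt_nonneg P.1.le (fun y hy => H.hh hy.1) fun y hy =>
    mul_nonneg hy.1.le (P.2 y hy).2.1.le

lemma firstPhase_neg_le_g (H : IsNeutral m κ f p u g h r) (P : IsFirstPhase u g h T) :
    -T ≤ g T := by
  have := add_mul_le_of_le_hasDerivAt (c := -1) P.1.le (fun y hy => H.hg y hy.1) fun y hy =>
    H.firstPhase_neg_one_le_h (P.mono hy.1 hy.2.le)
  rw [H.g0] at this
  linarith

lemma firstPhase_u_le (H : IsNeutral m κ f p u g h r) (P : IsFirstPhase u g h T) : u T ≤ κ := by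
  have := le_of_hasDerivAt_nonneg (φ := fun s => -u s) P.1.le (fun y hy => (H.hu y hy.1).neg)
    fun y hy => by
      have := mul_pos (neg_pos.mpr (P.2 y hy).2.2) (H.r_pos hy.1.le)
      linarith
  simp only [H.u0] at this
  linarith

lemma firstPhase_le_u (H : IsNeutral m κ f p u g h r) (P : IsFirstPhase u g h T) :
    κ - T ^ 2 / 2 ≤ u T := by
  have := le_of_hasDerivAt_nonneg (φ := fun y => u y + y ^ 2 / 2) P.1.le
    (fun y hy => (H.hu y hy.1).add ((hasDerivAt_pow 2 y).div_const 2)) fun y hy => by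
      have h1 := H.firstPhase_neg_le_g (P.mono hy.1 hy.2.le)
      have h2 := H.r_pos hy.1.le
      have h3 := H.r_le_one hy.1.le
      have h4 := (P.2 y hy).2.2
      norm_num
      nlinarith
  simp only [H.u0] at this
  linarith

/-- The chord bound for `u` as a function of `t ^ 2`. -/
lemma firstPhase_u_le_chord (H : IsNeutral m κ f p u g h r) (P : IsFirstPhase u g h T) (hs : 0 < s)
    (hsT : s ≤ T) : u s ≤ κ - (κ - u T) * (s ^ 2 / T ^ 2) := by
  have hN : ∀ x, 0 < x → x ≤ T → 2 * (κ - u x) + x * (g x * r x) ≥ 0 := by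
    intro x hx hxT
    have hP := P.mono hx hxT
    have := le_of_hasDerivAt_nonneg (φ := fun y => - u y + (g x * r x) / x * (y ^ 2 / 2)) hx.le
      (fun y hy => (H.hu y hy.1).neg.add (((hasDerivAt_pow 2 y).div_const 2).const_mul _))
      fun y hy => by
        have h1 := H.firstPhase_gr_div hP hy.1 hy.2.le
        have : g y * r y ≤ g x * r x / x * y := by
          rw [div_mul_eq_mul_div, le_div_iff₀ hx]
          exact h1
        norm_num
        linarith
    simp only [H.u0] at this
    have e : g x * r x / x * (x ^ 2 / 2) = x * (g x * r x) / 2 := by field_simp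
    rw [e] at this
    norm_num at this
    linarith
  have := le_of_hasDerivAt_nonneg (φ := fun y => -((κ - u y) / y ^ 2)) hsT
    (fun y hy => ((((H.hu y (hs.le.trans hy.1)).const_sub κ).div (hasDerivAt_pow 2 y)
      (pow_ne_zero 2 (hs.trans_le hy.1).ne'))).neg)
    fun y hy => by
      have hy0 : 0 < y := hs.trans hy.1
      have h1 := hN y hy0 hy.2.le
      have e : -((-(g y * r y) * y ^ 2 - (κ - u y) * (((2 : ℕ) : ℝ) * y ^ (2 - 1))) / (y ^ 2) ^ 2)
          = (2 * (κ - u y) + y * (g y * r y)) / y ^ 3 := by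
        push_cast
        field_simp
        ring
      rw [e]
      positivity
  have hT := P.1
  rw [neg_le_neg_iff, le_div_iff₀ (by positivity)] at this
  have e : (κ - u T) / T ^ 2 * s ^ 2 = (κ - u T) * (s ^ 2 / T ^ 2) := by ring
  linarith

/-- If `f / t` stays large during the first phase then `u` decays quickly in it. -/
lemma firstPhase_sq_mul_u_le_of_pow_le (H : IsNeutral 4 κ f p u g h r)
    (hv : ∀ T, IsFirstPhase u g h T → T ^ 4 ≤ 0.87 * f T ^ 4) (P : IsFirstPhase u g h T) :
    T ^ 2 * u T ≤ 0.43 := by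
  -- Roughly the unstable left eigenvector of the logarithmic system for `t ^ 4 * r = 0.87`. The
  -- coefficients are such that `t L' ≥ 1.14 * L` in the phase, and `0.87 = 3 * 0.29` makes
  -- `cube_mul_u_le` applicable with `C = 0.29`.
  set L : ℝ → ℝ := fun t => 0.14 * (h t / t) + t * u t + 0.29 * (g t / t ^ 2) with hL
  have hLd : ∀ t, 0 < t → HasDerivAt L (0.14 * ((t * u t * t - h t * 1) / t ^ 2)
      + (1 * u t + t * (g t * r t))
      + 0.29 * ((h t * t ^ 2 - g t * (((2 : ℕ) : ℝ) * t ^ (2 - 1))) / (t ^ 2) ^ 2)) t := fun t ht =>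
    ((((H.hh ht.le).div (hasDerivAt_id t) ht.ne').const_mul 0.14).add
      ((hasDerivAt_id t).mul (H.hu t ht.le))).add
      (((H.hg t ht.le).div (hasDerivAt_pow 2 t) (pow_ne_zero 2 ht.ne')).const_mul 0.29)
  have grow : ∀ s, 0 < s → 0 < L s → ∀ t ≥ s, IsFirstPhase u g h t → L s / s ≤ L t / t := by
    intro s hs hLs t hst Pt
    have step : ∀ x, s ≤ x → x ≤ t → (∀ y ∈ Ico s x, 0 < L y) → L s / s ≤ L x / x := by
      intro x hsx hxt hy'
      refine le_of_hasDerivAt_nonneg (φ := fun t => L t / t) hsx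
        (fun y hy => (hLd y (hs.trans_le hy.1)).div (hasDerivAt_id y) (hs.trans_le hy.1).ne')
        fun y hy => ?_
      have hy0 : 0 < y := hs.trans hy.1
      have hyt : y < t := hy.2.trans_le hxt
      obtain ⟨k1, k2, k3⟩ := Pt.2 y ⟨hy0, hyt⟩
      have hr := H.r_le_of_pow_le hy0 (hv y (Pt.mono hy0 hyt.le))
      have hLy := hy' y ⟨hy.1.le, hy.2⟩
      refine div_nonneg ?_ (sq_nonneg _)
      have e : (0.14 * ((y * u y * y - h y * 1) / y ^ 2) + (1 * u y + y * (g y * r y))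
          + 0.29 * ((h y * y ^ 2 - g y * (((2 : ℕ) : ℝ) * y ^ (2 - 1))) / (y ^ 2) ^ 2)) * y
          - L y * 1 = 0.14 * L y + 0.0096 * (-h y / y)
            + (-g y) * (y ^ 2 * (0.87 / y ^ 4 - r y) + 0.0406 / y ^ 2) := by
        simp only [hL]
        push_cast
        field_simp
        ring
      rw [e]
      have h1 : 0 ≤ 0.87 / y ^ 4 - r y := by linarith
      have h2 : 0 < -h y := by linarith
      have h3 : 0 < -g y := by linarith
      positivity
    have hpos := pos_of_bootstrap (φ := L) (a := s) (b := t)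
      (fun x hx => (hLd x (hs.trans_le hx.1)).continuousAt.continuousWithinAt) hLs
      fun x hx hy => by
        have := step x hx.1.le hx.2 hy
        have h1 : 0 < L x / x := (div_pos hLs hs).trans_le this
        exact (div_pos_iff_of_pos_right (hs.trans hx.1)).mp h1
    exact step t hst le_rfl fun y hy => hpos y ⟨hy.1, hy.2.le⟩
  have hT := P.1
  -- If `L T > 0`, then `L / t` stays above a positive constant. An endless phase would then keep
  -- `u` away from `0`, against `t ^ 2 * u ≤ 2`; a phase ending with `h = 0` would violate
  -- `cube_mul_u_le`.
  have hLT : L T ≤ 0 := by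
    by_contra hc
    push Not at hc
    rcases H.firstPhase_dichotomy with hph | ⟨y, Py, hhy, huy, hgy⟩
    · set c := L T / T
      have hc0 : 0 < c := div_pos hc hT
      set S := max (T + 1) (2 / c + 1)
      have hST : T < S := lt_of_lt_of_le (by linarith) (le_max_left _ _)
      have hS0 : 0 < S := hT.trans hST
      have hS1 : 2 / c + 1 ≤ S := le_max_right _ _
      have h1 := grow T hT hc S hST.le (hph S hS0)
      obtain ⟨k1, -, k3⟩ := (hph (S + 1) (by linarith)).2 S ⟨hS0, by linarith⟩
      have h2 : c ≤ u S := by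
        refine h1.trans ?_
        rw [div_le_iff₀ hS0]
        have a1 : h S / S ≤ 0 := div_nonpos_of_nonpos_of_nonneg k1.le hS0.le
        have a2 : g S / S ^ 2 ≤ 0 := div_nonpos_of_nonpos_of_nonneg k3.le (sq_nonneg S)
        simp only [hL]
        linarith
      have h3 := H.firstPhase_sq_mul_u_le (hph S hS0)
      have h4 : 2 < S * c := by
        have : 2 / c < S := by linarith
        rwa [div_lt_iff₀ hc0] at this
      have h5 : 1 < S := by
        have : 0 < 2 / c := by positivity
        linarith
      nlinarith
    · have hTy : T ≤ y := by
        by_contra hlt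
        have := (P.2 y ⟨Py.1, not_le.mp hlt⟩).1
        linarith
      have h1 := grow T hT hc y hTy Py
      have h2 : 0 < L y := by
        have : 0 < L y / y := (div_pos hc hT).trans_le h1
        exact (div_pos_iff_of_pos_right Py.1).mp this
      have h3 := H.cube_mul_u_le (C := 0.29) (by norm_num) Py.1 hhy huy hgy (by
        have := hv y Py
        norm_num at this ⊢
        linarith)
      have hy0 := Py.1
      have e : y ^ 2 * L y = y ^ 3 * u y + 0.29 * g y := by
        simp only [hL, hhy]
        field_simp
        ring
      have : 0 < y ^ 2 * L y := by positivity
      rw [e] at this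
      linarith
  have e : T * L T = 0.14 * h T + T ^ 2 * u T + 0.29 * (g T / T) := by
    simp only [hL]
    field_simp
  have h1 : T * L T ≤ 0 := mul_nonpos_of_nonneg_of_nonpos hT.le hLT
  rw [e] at h1
  have h2 : -1 ≤ g T / T := by
    rw [le_div_iff₀ hT]
    linarith [H.firstPhase_neg_le_g P]
  linarith [H.firstPhase_neg_one_le_h P]

/-- The first phase reaches a point where `f / t` is small. -/
lemma exists_firstPhase_lt_pow (H : IsNeutral 4 κ f p u g h r) :
    ∃ T, IsFirstPhase u g h T ∧ 0.87 * f T ^ 4 < T ^ 4 := by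
  -- Otherwise `t ^ 2 * u ≤ 0.43` throughout the phase. This bounds `f'` by `1.24 * √κ`, and the
  -- assumed size of `f / t` forces `κ ^ 2 ≥ 0.486`. But integrating `u' ≥ -t r` up to `t = 1 / √κ`
  -- yields `0.57 * κ ^ 2 ≤ 0.26483`.
  by_contra hcon
  push Not at hcon
  have hsq := fun T (P : IsFirstPhase u g h T) => H.firstPhase_sq_mul_u_le_of_pow_le hcon P
  have hκ := H.hκ
  set k := Real.sqrt κ
  have hk : 0 < k := Real.sqrt_pos.mpr hκ
  have hk2 : k ^ 2 = κ := Real.sq_sqrt hκ.le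
  have P1 : IsFirstPhase u g h (1 / k) := by
    rcases H.firstPhase_dichotomy with hph | ⟨y, Py, hhy, -, -⟩
    · exact hph _ (by positivity)
    · refine Py.mono (by positivity) ?_
      have := le_of_hasDerivAt_nonneg (φ := fun t => κ / 2 * t ^ 2 - h t) Py.1.le
        (fun t ht => ((hasDerivAt_pow 2 t).const_mul _).sub (H.hh ht.1)) fun t ht => by
          have := mul_le_mul_of_nonneg_left (H.firstPhase_u_le (Py.mono ht.1 ht.2.le)) ht.1.le
          norm_num
          linarith
      simp only [H.h0, hhy] at this
      norm_num at this
      have hy := Py.1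
      rw [div_le_iff₀ hk]
      rw [← hk2] at this
      by_contra hlt
      push Not at hlt
      have : (y * k) ^ 2 < 1 := pow_lt_one₀ (by positivity) hlt (by norm_num)
      nlinarith
  have hy1 : 0 < 1 / k := by positivity
  have hu1 : u (1 / k) ≤ 0.43 * κ := by
    have := hsq _ P1
    have e : (1 / k) ^ 2 * u (1 / k) = u (1 / k) / κ := by rw [← hk2]; field_simp
    rwa [e, div_le_iff₀ hκ] at this
  -- The chord bound reads `u ≤ κ - 0.57 * κ ^ 2 * t ^ 2`; integration gives `k - 0.19 * k`.
  have hp1 : p (1 / k) ≤ 0.81 * k := by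
    have := le_of_hasDerivAt_nonneg (φ := fun t => κ * t - 0.57 * κ ^ 2 * (t ^ 3 / 3) - p t) hy1.le
      (fun t ht => (((hasDerivAt_id t).const_mul κ).sub
        (((hasDerivAt_pow 3 t).div_const 3).const_mul _)).sub (H.hp t ht.1)) fun t ht => by
        have h1 := H.firstPhase_u_le_chord P1 ht.1 ht.2.le
        have e : t ^ 2 / (1 / k) ^ 2 = κ * t ^ 2 := by rw [← hk2]; field_simp
        rw [e] at h1
        have h2 : 0 ≤ κ * t ^ 2 := by positivity
        norm_num
        nlinarith
    simp only [H.p0] at this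
    have e : κ * (1 / k) - 0.57 * κ ^ 2 * ((1 / k) ^ 3 / 3) - p (1 / k) = 0.81 * k - p (1 / k) := by
      rw [← hk2]; field_simp; ring
    rw [e] at this
    norm_num at this ⊢
    linarith
  -- The integral of `0.43 / t ^ 2` beyond `1 / k` adds at most `0.43 * k`.
  have hp : ∀ T, IsFirstPhase u g h T → 1 / k ≤ T → p T ≤ 1.24 * k := by
    intro T P hT
    have := le_of_hasDerivAt_nonneg (φ := fun t => -(0.43 * t⁻¹) - p t) hT
      (fun t ht => (((hasDerivAt_inv (hy1.trans_le ht.1).ne').const_mul 0.43).neg).sub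
        (H.hp t (hy1.le.trans ht.1))) fun t ht => by
        have ht0 : 0 < t := hy1.trans ht.1
        have h1 := hsq t (P.mono ht0 ht.2.le)
        have : u t ≤ 0.43 * (t ^ 2)⁻¹ := by
          rw [← div_eq_mul_inv, le_div_iff₀ (by positivity)]
          linarith
        linarith
    simp only [one_div, inv_inv] at this hp1
    have : 0 < T⁻¹ := inv_pos.mpr P.1
    linarith
  have hκ2 : 0.486 ≤ κ ^ 2 := by
    have h4 : 1 ≤ 0.87 * (1.24 * k) ^ 4 := by
      rcases H.firstPhase_dichotomy with hph | ⟨y, Py, hhy, -, -⟩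
      · have key : ∀ T : ℝ, T ≥ 1 / k → 1 ≤ 0.87 * (1.24 * k + 1 / T) ^ 4 := by
          intro T hT
          have hT0 : 0 < T := hy1.trans_le hT
          have P := hph T hT0
          have h1 := hp T P hT
          have h2 := hcon T P
          have h3 := H.firstPhase_neg_one_le_h P
          rw [H.h_eq] at h3
          have h4 : f T ≤ T * (1.24 * k + 1 / T) := by
            have : T * (1.24 * k + 1 / T) = T * (1.24 * k) + 1 := by field_simp
            rw [this]
            have := mul_le_mul_of_nonneg_left h1 hT0.le
            linarith
          have h5 := H.one_le_f hT0.le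
          have h6 : f T ^ 4 ≤ (T * (1.24 * k + 1 / T)) ^ 4 := by gcongr
          rw [mul_pow] at h6
          have h7 : 0 < T ^ 4 := by positivity
          by_contra hlt
          push Not at hlt
          have := mul_lt_mul_of_pos_left hlt h7
          linarith
        have lim : Tendsto (fun T : ℝ => 0.87 * (1.24 * k + 1 / T) ^ 4) atTop
            (𝓝 (0.87 * (1.24 * k + 0) ^ 4)) :=
          (((tendsto_const_nhds.div_atTop tendsto_id).const_add _).pow 4).const_mul _
        rw [add_zero] at lim
        exact ge_of_tendsto lim (by
          filter_upwards [eventually_ge_atTop (1 / k)] with T hT using key T hT)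
      · have hTy : 1 / k ≤ y := by
          by_contra hlt
          have := (P1.2 y ⟨Py.1, not_le.mp hlt⟩).1
          linarith
        have h1 := hp y Py hTy
        have h2 := hcon y Py
        have hy := Py.1
        have h3 : f y = y * p y := by have := H.h_eq y; linarith
        have h4 := H.p_pos hy
        have h6 : p y ^ 4 ≤ (1.24 * k) ^ 4 := by gcongr
        rw [h3, mul_pow] at h2
        have h7 : 0 < y ^ 4 := by positivity
        by_contra hlt
        push Not at hlt
        have := mul_lt_mul_of_pos_left hlt h7
        have := mul_le_mul_of_nonneg_left h6 h7.le
        linarith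
    have e : (1.24 * k) ^ 4 = 1.24 ^ 4 * κ ^ 2 := by rw [← hk2]; ring
    rw [e] at h4
    norm_num at h4 ⊢
    linarith
  -- From `f ≥ 1 + κ * t ^ 2 / 2 - t ^ 4 / 24`; the quartic term is absorbed using `κ * t ^ 2 ≤ 1`
  -- and `κ ^ 2 ≥ 0.486`.
  have hf1 : ∀ t ∈ Ioc 0 (1 / k), 1 + 0.4 * κ * t ^ 2 ≤ f t := by
    intro t ht
    have hu2 : ∀ s ∈ Ioc 0 t, κ - s ^ 2 / 2 ≤ u s := fun s hs =>
      H.firstPhase_le_u (P1.mono hs.1 (hs.2.trans ht.2))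
    have hpb : ∀ s ∈ Ioc 0 t, κ * s - s ^ 3 / 6 ≤ p s := by
      intro s hs
      have := le_of_hasDerivAt_nonneg (φ := fun y => p y - (κ * y - y ^ 3 / 6)) hs.1.le
        (fun y hy => (H.hp y hy.1).sub (((hasDerivAt_id y).const_mul κ).sub
          ((hasDerivAt_pow 3 y).div_const 6))) fun y hy => by
          have := hu2 y ⟨hy.1, hy.2.le.trans hs.2⟩
          norm_num
          linarith
      simp only [H.p0] at this
      norm_num at this
      linarith
    have h1 := le_of_hasDerivAt_nonneg (φ := fun y => f y - (κ / 2 * y ^ 2 - y ^ 4 / 24)) ht.1.le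
      (fun y hy => (H.hf y hy.1).sub (((hasDerivAt_pow 2 y).const_mul (κ / 2)).sub
        ((hasDerivAt_pow 4 y).div_const 24))) fun y hy => by
        have := hpb y ⟨hy.1, hy.2.le⟩
        norm_num
        linarith
    simp only [H.f0] at h1
    norm_num at h1
    have ht0 : 0 < t := ht.1
    have h2 : κ * t ^ 2 ≤ 1 := by
      have : t * k ≤ 1 := (le_div_iff₀ hk).mp ht.2
      have : (t * k) ^ 2 ≤ 1 := pow_le_one₀ (by positivity) this
      rw [← hk2]
      linarith [mul_pow t k 2]
    have h3 : t ^ 4 / 24 ≤ 0.1 * (κ * t ^ 2) := by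
      have : κ * (t ^ 4) ≤ t ^ 2 := by nlinarith [sq_nonneg t]
      have h5 : κ * (t ^ 4 / 24) ≤ κ * (0.1 * (κ * t ^ 2)) := by nlinarith [sq_nonneg t]
      exact le_of_mul_le_mul_left h5 hκ
    norm_num at h3 ⊢
    linarith
  -- The subtracted function is a primitive of `-t * (1 + 0.4 * κ * t ^ 2) ^ (-4)`. At `t = 1 / k`
  -- the bracket is `1.4`, and `(1 - 1.4⁻³) / 2.4 < 0.26483`.
  have hfin := le_of_hasDerivAt_nonneg
    (φ := fun t => u t - 1 / (2.4 * κ) * ((1 + 0.4 * κ * t ^ 2) ^ 3)⁻¹) hy1.le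
    (fun t ht => (H.hu t ht.1).sub (((((hasDerivAt_pow 2 t).const_mul (0.4 * κ)).const_add 1).fun_pow
      3).fun_inv (by positivity) |>.const_mul _)) fun t ht => by
      have ht0 : 0 < t := ht.1
      have h1 := hf1 t ⟨ht.1, ht.2.le⟩
      have hq : 0 < 1 + 0.4 * κ * t ^ 2 := by positivity
      have h2 := H.firstPhase_neg_le_g (P1.mono ht.1 ht.2.le)
      have h3 : r t ≤ ((1 + 0.4 * κ * t ^ 2) ^ 4)⁻¹ := by
        rw [H.r_eq_inv ht.1.le]
        gcongr
      have h4 := H.r_pos ht.1.le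
      have h5 : -(t * ((1 + 0.4 * κ * t ^ 2) ^ 4)⁻¹) ≤ g t * r t := by
        have : t * r t ≤ t * ((1 + 0.4 * κ * t ^ 2) ^ 4)⁻¹ := by gcongr
        nlinarith
      have e : ∀ q : ℝ, q = 1 + 0.4 * κ * t ^ 2 → 0 < q → 1 / (2.4 * κ) * (-(((3 : ℕ) : ℝ) * q ^ (3 - 1) *
          (0.4 * κ * (((2 : ℕ) : ℝ) * t ^ (2 - 1)))) / (q ^ 3) ^ 2) = -(t * (q ^ 4)⁻¹) := by
        intro q _ hq
        push_cast
        field_simp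
        norm_num
      have := e _ rfl hq
      linarith
  simp only [H.u0] at hfin
  have e : 0.4 * κ * (1 / k) ^ 2 = 0.4 := by rw [← hk2]; field_simp
  rw [e] at hfin
  have h5 : κ - 0.26483 / κ ≤ u (1 / k) := by
    have h6 : 1 / (2.4 * κ) * ((1 + 0.4 * κ * 0 ^ 2) ^ 3)⁻¹ - 1 / (2.4 * κ) * ((1 + 0.4) ^ 3)⁻¹
        ≤ 0.26483 / κ := by
      have : 1 / (2.4 * κ) * ((1 + 0.4 * κ * 0 ^ 2) ^ 3)⁻¹ - 1 / (2.4 * κ) * ((1 + 0.4) ^ 3)⁻¹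
        = (1 - ((1 + 0.4) ^ 3)⁻¹) / 2.4 / κ := by field_simp; norm_num
      rw [this]
      gcongr
      norm_num
    linarith
  have h7 : κ * κ - 0.26483 ≤ κ * (0.43 * κ) := by
    have := mul_le_mul_of_nonneg_left (h5.trans hu1) hκ.le
    have e : κ * (κ - 0.26483 / κ) = κ * κ - 0.26483 := by field_simp
    linarith
  norm_num at h7 hκ2
  nlinarith

end IsNeutral

/-! ### Decay at infinity. -/

lemma tendsto_zero_of_sq_le_div {φ : ℝ → ℝ} {C : ℝ} (h : ∀ᶠ t in atTop, φ t ^ 2 ≤ C / t) :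
    Tendsto φ atTop (𝓝 0) := by
  have h1 : Tendsto (fun t : ℝ => C / t) atTop (𝓝 0) := tendsto_const_nhds.div_atTop tendsto_id
  have h2 : Tendsto (fun t => φ t ^ 2) atTop (𝓝 0) :=
    tendsto_of_tendsto_of_tendsto_of_le_of_le' tendsto_const_nhds h1
      (Eventually.of_forall fun t => sq_nonneg _) h
  have h3 := h2.sqrt
  simp only [Real.sqrt_sq_eq_abs, Real.sqrt_zero] at h3
  exact (tendsto_zero_iff_abs_tendsto_zero φ).mpr h3

namespace IsNeutral

variable {m κ a : ℝ} {f p u g h r : ℝ → ℝ} {s t T : ℝ}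

lemma tendsto_f_div (H : IsNeutral m κ f p u g h r) (ha : Tendsto p atTop (𝓝 a)) :
    Tendsto (fun t => f t / t) atTop (𝓝 a) :=
  tendsto_div_id_of_tendsto_deriv (T := 0) (fun t ht => H.hf t ht) ha

/-- The derivative of `h ^ 2 / t` is `2 h u - h ^ 2 / t ^ 2 ≤ t ^ 2 u ^ 2`, a part of the derivative
of `lyap`. Thus `h ^ 2 / t` cannot grow faster than `lyap`, which is bounded above. -/
lemma h_sq_div_sub_lyap_le (H : IsNeutral m κ f p u g h r) (ht : 0 < t) (htT : t ≤ T) :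
    h T ^ 2 / T - lyap u g h r T ≤ h t ^ 2 / t - lyap u g h r t := by
  have := le_of_hasDerivAt_nonneg (φ := fun s => lyap u g h r s - h s ^ 2 / s) htT
    (fun y hy => (H.hasDerivAt_lyap (ht.trans_le hy.1)).sub (((H.hh (ht.le.trans hy.1)).fun_pow 2).div
      (hasDerivAt_id y) (ht.trans_le hy.1).ne')) fun y hy => by
      have hy0 : 0 < y := ht.trans hy.1
      have h1 := H.lyap_deriv_nonneg hy0
      have e : (((2 : ℕ) : ℝ) * h y ^ (2 - 1) * (y * u y) * y - h y ^ 2 * 1) / y ^ 2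
          = 2 * (h y * u y) - h y ^ 2 / y ^ 2 := by
        push_cast
        field_simp
      have h2 : 2 * (h y * u y) ≤ h y ^ 2 / y ^ 2 + y ^ 2 * u y ^ 2 := by
        have := sq_nonneg (h y / y - y * u y)
        have e : (h y / y - y * u y) ^ 2 = h y ^ 2 / y ^ 2 - 2 * (h y * u y) + y ^ 2 * u y ^ 2 := by
          field_simp
          ring
        linarith
      have h3 : 0 ≤ h y ^ 2 / y ^ 2 := by positivity
      simp only [id] at *
      rw [e]
      linarith
  linarith

/-- The first decay estimate. -/
lemma exists_decay (H : IsNeutral 4 κ f p u g h r) (ha0 : 0 < a) (ha : Tendsto p atTop (𝓝 a)) :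
    ∃ C, ∀ᶠ t in atTop, (h t / t) ^ 2 ≤ C / t ∧ (t * u t) ^ 2 ≤ C / t ∧ (g t / t ^ 2) ^ 2 ≤ C / t := by
  have hv := H.tendsto_f_div ha
  obtain ⟨T, hT⟩ := eventually_atTop.mp ((eventually_ge_atTop 1).and
    ((ha.eventually (lt_mem_nhds (half_lt_self ha0))).and
      (hv.eventually (lt_mem_nhds (half_lt_self ha0)))))
  have hT1 : 1 ≤ T := (hT T le_rfl).1
  have hT0 : 0 < T := by linarith
  set l := lyap u g h r
  have hl : ∀ t ≥ T, l t ≤ 0 := fun t ht => H.lyap_nonpos (hT0.trans_le ht)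
  have hG : ∀ t ≥ T, g t ^ 2 / t ^ 3 - l t ≤ g T ^ 2 / T ^ 3 - l T := by
    intro t ht
    have := le_of_hasDerivAt_nonneg (φ := fun s => l s - g s ^ 2 / s ^ 3) ht
      (fun y hy => (H.hasDerivAt_lyap (hT0.trans_le hy.1)).sub (((H.hg y
        (hT0.le.trans hy.1)).fun_pow 2).div (hasDerivAt_pow 3 y)
        (pow_ne_zero 3 (hT0.trans_le hy.1).ne'))) fun y hy => by
        have hy0 : 0 < y := hT0.trans hy.1
        have h1 := H.lyap_deriv_nonneg hy0
        have e : (((2 : ℕ) : ℝ) * g y ^ (2 - 1) * h y * y ^ 3 -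
            g y ^ 2 * (((3 : ℕ) : ℝ) * y ^ (3 - 1))) / (y ^ 3) ^ 2
            = h y ^ 2 / y ^ 2 / 3 - 3 * (g y / y ^ 2 - h y / y / 3) ^ 2 := by
          push_cast
          field_simp
          ring
        have h2 : 0 ≤ h y ^ 2 / y ^ 2 := by positivity
        have h3 : 0 ≤ y ^ 2 * u y ^ 2 := by positivity
        rw [e]
        linarith [sq_nonneg (g y / y ^ 2 - h y / y / 3)]
    linarith
  -- The derivative of `t ^ 3 u ^ 2` is at most `4 t ^ 2 u ^ 2 + t ^ 4 g ^ 2 r ^ 2`; the factor `8 /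
  -- a ^ 4` converts the second summand into the last term of `lyap'`, since `f / t` and `f'` exceed
  -- `a / 2`.
  set B := 4 + 8 / a ^ 4
  have hB : 0 < B := by positivity
  have hU : ∀ t ≥ T, t ^ 3 * u t ^ 2 - B * l t ≤ T ^ 3 * u T ^ 2 - B * l T := by
    intro t ht
    have := le_of_hasDerivAt_nonneg (φ := fun s => B * l s - s ^ 3 * u s ^ 2) ht
      (fun y hy => ((H.hasDerivAt_lyap (hT0.trans_le hy.1)).const_mul B).sub
        ((hasDerivAt_pow 3 y).mul ((H.hu y (hT0.le.trans hy.1)).fun_pow 2))) fun y hy => by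
        have hy0 : 0 < y := hT0.trans hy.1
        obtain ⟨-, hp, hf⟩ := hT y hy.1.le
        have hf1 := H.one_le_f hy0.le
        have hr := H.r_eq_inv hy0.le
        have hp0 : 0 < p y := by linarith
        have h1 := H.lyap_deriv_nonneg hy0
        have h2 : y ^ 4 * g y ^ 2 * r y ^ 2 ≤
            8 / a ^ 4 * (4 / 2 * y * r y * (p y / f y) * g y ^ 2) := by
          have k1 : (a / 2) ^ 3 ≤ (f y / y) ^ 3 := by gcongr
          have k2 : (a / 2) ^ 3 * (a / 2) ≤ (f y / y) ^ 3 * p y := by gcongr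
          have k3 : 1 ≤ 16 / a ^ 4 * ((f y / y) ^ 3 * p y) := by
            have : 16 / a ^ 4 * ((a / 2) ^ 3 * (a / 2)) = 1 := by field_simp; norm_num
            rw [← this]
            gcongr
          have e : 8 / a ^ 4 * (4 / 2 * y * r y * (p y / f y) * g y ^ 2)
              = y ^ 4 * g y ^ 2 * r y ^ 2 * (16 / a ^ 4 * ((f y / y) ^ 3 * p y)) := by
            rw [hr]
            field_simp
            ring
          rw [e]
          exact le_mul_of_one_le_right (by positivity) k3
        have h3 : 2 * y ^ 3 * u y * (g y * r y) ≤ y ^ 2 * u y ^ 2 + y ^ 4 * g y ^ 2 * r y ^ 2 := by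
          nlinarith [sq_nonneg (y * u y - y ^ 2 * g y * r y)]
        have h4 : 0 ≤ h y ^ 2 / y ^ 2 := by positivity
        have h5 : 0 ≤ y ^ 2 * u y ^ 2 := by positivity
        have h6 : 0 ≤ 8 / a ^ 4 := by positivity
        have h7 := mul_nonneg h6 h5
        have h8 := mul_nonneg h6 h4
        push_cast
        norm_num
        simp only [B]
        norm_num at h1 h2
        nlinarith
    linarith
  set D := |h T ^ 2 / T - l T| + |g T ^ 2 / T ^ 3 - l T| + |T ^ 3 * u T ^ 2 - B * l T|
  refine ⟨D, eventually_atTop.mpr ⟨T, fun t ht => ?_⟩⟩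
  have ht0 : 0 < t := hT0.trans_le ht
  have hlt := hl t ht
  have b1 : h t ^ 2 / t ≤ D := by
    have := H.h_sq_div_sub_lyap_le hT0 ht
    have h1 := le_abs_self (h T ^ 2 / T - l T)
    have h2 := abs_nonneg (g T ^ 2 / T ^ 3 - l T)
    have h3 := abs_nonneg (T ^ 3 * u T ^ 2 - B * l T)
    simp only [D, l] at *
    linarith
  have b2 : g t ^ 2 / t ^ 3 ≤ D := by
    have := hG t ht
    have h1 := le_abs_self (g T ^ 2 / T ^ 3 - l T)
    have h2 := abs_nonneg (h T ^ 2 / T - l T)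
    have h3 := abs_nonneg (T ^ 3 * u T ^ 2 - B * l T)
    simp only [D]
    linarith
  have b3 : t ^ 3 * u t ^ 2 ≤ D := by
    have := hU t ht
    have h1 := le_abs_self (T ^ 3 * u T ^ 2 - B * l T)
    have h2 := abs_nonneg (g T ^ 2 / T ^ 3 - l T)
    have h3 := abs_nonneg (h T ^ 2 / T - l T)
    have h4 : B * l t ≤ 0 := mul_nonpos_of_nonneg_of_nonpos hB.le hlt
    simp only [D]
    linarith
  refine ⟨?_, ?_, ?_⟩
  · have : (h t / t) ^ 2 = (h t ^ 2 / t) / t := by field_simp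
    rw [this]; gcongr
  · have : (t * u t) ^ 2 = (t ^ 3 * u t ^ 2) / t := by field_simp
    rw [this]; gcongr
  · have : (g t / t ^ 2) ^ 2 = (g t ^ 2 / t ^ 3) / t := by field_simp
    rw [this]; gcongr

/-- The left side is `∫ s ^ 2 u = T ^ 3 u / 3 + ∫ s ^ 3 (-u') / 3`, and `p T - T u T = ∫ s (-u')`.
Since `-u' / s` decreases, Chebyshev bounds the last integral of the first identity, with equality
when `-u' / s` is constant. -/
lemma firstPhase_neg_g_le_fifth (H : IsNeutral m κ f p u g h r) (P : IsFirstPhase u g h T) :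
    -g T + T * h T ≤ T ^ 3 * u T / 3 + 1 / 5 * T ^ 2 * (p T - T * u T) := by
  have hN : ∀ s, 0 < s → s ≤ T → 0 ≤ (p s - s * u s) + s ^ 2 * (g s * r s) / 3 := by
    intro s hs hsT
    have Ps := P.mono hs hsT
    have := le_of_hasDerivAt_nonneg
      (φ := fun y => p y - y * u y + (g s * r s) / s * (y ^ 3 / 3)) hs.le
      (fun y hy => ((H.hp y hy.1).sub ((hasDerivAt_id y).mul (H.hu y hy.1))).add
        (((hasDerivAt_pow 3 y).div_const 3).const_mul _))
      fun y hy => by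
        have hy0 : 0 < y := hy.1
        have h1 := H.firstPhase_gr_div Ps hy.1 hy.2.le
        have h2 : g y * r y ≤ g s * r s / s * y := by
          rw [div_mul_eq_mul_div, le_div_iff₀ hs]
          exact h1
        have h3 := mul_le_mul_of_nonneg_left h2 hy0.le
        norm_num
        linarith
    simp only [H.p0] at this
    have e : g s * r s / s * (s ^ 3 / 3) = s ^ 2 * (g s * r s) / 3 := by field_simp
    rw [e] at this
    norm_num at this
    linarith
  have := le_of_hasDerivAt_nonneg
    (φ := fun y => 1 / 5 * (y ^ 2 * (p y - y * u y)) + (y ^ 3 * u y) / 3 + (g y - y * h y)) P.1.le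
    (fun y hy => ((((hasDerivAt_pow 2 y).mul ((H.hp y hy.1).sub ((hasDerivAt_id y).mul
      (H.hu y hy.1)))).const_mul (1 / 5)).add (((hasDerivAt_pow 3 y).mul
      (H.hu y hy.1)).div_const 3)).add ((H.hg y hy.1).sub ((hasDerivAt_id y).mul (H.hh hy.1))))
    fun y hy => by
      have hy0 : 0 < y := hy.1
      have h1 := mul_nonneg hy0.le (hN y hy.1 hy.2.le)
      simp only [id, Pi.sub_apply, Pi.mul_apply]
      norm_num
      linarith
  simp only [H.g0] at this
  norm_num at this
  linarith

/-! ### The upper bound for the slope at infinity. -/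

/-- A quantity that is conserved up to cubic terms. -/
noncomputable def almostConserved (f u g h : ℝ → ℝ) (t : ℝ) : ℝ :=
  f t / t - g t / t ^ 2 - 2 * (f t / t) ^ 4 * (t * u t - h t / t)
    + 4 * (f t / t) ^ 3 * (h t / t) ^ 2 + 0.4 * (f t / t) ^ 5

/-- In logarithmic variables this is `v - G - 2 v ^ 4 (U - w) + 4 v ^ 3 w ^ 2 + 0.4 v ^ 5`: the
linear terms cancel, and `4 v ^ 3 w ^ 2` and `0.4 v ^ 5` remove the rest up to `12 v ^ 2 w ^ 3`. -/
lemma hasDerivAt_almostConserved (H : IsNeutral 4 κ f p u g h r) (ht : 0 < t) :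
    HasDerivAt (almostConserved f u g h) (12 * (f t / t) ^ 2 * (h t ^ 2 / t ^ 2 * (h t / t ^ 2))) t := by
  have hv := H.hasDerivAt_f_div ht
  have hw := (H.hh ht.le).fun_div (hasDerivAt_id' t) ht.ne'
  have hG := (H.hg t ht.le).fun_div (hasDerivAt_pow 2 t) (pow_ne_zero 2 ht.ne')
  have hU := (hasDerivAt_id' t).fun_mul (H.hu t ht.le)
  have hf := H.one_le_f ht.le
  have hr := H.r_eq_inv ht.le
  have := (((hv.fun_sub hG).fun_sub (((hv.fun_pow 4).const_mul 2).fun_mul (hU.fun_sub hw))).fun_add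
    (((hv.fun_pow 3).const_mul 4).fun_mul (hw.fun_pow 2))).fun_add ((hv.fun_pow 5).const_mul 0.4)
  refine this.congr_deriv ?_
  rw [hr]
  have hf0 : f t ≠ 0 := by linarith
  push_cast
  field_simp
  ring

lemma tendsto_almostConserved (H : IsNeutral 4 κ f p u g h r) (ha0 : 0 < a)
    (ha : Tendsto p atTop (𝓝 a)) :
    Tendsto (almostConserved f u g h) atTop (𝓝 (a + 0.4 * a ^ 5)) := by
  obtain ⟨C, hC⟩ := H.exists_decay ha0 ha
  have hv := H.tendsto_f_div ha
  have hw : Tendsto (fun t => h t / t) atTop (𝓝 0) :=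
    tendsto_zero_of_sq_le_div (hC.mono fun t ht => ht.1)
  have hU : Tendsto (fun t => t * u t) atTop (𝓝 0) :=
    tendsto_zero_of_sq_le_div (hC.mono fun t ht => ht.2.1)
  have hG : Tendsto (fun t => g t / t ^ 2) atTop (𝓝 0) :=
    tendsto_zero_of_sq_le_div (hC.mono fun t ht => ht.2.2)
  have := (((hv.sub hG).sub (((hv.pow 4).const_mul 2).mul (hU.sub hw))).add
    (((hv.pow 3).const_mul 4).mul (hw.pow 2))).add ((hv.pow 5).const_mul 0.4)
  have e : almostConserved f u g h = fun x => f x / x - g x / x ^ 2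
      - 2 * (f x / x) ^ 4 * (x * u x - h x / x) + 4 * (f x / x) ^ 3 * (h x / x) ^ 2
      + 0.4 * (f x / x) ^ 5 := rfl
  rw [e]
  simpa using this

/-- The arithmetic behind the bound for the slope at infinity: `V` is the slope at the end of the
first phase and `e` bounds its variation afterwards. -/
lemma pow_four_le_of_slope_bounds {V G e : ℝ} (ha0 : 0 < a) (hV : 0 < V) (hV4 : 0.87 * V ^ 4 ≤ 1)
    (hG0 : 0 ≤ G) (he : 0 ≤ e) (e1 : e ^ 2 ≤ 2 / 3 * V ^ 2) (e2 : e ^ 2 * V ^ 4 ≤ 2 / 3 * G ^ 2)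
    (hG : G * (V ^ 4 - 2 / 45) ≤ 0.2 * V ^ 5) (hae : a ≤ V + e)
    (hM : 1 / 15 ≤ V ^ 4 → a + 0.4 * a ^ 5 ≤ 1.2 * V + 0.4 * V ^ 5 + 32 / 3 * (V + e) ^ 2 * e ^ 3) :
    a ^ 4 ≤ 1.58 := by
  by_contra hc
  push Not at hc
  have ha1 : 1.1211 < a := by
    by_contra hle
    push Not at hle
    have : a ^ 4 ≤ 1.1211 ^ 4 := by gcongr
    norm_num at this hc
    linarith
  -- `0.8165` is `√(2 / 3)` rounded up, and `1.1211` lies just below the fourth root of `1.58`.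
  have e1' : e ≤ 0.8165 * V := by
    refine le_of_sq_le_sq ?_ (by positivity)
    norm_num at e1 ⊢
    nlinarith [sq_nonneg V]
  have e2' : e * V ^ 2 ≤ 0.8165 * G := by
    refine le_of_sq_le_sq ?_ (by positivity)
    have : (e * V ^ 2) ^ 2 = e ^ 2 * V ^ 4 := by ring
    rw [this]
    norm_num at e2 ⊢
    nlinarith [sq_nonneg G]
  -- `x / (x - 2 / 45)` decreases, so `V ^ 4` may be replaced by a lower bound `w`; `0.1633 = 0.2 *
  -- 0.8165`.
  have key : ∀ w : ℝ, 2 / 45 < w → w ≤ V ^ 4 → e * V * (w - 2 / 45) ≤ 0.1633 * w := by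
    intro w hw hwV
    have h1 : G * (V ^ 4 * (w - 2 / 45)) ≤ G * (V ^ 4 - 2 / 45) * w := by nlinarith
    have h2 : G * (V ^ 4 * (w - 2 / 45)) ≤ 0.2 * V ^ 5 * w :=
      h1.trans (by have : 0 < w := by linarith
                   gcongr)
    have h3 : G * (w - 2 / 45) ≤ 0.2 * V * w := by
      have : V ^ 4 * (G * (w - 2 / 45)) ≤ V ^ 4 * (0.2 * V * w) := by linarith
      exact le_of_mul_le_mul_left this (by positivity)
    have h4 : e * V ^ 2 * (w - 2 / 45) ≤ 0.8165 * G * (w - 2 / 45) :=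
      mul_le_mul_of_nonneg_right e2' (by linarith)
    have : V * (e * V * (w - 2 / 45)) ≤ V * (0.1633 * w) := by
      norm_num at h3 h4 ⊢
      linarith
    exact le_of_mul_le_mul_left this hV
  have hVhi : V < 1.0356 := by
    by_contra hle
    push Not at hle
    have : (1.0356 : ℝ) ^ 4 ≤ V ^ 4 := by gcongr
    norm_num at this hV4
    linarith
  have low : ∀ x : ℝ, 0 ≤ x → x ≤ V → x ^ 4 ≤ V ^ 4 := fun x hx hxV => by gcongr
  -- Up to `V = 0.92` the bound `a ≤ V + e` suffices: `e ≤ 0.8165 * V` at first, then `e ≤ C / V` on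
  -- each interval, where `V + C / V` is convex and controlled by its endpoint values.
  rcases le_or_gt V 0.61 with hV1 | hV1
  · norm_num at *
    linarith
  have p1 := low 0.61 (by norm_num) hV1.le
  rcases le_or_gt V 0.8 with hV2 | hV2
  · have := key 0.138 (by norm_num) (by norm_num at p1 ⊢; linarith)
    norm_num at *
    nlinarith [mul_nonneg (sub_nonneg.mpr hV1.le) (sub_nonneg.mpr hV2)]
  have p2 := low 0.8 (by norm_num) hV2.le
  rcases le_or_gt V 0.92 with hV3 | hV3
  · have := key 0.4096 (by norm_num) (by norm_num at p2 ⊢; linarith)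
    norm_num at *
    nlinarith [mul_nonneg (sub_nonneg.mpr hV2.le) (sub_nonneg.mpr hV3)]
  have p3 := low 0.92 (by norm_num) hV3.le
  have k1 := key 0.716 (by norm_num) (by norm_num at p3 ⊢; linarith)
  have k2 : e * V ≤ 0.17412 := by norm_num at k1 ⊢; linarith
  have k3 : e ≤ 0.18927 := by
    norm_num at k2 hV3 ⊢
    nlinarith
  have k4 : V + e ≤ 1.2045 := by
    have : V * (V + e) ≤ V * 1.2045 := by
      norm_num at *
      nlinarith [mul_nonneg (sub_nonneg.mpr hV3.le) (sub_nonneg.mpr hVhi.le)]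
    exact le_of_mul_le_mul_left this hV
  -- For larger `V` the almost conserved quantity is needed: it gives `a + 0.4 * a ^ 5 < 1.825`,
  -- whereas `a > 1.1211` and `a ^ 4 > 1.58` give more than `1.829`.
  have h1 := hM (by norm_num at p3 ⊢; linarith)
  have h2 : (V + e) ^ 2 * e ^ 3 ≤ 1.2045 ^ 2 * 0.18927 ^ 3 := by gcongr
  have h3 : V ^ 5 ≤ 1.0356 * (1 / 0.87) := by
    have : V ^ 4 ≤ 1 / 0.87 := by
      rw [le_div_iff₀ (by norm_num)]
      linarith
    calc V ^ 5 = V * V ^ 4 := by ring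
      _ ≤ _ := by gcongr
  have h4 : 1.1211 * 1.58 ≤ a ^ 5 := by
    calc 1.1211 * 1.58 ≤ a * a ^ 4 := by gcongr
      _ = a ^ 5 := by ring
  norm_num at *
  linarith

/-- The slope at infinity is not too large. -/
lemma limit_pow_four_le (H : IsNeutral 4 κ f p u g h r) (ha0 : 0 < a)
    (ha : Tendsto p atTop (𝓝 a)) : a ^ 4 ≤ 1.58 := by
  have hv := H.tendsto_f_div ha
  obtain ⟨S, PS, hS⟩ := H.exists_firstPhase_lt_pow
  have hS0 := PS.1
  have hS4 : 0.87 * (f S / S) ^ 4 ≤ 1 := by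
    rw [div_pow, ← mul_div_assoc, div_le_one (by positivity)]
    exact hS.le
  rcases H.firstPhase_dichotomy with hph | ⟨T, P, hhT, huT, hgT⟩
  · have h1 : a ≤ f S / S := le_of_tendsto hv (by
      filter_upwards [eventually_ge_atTop S] with t ht
      exact H.f_div_le_of_h_nonpos hS0 ht fun s hs =>
        ((hph t (hS0.trans_le ht)).2 s ⟨hS0.trans hs.1, hs.2⟩).1.le)
    have h2 : a ^ 4 ≤ (f S / S) ^ 4 := by gcongr
    norm_num at hS4 ⊢
    linarith
  have hT := P.1
  have hST : S ≤ T := by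
    by_contra hlt
    have := (PS.2 T ⟨hT, not_le.mp hlt⟩).1
    linarith
  have hfT : f T = T * p T := by have := H.h_eq T; linarith
  obtain ⟨hV, l1, l2⟩ := H.firstPhase_lyap P hhT huT.le
  set V := p T with hVdef
  have hVT : f T / T = V := by rw [hfT]; field_simp
  have hV4 : 0.87 * V ^ 4 ≤ 1 := by
    have : V ≤ f S / S := by
      rw [← hVT]
      exact H.f_div_le_of_h_nonpos hS0 hST fun s hs => (P.2 s ⟨hS0.trans hs.1, hs.2⟩).1.le
    have : V ^ 4 ≤ (f S / S) ^ 4 := by gcongr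
    norm_num at hS4 ⊢
    linarith
  obtain ⟨G, hG⟩ : ∃ G, G = -g T / T ^ 2 := ⟨_, rfl⟩
  have hgG : -g T = T ^ 2 * G := by rw [hG]; field_simp
  have hG0 : 0 < G := by
    rw [hG]
    exact div_pos (by linarith) (by positivity)
  obtain ⟨U, hU⟩ : ∃ U, U = T * u T := ⟨_, rfl⟩
  have huU : u T = U / T := by rw [hU]; field_simp
  have hU0 : 0 < U := by rw [hU]; positivity
  -- As `f T = T * V`, the smallest admissible constant in `cube_mul_u_le` is `C = 1 / (3 * V ^ 4)`.
  have c1 : U * (3 * V ^ 4) ≤ G := by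
    have := H.cube_mul_u_le (C := 1 / (3 * V ^ 4)) (by positivity) hT hhT huT hgT (by
      rw [hfT]
      apply le_of_eq
      field_simp)
    rw [hgG, huU] at this
    have e1 : T ^ 3 * (U / T) = T ^ 2 * U := by field_simp
    have e2 : 1 / (3 * V ^ 4) * (T ^ 2 * G) = T ^ 2 * (G / (3 * V ^ 4)) := by field_simp
    rw [e1, e2] at this
    have := le_of_mul_le_mul_left this (by positivity)
    rwa [le_div_iff₀ (by positivity)] at this
  have c2 : G ≤ 0.2 * V + 2 / 15 * U := by
    have := H.firstPhase_neg_g_le_fifth P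
    rw [hgG, hhT, huU] at this
    have e : T ^ 3 * (U / T) / 3 + 1 / 5 * T ^ 2 * (V - T * (U / T))
        = T ^ 2 * (0.2 * V + 2 / 15 * U) := by field_simp; ring
    rw [← hVdef, e, mul_zero, add_zero] at this
    exact le_of_mul_le_mul_left this (by positivity)
  set E := g T ^ 2 * r T / 2 + u T * -g T / (2 * T) with hE
  have hE' : E * V ^ 4 = G ^ 2 / 2 + U * G * V ^ 4 / 2 := by
    have e : g T ^ 2 = (T ^ 2 * G) ^ 2 := by rw [← hgG]; ring
    rw [hE, e, hgG, huU, H.r_eq_inv hT.le, hfT]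
    field_simp
  have hE0 : 0 < E := by
    have : 0 < E * V ^ 4 := by rw [hE']; positivity
    exact pos_of_mul_pos_left this (by positivity)
  set e := Real.sqrt E with he
  have hee : e ^ 2 = E := Real.sq_sqrt hE0.le
  have he0 : 0 < e := Real.sqrt_pos.mpr hE0
  have hpe : ∀ t ≥ T, |p t - V| ≤ e := fun t ht =>
    H.abs_p_sub_le_sqrt hT ht l1 (H.lyap_nonpos (hT.trans_le ht))
  have hvmax : ∀ t ≥ T, f t / t ≤ V + e := by
    intro t ht
    have ht0 : 0 < t := hT.trans_le ht
    have := add_mul_le_of_le_hasDerivAt (φ := fun s => -f s) (c := -(V + e)) ht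
      (fun s hs => (H.hf s (hT.le.trans hs.1)).neg) fun s hs => by
        linarith [(abs_le.mp (hpe s hs.1.le)).2]
    rw [div_le_iff₀ ht0]
    have := mul_pos hT he0
    linarith
  -- The cubic derivative is split: `h / y ^ 2 ≤ √(A / T ^ 3)` with `A` the increase of `lyap`, and
  -- `h ^ 2 / y ^ 2 ≤ 4 / 3 * lyap'`. The product integrates to a power `3 / 2` of that increase.
  have hMder : ∀ t ≥ T, almostConserved f u g h t ≤ almostConserved f u g h T
      + 32 / 3 * (V + e) ^ 2 * T ^ 3 * ((lyap u g h r t - lyap u g h r T) / T ^ 3) ^ (3 / 2 : ℝ) := by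
    intro t ht
    have := le_of_hasDerivAt_nonneg (φ := fun t => 32 / 3 * (V + e) ^ 2 * T ^ 3 *
      ((lyap u g h r t - lyap u g h r T) / T ^ 3) ^ (3 / 2 : ℝ) - almostConserved f u g h t) ht
      (fun y hy => (((((H.hasDerivAt_lyap (hT.trans_le hy.1)).sub_const _).div_const _).rpow_const
        (Or.inr (by norm_num))).const_mul _).sub (H.hasDerivAt_almostConserved (hT.trans_le hy.1)))
      fun y hy => by
        have hy0 : 0 < y := hT.trans hy.1
        set A := lyap u g h r y - lyap u g h r T
        have hA : h y ^ 2 / y ≤ A := by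
          have := H.h_sq_div_sub_lyap_le hT hy.1.le
          rw [hhT] at this
          norm_num at this
          linarith
        have k1 : h y / y ^ 2 ≤ Real.sqrt (A / T ^ 3) := by
          refine (le_abs_self _).trans (Real.abs_le_sqrt ?_)
          have : (h y / y ^ 2) ^ 2 = (h y ^ 2 / y) / y ^ 3 := by field_simp
          rw [this]
          have hT3 : T ^ 3 ≤ y ^ 3 := by gcongr; exact hy.1.le
          have hA0 : 0 ≤ A := le_trans (by positivity) hA
          gcongr
        have k2 : f y / y ≤ V + e := hvmax y hy.1.le
        have hf := H.one_le_f hy0.le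
        have k3 : (f y / y) ^ 2 ≤ (V + e) ^ 2 := by gcongr
        have k4 := H.lyap_deriv_nonneg hy0
        have e12 : (3 / 2 - 1 : ℝ) = 1 / 2 := by norm_num
        rw [e12, ← Real.sqrt_eq_rpow]
        set q := Real.sqrt (A / T ^ 3)
        have hq : 0 ≤ q := Real.sqrt_nonneg _
        have k5 : 12 * (f y / y) ^ 2 * (h y ^ 2 / y ^ 2 * (h y / y ^ 2))
            ≤ 12 * (V + e) ^ 2 * (h y ^ 2 / y ^ 2 * q) := by
          calc 12 * (f y / y) ^ 2 * (h y ^ 2 / y ^ 2 * (h y / y ^ 2))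
              ≤ 12 * (f y / y) ^ 2 * (h y ^ 2 / y ^ 2 * q) := by gcongr
            _ ≤ _ := by gcongr
        set L := y ^ 2 * u y ^ 2 + 3 / 4 * (h y ^ 2 / y ^ 2) + 4 / 2 * y * r y * (p y / f y) * g y ^ 2
        have k6 : 3 / 4 * (h y ^ 2 / y ^ 2) ≤ L := by
          have : 0 ≤ y ^ 2 * u y ^ 2 := by positivity
          simp only [L]
          linarith
        have k7 : 12 * (V + e) ^ 2 * (h y ^ 2 / y ^ 2 * q) ≤ 16 * (V + e) ^ 2 * (L * q) := by
          have : h y ^ 2 / y ^ 2 * q ≤ 4 / 3 * L * q := by gcongr; linarith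
          have := mul_le_mul_of_nonneg_left this (show 0 ≤ 12 * (V + e) ^ 2 by positivity)
          linarith
        have e3 : 32 / 3 * (V + e) ^ 2 * T ^ 3 * (L / T ^ 3 * (3 / 2) * q)
            = 16 * (V + e) ^ 2 * (L * q) := by field_simp; ring
        rw [e3]
        linarith
    simp only [sub_self, zero_div] at this
    rw [Real.zero_rpow (by norm_num)] at this
    linarith
  refine pow_four_le_of_slope_bounds (V := V) (G := G) (e := e) ha0 hV hV4 hG0.le he0.le
    (by rw [hee]; exact l2) ?_ ?_ ?_ fun hV15 => ?_
  · rw [hee, hE']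
    nlinarith
  · have hV4' : 0 < V ^ 4 := by positivity
    have := mul_le_mul_of_nonneg_right c2 hV4'.le
    norm_num at this ⊢
    linarith
  · exact le_of_tendsto ha (by
      filter_upwards [eventually_ge_atTop T] with t ht
      linarith [(abs_le.mp (hpe t ht)).2])
  -- After inserting `c2`, the contribution `(2 / 15 - 2 * V ^ 4) * U` is nonpositive because `V ^ 4
  -- ≥ 1 / 15`.
  · have hM0 : almostConserved f u g h T ≤ 1.2 * V + 0.4 * V ^ 5 := by
      have e1 : almostConserved f u g h T = V + G - 2 * V ^ 4 * U + 0.4 * V ^ 5 := by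
        simp only [almostConserved, hVT, hhT]
        rw [hG, hU]
        ring
      rw [e1]
      norm_num at c2 ⊢
      nlinarith
    refine le_of_tendsto (H.tendsto_almostConserved ha0 ha) ?_
    filter_upwards [eventually_ge_atTop T] with t ht
    have h1 := hMder t ht
    have h2 := H.lyap_nonpos (hT.trans_le ht)
    have h3 := H.lyap_mono hT ht
    have h4 : ((lyap u g h r t - lyap u g h r T) / T ^ 3) ^ (3 / 2 : ℝ) ≤ (e / T) ^ 3 := by
      have h5 : (lyap u g h r t - lyap u g h r T) / T ^ 3 ≤ (e / T) ^ 2 := by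
        have : (e / T) ^ 2 = T * E / T ^ 3 := by rw [← hee]; field_simp
        rw [this]
        gcongr
        linarith
      have h6 : 0 ≤ (lyap u g h r t - lyap u g h r T) / T ^ 3 :=
        div_nonneg (by linarith) (by positivity)
      calc _ ≤ ((e / T) ^ 2) ^ (3 / 2 : ℝ) := Real.rpow_le_rpow h6 h5 (by norm_num)
        _ = (e / T) ^ 3 := by
          rw [← Real.rpow_natCast, ← Real.rpow_mul (by positivity), ← Real.rpow_natCast]
          norm_num
    have h7 : 32 / 3 * (V + e) ^ 2 * T ^ 3 * ((lyap u g h r t - lyap u g h r T) / T ^ 3) ^ (3 / 2 : ℝ)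
        ≤ 32 / 3 * (V + e) ^ 2 * e ^ 3 := by
      calc _ ≤ 32 / 3 * (V + e) ^ 2 * T ^ 3 * (e / T) ^ 3 := by gcongr
        _ = _ := by field_simp
    exact h1.trans (add_le_add hM0 h7)

end IsNeutral

/-! ### Integration of exponential bounds. -/

section ExponentialBounds

variable {E : Type*} [NormedAddCommGroup E] [NormedSpace ℝ E] {y y' : ℝ → E} {S δ : ℝ}

lemma norm_sub_le_of_norm_deriv_le_exp {C s t : ℝ} (hδ : δ ≠ 0)
    (hd : ∀ x ∈ Icc s t, HasDerivAt y (y' x) x)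
    (hb : ∀ x ∈ Icc s t, ‖y' x‖ ≤ C * Real.exp (δ * x)) (hst : s ≤ t) :
    ‖y t - y s‖ ≤ C / δ * (Real.exp (δ * t) - Real.exp (δ * s)) := by
  have hB : ∀ x : ℝ, HasDerivAt (fun x => C / δ * (Real.exp (δ * x) - Real.exp (δ * s)))
      (C * Real.exp (δ * x)) x := fun x => by
    have h1 : HasDerivAt (fun x : ℝ => δ * x) δ x := by
      simpa using (hasDerivAt_id x).const_mul δ
    refine ((h1.exp.sub_const _).const_mul (C / δ)).congr_deriv ?_
    field_simp
  exact image_norm_le_of_norm_deriv_right_le_deriv_boundary (f := fun x => y x - y s) (f' := y')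
    (fun x hx => ((hd x hx).sub_const _).continuousAt.continuousWithinAt)
    (fun x hx => ((hd x ⟨hx.1, hx.2.le⟩).sub_const _).hasDerivWithinAt) (by simp) hB
    (fun x hx => hb x ⟨hx.1, hx.2.le⟩) ⟨hst, le_rfl⟩

lemma isBigO_exp_of_deriv (hδ : 0 < δ) (hd : ∀ s, HasDerivAt y (y' s) s)
    (h : y' =O[atTop] fun s => Real.exp (δ * s)) : y =O[atTop] fun s => Real.exp (δ * s) := by
  obtain ⟨C, hC⟩ := h.bound
  obtain ⟨S, hS⟩ := eventually_atTop.mp hC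
  refine IsBigO.of_bound (‖y (max S 0)‖ + |C / δ|) ?_
  filter_upwards [eventually_ge_atTop (max S 0)] with s hs
  have h1 := norm_sub_le_of_norm_deriv_le_exp (C := C) hδ.ne' (fun x _ => hd x) (fun x hx => by
    have := hS x ((le_max_left _ _).trans hx.1)
    rwa [Real.norm_of_nonneg (Real.exp_pos _).le] at this) hs
  have h2 : 1 ≤ Real.exp (δ * s) := Real.one_le_exp (mul_nonneg hδ.le ((le_max_right _ _).trans hs))
  have h3 : ‖y s‖ ≤ ‖y s - y (max S 0)‖ + ‖y (max S 0)‖ := by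
    simpa using norm_add_le (y s - y (max S 0)) (y (max S 0))
  have h4 : C / δ * (Real.exp (δ * s) - Real.exp (δ * max S 0)) ≤ |C / δ| * Real.exp (δ * s) := by
    have h5 : 0 ≤ Real.exp (δ * s) - Real.exp (δ * max S 0) := by
      rw [sub_nonneg]
      gcongr
    calc _ ≤ |C / δ| * (Real.exp (δ * s) - Real.exp (δ * max S 0)) := by
          gcongr; exact le_abs_self _
      _ ≤ _ := by
          gcongr
          linarith [Real.exp_pos (δ * max S 0)]
  rw [Real.norm_of_nonneg (Real.exp_pos _).le]
  have := mul_le_mul_of_nonneg_left h2 (norm_nonneg (y (max S 0)))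
  linarith

lemma exists_limit_isBigO_exp_of_deriv [CompleteSpace E] (hδ : 0 < δ)
    (hd : ∀ s, HasDerivAt y (y' s) s) (h : y' =O[atTop] fun s => Real.exp (-δ * s)) :
    ∃ L, (fun s => y s - L) =O[atTop] fun s => Real.exp (-δ * s) := by
  obtain ⟨C, hC0, hC⟩ := h.exists_pos
  obtain ⟨S, hS⟩ := eventually_atTop.mp hC.bound
  have key : ∀ s t, S ≤ s → s ≤ t → ‖y t - y s‖ ≤ C / δ * Real.exp (-δ * s) := by
    intro s t hs hst
    have h1 := norm_sub_le_of_norm_deriv_le_exp (C := C) (neg_ne_zero.mpr hδ.ne') (fun x _ => hd x)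
      (fun x hx => by
        have := hS x (hs.trans hx.1)
        rwa [Real.norm_of_nonneg (Real.exp_pos _).le] at this) hst
    refine h1.trans ?_
    have e : C / -δ * (Real.exp (-δ * t) - Real.exp (-δ * s))
        = C / δ * Real.exp (-δ * s) - C / δ * Real.exp (-δ * t) := by
      rw [div_neg]; ring
    rw [e]
    have : 0 ≤ C / δ * Real.exp (-δ * t) := by positivity
    linarith
  have lim0 : Tendsto (fun s => C / δ * Real.exp (-δ * s)) atTop (𝓝 0) := by
    have : Tendsto (fun s : ℝ => Real.exp (-δ * s)) atTop (𝓝 0) :=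
      Real.tendsto_exp_atBot.comp (tendsto_id.const_mul_atTop_of_neg (by linarith))
    simpa using this.const_mul (C / δ)
  have hcauchy : CauchySeq y := by
    rw [Metric.cauchySeq_iff']
    intro ε hε
    obtain ⟨N, hN⟩ := eventually_atTop.mp (lim0.eventually (gt_mem_nhds hε))
    refine ⟨max N S, fun t ht => ?_⟩
    rw [dist_eq_norm]
    exact (key _ _ (le_max_right _ _) ht).trans_lt (hN _ (le_max_left _ _))
  obtain ⟨L, hL⟩ := cauchySeq_tendsto_of_complete hcauchy
  refine ⟨L, IsBigO.of_bound (C / δ) ?_⟩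
  filter_upwards [eventually_ge_atTop S] with s hs
  rw [Real.norm_of_nonneg (Real.exp_pos _).le, norm_sub_rev]
  exact le_of_tendsto ((hL.sub_const (y s)).norm) (by
    filter_upwards [eventually_ge_atTop s] with t ht using key s t hs ht)

lemma isBigO_exp_of_deriv_of_tendsto_zero [CompleteSpace E] (hδ : 0 < δ)
    (hd : ∀ s, HasDerivAt y (y' s) s) (h : y' =O[atTop] fun s => Real.exp (-δ * s))
    (h0 : Tendsto y atTop (𝓝 0)) : y =O[atTop] fun s => Real.exp (-δ * s) := by
  obtain ⟨L, hL⟩ := exists_limit_isBigO_exp_of_deriv hδ hd h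
  have lim0 : Tendsto (fun s : ℝ => Real.exp (-δ * s)) atTop (𝓝 0) :=
    Real.tendsto_exp_atBot.comp (tendsto_id.const_mul_atTop_of_neg (by linarith))
  have h1 := hL.trans_tendsto lim0
  have h2 : Tendsto (fun s => y s - L) atTop (𝓝 (0 - L)) := h0.sub_const L
  have : (0 : E) - L = 0 := tendsto_nhds_unique h2 h1
  have hL0 : L = 0 := by simpa using this
  simpa [hL0] using hL

end ExponentialBounds

/-! ### Scalar linear equations with exponentially decaying forcing. -/

section LinearEquation

variable {ℓ N : ℝ → ℂ} {z : ℂ} {η : ℝ}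

lemma isBigO_exp_mono {α β : ℝ} (h : α ≤ β) :
    (fun s : ℝ => Real.exp (α * s)) =O[atTop] fun s => Real.exp (β * s) := by
  refine IsBigO.of_bound 1 ?_
  filter_upwards [eventually_ge_atTop 0] with s hs
  rw [Real.norm_of_nonneg (Real.exp_pos _).le, Real.norm_of_nonneg (Real.exp_pos _).le, one_mul]
  gcongr

lemma isBigO_cexp_mul {φ : ℝ → ℂ} {δ : ℝ} (w : ℂ) (h : φ =O[atTop] fun s => Real.exp (δ * s)) :
    (fun s : ℝ => Complex.exp (w * s) * φ s) =O[atTop] fun s => Real.exp ((w.re + δ) * s) := by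
  have h1 : (fun s : ℝ => Complex.exp (w * s)) =O[atTop] fun s => Real.exp (w.re * s) := by
    refine IsBigO.of_bound 1 (Eventually.of_forall fun s => ?_)
    rw [Complex.norm_exp, Real.norm_of_nonneg (Real.exp_pos _).le]
    simp
  refine (h1.mul h).congr_right fun s => ?_
  rw [← Real.exp_add]
  ring_nf

lemma hasDerivAt_cexp_neg_mul (hd : ∀ s, HasDerivAt ℓ (z * ℓ s + N s) s) (s : ℝ) :
    HasDerivAt (fun s : ℝ => Complex.exp (-z * s) * ℓ s) (Complex.exp (-z * s) * N s) s := by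
  have h1 : HasDerivAt (fun s : ℝ => -z * (s : ℂ)) (-z) s := by
    simpa using (Complex.ofRealCLM.hasDerivAt (x := s)).const_mul (-z)
  refine (h1.cexp.fun_mul (hd s)).congr_deriv ?_
  ring

lemma cexp_mul_cexp_neg_mul (z : ℂ) (s : ℝ) (x : ℂ) :
    Complex.exp (z * s) * (Complex.exp (-z * s) * x) = x := by
  rw [← mul_assoc, ← Complex.exp_add]
  simp

lemma linear_isBigO_exp (hd : ∀ s, HasDerivAt ℓ (z * ℓ s + N s) s)
    (hN : N =O[atTop] fun s => Real.exp (-η * s)) (hη : η < -z.re) :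
    ℓ =O[atTop] fun s => Real.exp (-η * s) := by
  have h1 := isBigO_exp_of_deriv (δ := (-z).re + -η) (by simp; linarith) (hasDerivAt_cexp_neg_mul hd)
    (isBigO_cexp_mul (-z) hN)
  have h2 := isBigO_cexp_mul z h1
  simp only [cexp_mul_cexp_neg_mul] at h2
  refine h2.congr_right fun s => ?_
  simp

/-- The derivative of `e ^ (-z s) ℓ` is `O(e ^ (-(η + Re z) s))`, which is integrable, so this
function converges at that rate. -/
lemma linear_asymptotics (hd : ∀ s, HasDerivAt ℓ (z * ℓ s + N s) s)
    (hN : N =O[atTop] fun s => Real.exp (-η * s)) (hη : -z.re < η) :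
    ∃ L : ℂ, (fun s => ℓ s - L * Complex.exp (z * s)) =O[atTop] fun s => Real.exp (-η * s) := by
  have h0 := isBigO_cexp_mul (-z) hN
  have e : ∀ s, Real.exp (((-z).re + -η) * s) = Real.exp (-(η + z.re) * s) := fun s => by
    congr 1
    simp
  obtain ⟨L, hL⟩ := exists_limit_isBigO_exp_of_deriv (δ := η + z.re) (by linarith)
    (hasDerivAt_cexp_neg_mul hd) (h0.congr_right e)
  have h2 := isBigO_cexp_mul z hL
  refine ⟨L, h2.congr (fun s => ?_) fun s => ?_⟩
  · rw [mul_sub, cexp_mul_cexp_neg_mul, mul_comm L]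
  · congr 1
    ring

/-- A nonzero coefficient of the growing mode would contradict `ℓ → 0`. -/
lemma linear_isBigO_exp_of_unstable (hd : ∀ s, HasDerivAt ℓ (z * ℓ s + N s) s)
    (hN : N =O[atTop] fun s => Real.exp (-η * s)) (hη : 0 < η) (hz : 0 < z.re)
    (h0 : Tendsto ℓ atTop (𝓝 0)) : ℓ =O[atTop] fun s => Real.exp (-η * s) := by
  obtain ⟨L, hL⟩ := linear_asymptotics hd hN (by linarith)
  have lim0 : Tendsto (fun s : ℝ => Real.exp (-η * s)) atTop (𝓝 0) :=
    Real.tendsto_exp_atBot.comp (tendsto_id.const_mul_atTop_of_neg (by linarith))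
  have h1 : Tendsto (fun s : ℝ => L * Complex.exp (z * s)) atTop (𝓝 0) := by
    simpa using h0.sub (hL.trans_tendsto lim0)
  have hL0 : L = 0 := by
    have h2 : ‖L‖ ≤ 0 := ge_of_tendsto (by simpa using h1.norm) (by
      filter_upwards [eventually_ge_atTop 0] with s hs
      rw [Complex.norm_exp]
      refine le_mul_of_one_le_right (norm_nonneg _) (Real.one_le_exp ?_)
      simp only [Complex.mul_re, Complex.ofReal_re, Complex.ofReal_im, mul_zero, sub_zero]
      positivity)
    exact norm_le_zero_iff.mp h2
  simpa [hL0] using hL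

end LinearEquation

/-! ### Roots of the characteristic cubic. -/

section Roots

/-- The unstable root of the linearization, and the condition for the other roots to be nonreal. -/
lemma exists_unstable_root {c : ℝ} (hc : 1 / 1.58 ≤ c) :
    ∃ μ : ℝ, 1 < μ ∧ (μ ^ 2 - 1) * (μ + 2) = c ∧ 8 < 3 * μ ^ 2 + 4 * μ := by
  have hc0 : 0.6329 < c := lt_of_lt_of_le (by norm_num) hc
  obtain ⟨μ, hμ, hμc⟩ := intermediate_value_Icc (f := fun x : ℝ => (x ^ 2 - 1) * (x + 2))
    (show (1 : ℝ) ≤ 1 + c by norm_num at hc0; linarith) (by fun_prop)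
    (show c ∈ Icc _ _ by
      norm_num at hc0
      constructor <;> nlinarith)
  simp only at hμc
  have h1 : 1 < μ := lt_of_le_of_ne hμ.1 fun h => by
    rw [← h] at hμc
    norm_num at hμc hc0
    linarith
  -- If `3 μ ^ 2 + 4 μ ≤ 8`, division by this quadratic bounds the cubic by `(7 μ - 2) / 9 <
  -- 0.6313`, below `c`.
  refine ⟨μ, h1, hμc, ?_⟩
  by_contra hle
  push Not at hle
  have h2 : μ < 1.0973 := by
    by_contra hc
    norm_num at hc
    nlinarith
  have h3 : (μ ^ 2 - 1) * (μ + 2) ≤ (7 * μ - 2) / 9 := by nlinarith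
  norm_num at h2 hc0
  linarith

/-- The stable root with nonnegative imaginary part. -/
noncomputable def stableRoot (μ : ℝ) : ℂ := ⟨-(2 + μ) / 2, Real.sqrt (3 * μ ^ 2 / 4 + μ - 2)⟩

variable {μ c : ℝ}

lemma stableRoot_quadratic (hμ : 8 < 3 * μ ^ 2 + 4 * μ) :
    stableRoot μ ^ 2 + (2 + μ) * stableRoot μ + (μ ^ 2 + 2 * μ - 1) = 0 := by
  have hs : Real.sqrt (3 * μ ^ 2 / 4 + μ - 2) * Real.sqrt (3 * μ ^ 2 / 4 + μ - 2)
      = 3 * μ ^ 2 / 4 + μ - 2 := Real.mul_self_sqrt (by linarith)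
  simp only [pow_two] at hs
  apply Complex.ext
  · simp [stableRoot, pow_two]
    linarith
  · simp [stableRoot, pow_two]
    ring

lemma stableRoot_cubic (hμ : 8 < 3 * μ ^ 2 + 4 * μ) (hc : (μ ^ 2 - 1) * (μ + 2) = c) :
    (stableRoot μ ^ 2 - 1) * (stableRoot μ + 2) = c := by
  rw [← hc]
  push_cast
  linear_combination (stableRoot μ - μ) * stableRoot_quadratic hμ

lemma stableRoot_isLeadingRoot (hμ1 : 1 < μ) (hμ : 8 < 3 * μ ^ 2 + 4 * μ)
    (hc : (μ ^ 2 - 1) * (μ + 2) = c) : IsLeadingRoot c (stableRoot μ) where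
  root := by linear_combination -(stableRoot_cubic hμ hc)
  re_neg := by simp only [stableRoot]; linarith
  re_max z hz hre := by
    -- The third factor belongs to the conjugate of `stableRoot μ`, which has the same real part.
    have h1 : (z - μ) * ((z - stableRoot μ) * (z + (2 + μ) + stableRoot μ)) = 0 := by
      have hc' : ((μ : ℂ) ^ 2 - 1) * (μ + 2) = c := by exact_mod_cast congrArg (fun x : ℝ => (x : ℂ)) hc
      linear_combination -hz - hc' - (z - μ) * stableRoot_quadratic hμ
    rcases mul_eq_zero.mp h1 with h | h
    · rw [sub_eq_zero.mp h, Complex.ofReal_re] at hre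
      linarith
    rcases mul_eq_zero.mp h with h | h
    · rw [sub_eq_zero.mp h]
    · have := congrArg Complex.re h
      simp [stableRoot] at this ⊢
      linarith
  im_nonneg := Real.sqrt_nonneg _

end Roots

/-! ### Asymptotics in logarithmic variables. -/

section LogSystem

/-- The profile equation in the variables `v = f / y`, `w = h / y`, `U = y f''`, `G = g / y ^ 2` of
`s = log y`, for a trajectory converging to `v = a`. -/
structure IsLogSystem (a : ℝ) (v w U G : ℝ → ℝ) : Prop where
  ha : 0 < a
  hv : ∀ s, HasDerivAt v (w s) s
  hw : ∀ s, HasDerivAt w (U s - w s) s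
  hU : ∀ s, HasDerivAt U (U s + (v s ^ 4)⁻¹ * G s) s
  hG : ∀ s, HasDerivAt G (w s - 2 * G s) s
  lim : Tendsto v atTop (𝓝 a)

/-- The common decay rate of `w`, `U`, `G`. -/
def HasRate (w U G : ℝ → ℝ) (η : ℝ) : Prop :=
  (w =O[atTop] fun s => Real.exp (-η * s)) ∧ (U =O[atTop] fun s => Real.exp (-η * s)) ∧
    G =O[atTop] fun s => Real.exp (-η * s)

/-- The component of the linearization along the eigenvalue `z`. -/
noncomputable def eigenComponent (w U G : ℝ → ℝ) (z : ℂ) (s : ℝ) : ℂ :=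
  ((U s - w s - G s : ℝ) : ℂ) + z * (w s : ℝ) + z ^ 2 * (G s : ℝ)

variable {a c μ η : ℝ} {v w U G : ℝ → ℝ} {z : ℂ}

lemma HasRate.mono {η' : ℝ} (h : HasRate w U G η) (hη : η' ≤ η) : HasRate w U G η' :=
  ⟨h.1.trans (isBigO_exp_mono (by linarith)), h.2.1.trans (isBigO_exp_mono (by linarith)),
    h.2.2.trans (isBigO_exp_mono (by linarith))⟩

lemma isBigO_ofReal {φ ψ : ℝ → ℝ} (h : φ =O[atTop] ψ) :
    (fun s => ((φ s : ℝ) : ℂ)) =O[atTop] ψ :=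
  h.norm_left.congr_left (fun s => (Complex.norm_real (φ s)).symm) |>.of_norm_left

lemma HasRate.eigenComponent (h : HasRate w U G η) (z : ℂ) :
    eigenComponent w U G z =O[atTop] fun s => Real.exp (-η * s) :=
  ((isBigO_ofReal ((h.2.1.sub h.1).sub h.2.2)).add ((isBigO_ofReal h.1).const_mul_left z)).add
    ((isBigO_ofReal h.2.2).const_mul_left (z ^ 2))

namespace IsLogSystem

/-- The coefficients `(z - 1, 1, z ^ 2 - 1)` of `(w, U, G)` form a left eigenvector of the
linearization; what is left over is the quadratic error. -/
lemma hasDerivAt_eigenComponent (H : IsLogSystem a v w U G) (hz : (z ^ 2 - 1) * (z + 2) = c) (s : ℝ) :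
    HasDerivAt (eigenComponent w U G z)
      (z * eigenComponent w U G z s + ((((v s ^ 4)⁻¹ - c) * G s : ℝ) : ℂ)) s := by
  have hw := (H.hw s).ofReal_comp
  have hU := (H.hU s).ofReal_comp
  have hG := (H.hG s).ofReal_comp
  have h1 := (((H.hU s).sub (H.hw s)).sub (H.hG s)).ofReal_comp
  refine ((h1.fun_add (hw.const_mul z)).fun_add (hG.const_mul (z ^ 2))).congr_deriv ?_
  simp only [eigenComponent]
  push_cast
  linear_combination -(G s : ℂ) * hz

lemma isBigO_v_sub (H : IsLogSystem a v w U G) (hη : 0 < η) (h : HasRate w U G η) :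
    (fun s => v s - a) =O[atTop] fun s => Real.exp (-η * s) :=
  isBigO_exp_of_deriv_of_tendsto_zero hη (fun s => (H.hv s).sub_const a) h.1
    (by simpa using H.lim.sub_const a)

lemma isBigO_forcing (H : IsLogSystem a v w U G) (hη : 0 < η) (h : HasRate w U G η)
    (hc : c = (a ^ 4)⁻¹) :
    (fun s => ((((v s ^ 4)⁻¹ - c) * G s : ℝ) : ℂ)) =O[atTop] fun s => Real.exp (-(2 * η) * s) := by
  have ha := H.ha
  have h1 : (fun x : ℝ => (x ^ 4)⁻¹ - (a ^ 4)⁻¹) =O[𝓝 a] fun x => x - a :=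
    ((hasDerivAt_pow 4 a).fun_inv (by positivity)).isBigO_sub
  have h2 : (fun s => (v s ^ 4)⁻¹ - c) =O[atTop] fun s => Real.exp (-η * s) := by
    rw [hc]
    exact (h1.comp_tendsto H.lim).trans (H.isBigO_v_sub hη h)
  refine isBigO_ofReal ((h2.mul h.2.2).congr_right fun s => ?_)
  rw [← Real.exp_add]
  ring_nf

/-- The components along `μ`, `z` and the conjugate of `z` determine `(w, U, G)` by a Vandermonde
system, invertible since `z` is nonreal. `w_eq` and `U_eq` complete the inversion. -/
lemma G_eq (w U G : ℝ → ℝ) (s μ : ℝ) (hz : 0 < z.im) :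
    G s = ((eigenComponent w U G μ s).re - (eigenComponent w U G z s).re
      - (μ - z.re) / z.im * (eigenComponent w U G z s).im) / ((μ - z.re) ^ 2 + z.im ^ 2) := by
  rw [eq_div_iff (by positivity)]
  simp [eigenComponent, pow_two]
  field_simp
  ring

lemma w_eq (w U G : ℝ → ℝ) (s : ℝ) (hz : 0 < z.im) :
    w s = (eigenComponent w U G z s).im / z.im - 2 * z.re * G s := by
  simp [eigenComponent, pow_two]
  field_simp
  ring

lemma U_eq (w U G : ℝ → ℝ) (s μ : ℝ) :
    U s = (eigenComponent w U G μ s).re + (1 - μ) * w s + (1 - μ ^ 2) * G s := by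
  simp [eigenComponent, pow_two]
  ring

lemma isBigO_re {φ : ℝ → ℂ} {ψ : ℝ → ℝ} (h : φ =O[atTop] ψ) : (fun s => (φ s).re) =O[atTop] ψ :=
  (IsBigO.of_bound 1 (Eventually.of_forall fun s => by
    simpa using Complex.abs_re_le_norm (φ s))).trans h

lemma isBigO_im {φ : ℝ → ℂ} {ψ : ℝ → ℝ} (h : φ =O[atTop] ψ) : (fun s => (φ s).im) =O[atTop] ψ :=
  (IsBigO.of_bound 1 (Eventually.of_forall fun s => by
    simpa using Complex.abs_im_le_norm (φ s))).trans h

lemma hasRate_of_eigenComponent (hz : 0 < z.im)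
    (h1 : eigenComponent w U G μ =O[atTop] fun s => Real.exp (-η * s))
    (h2 : eigenComponent w U G z =O[atTop] fun s => Real.exp (-η * s)) : HasRate w U G η := by
  have hG : G =O[atTop] fun s => Real.exp (-η * s) := by
    have := ((isBigO_re h1).sub (isBigO_re h2)).sub
      ((isBigO_im h2).const_mul_left ((μ - z.re) / z.im))
    refine (this.const_mul_left ((μ - z.re) ^ 2 + z.im ^ 2)⁻¹).congr_left fun s => ?_
    rw [G_eq w U G s μ hz]
    ring
  have hw : w =O[atTop] fun s => Real.exp (-η * s) := by
    refine (((isBigO_im h2).const_mul_left (z.im)⁻¹).sub (hG.const_mul_left (2 * z.re))).congr_left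
      fun s => ?_
    rw [w_eq w U G s hz]
    ring
  refine ⟨hw, ?_, hG⟩
  refine (((isBigO_re h1).add (hw.const_mul_left (1 - μ))).add
    (hG.const_mul_left (1 - μ ^ 2))).congr_left fun s => ?_
  rw [U_eq w U G s μ]

lemma unstable_isBigO (H : IsLogSystem a v w U G) (hc : c = (a ^ 4)⁻¹) (hμ0 : 0 < μ)
    (hμ : (μ ^ 2 - 1) * (μ + 2) = c) (hη : 0 < η) (h : HasRate w U G η) :
    eigenComponent w U G μ =O[atTop] fun s => Real.exp (-(2 * η) * s) := by
  have lim0 : Tendsto (fun s : ℝ => Real.exp (-η * s)) atTop (𝓝 0) :=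
    Real.tendsto_exp_atBot.comp (tendsto_id.const_mul_atTop_of_neg (by linarith))
  exact linear_isBigO_exp_of_unstable (H.hasDerivAt_eigenComponent (by exact_mod_cast hμ))
    (H.isBigO_forcing hη h hc) (by linarith) (by simpa using hμ0)
    ((h.eigenComponent _).trans_tendsto lim0)

/-- Doubling of the decay rate. -/
lemma hasRate_two_mul (H : IsLogSystem a v w U G) (hc : c = (a ^ 4)⁻¹) (hμ0 : 0 < μ)
    (hμ : (μ ^ 2 - 1) * (μ + 2) = c) (hz : (z ^ 2 - 1) * (z + 2) = c) (hzi : 0 < z.im) (hη : 0 < η)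
    (hηz : 2 * η < -z.re) (h : HasRate w U G η) : HasRate w U G (2 * η) :=
  hasRate_of_eigenComponent hzi (H.unstable_isBigO hc hμ0 hμ hη h)
    (linear_isBigO_exp (H.hasDerivAt_eigenComponent hz) (H.isBigO_forcing hη h hc) hηz)

/-- Doubling starts from some `q / 2 ^ n` and stops exactly at `q = 2 / 3 * (-z.re)`: still below
`-z.re`, as each doubling requires, but with `2 * q` above it, as the expansion requires. -/
lemma hasRate_two_thirds (H : IsLogSystem a v w U G) (hc : c = (a ^ 4)⁻¹) (hμ0 : 0 < μ)
    (hμ : (μ ^ 2 - 1) * (μ + 2) = c) (hz : (z ^ 2 - 1) * (z + 2) = c) (hzi : 0 < z.im)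
    (hzr : z.re < 0) (hη : 0 < η) (h : HasRate w U G η) : HasRate w U G (2 / 3 * (-z.re)) := by
  set q := 2 / 3 * (-z.re)
  have hq : 0 < q := by simp only [q]; linarith
  have hqz : q < -z.re := by simp only [q]; linarith
  obtain ⟨n, hn⟩ := pow_unbounded_of_one_lt (q / η) (one_lt_two (α := ℝ))
  have key : ∀ k : ℕ, HasRate w U G (q / 2 ^ k) → HasRate w U G q := by
    intro k
    induction k with
    | zero => intro h; simpa using h
    | succ k ih =>
      intro h
      have e : 2 * (q / 2 ^ (k + 1)) = q / 2 ^ k := by rw [pow_succ]; field_simp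
      have h1 : q / 2 ^ k ≤ q := div_le_self hq.le (one_le_pow₀ (by norm_num))
      have := H.hasRate_two_mul hc hμ0 hμ hz hzi (by positivity) (by rw [e]; linarith) h
      rw [e] at this
      exact ih this
  refine key n (h.mono ?_)
  rw [div_lt_iff₀ hη] at hn
  rw [div_le_iff₀ (by positivity)]
  linarith

/-- The expansion of `v` at infinity. -/
lemma exists_expansion (H : IsLogSystem a v w U G) (hc : c = (a ^ 4)⁻¹) (hμ0 : 0 < μ)
    (hμ : (μ ^ 2 - 1) * (μ + 2) = c) (hz : (z ^ 2 - 1) * (z + 2) = c) (hzi : 0 < z.im)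
    (hzr : z.re < 0) (hη : 0 < η) (h : HasRate w U G η) :
    ∃ K : ℂ, (fun s : ℝ => v s - (a + (K * Complex.exp (z * s)).re)) =o[atTop]
      fun s => Real.exp (z.re * s) := by
  have hr := H.hasRate_two_thirds hc hμ0 hμ hz hzi hzr hη h
  set q := 2 / 3 * (-z.re) with hq
  have hq0 : 0 < q := by simp only [q]; linarith
  have hu := H.unstable_isBigO hc hμ0 hμ hq0 hr
  obtain ⟨L, hL⟩ := linear_asymptotics (H.hasDerivAt_eigenComponent hz)
    (H.isBigO_forcing hq0 hr hc) (by simp only [q]; linarith)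
  set d := (μ - z.re) ^ 2 + z.im ^ 2
  have hd : 0 < d := by positivity
  set b := 2 * z.re / d
  -- `G_eq` and `w_eq` combined express `w` through the two components. The leading term `L e ^ (z
  -- s)` thus passes to `w`, and integration from infinity gives `K = B * L / z` for `v - a`.
  set B : ℂ := ⟨b, -(1 / z.im + b * ((μ - z.re) / z.im))⟩
  have hw : ∀ s, w s = -b * (eigenComponent w U G μ s).re + (B * eigenComponent w U G z s).re := by
    intro s
    rw [w_eq w U G s hzi, G_eq w U G s μ hzi]
    simp only [B, b, Complex.mul_re]
    ring
  have hz0 : z ≠ 0 := fun h => by rw [h] at hzi; simp at hzi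
  have hw' : (fun s : ℝ => w s - (B * L * Complex.exp (z * s)).re) =O[atTop]
      fun s => Real.exp (-(2 * q) * s) := by
    refine (((isBigO_re hu).const_mul_left (-b)).add (isBigO_re (hL.const_mul_left B))).congr_left
      fun s => ?_
    rw [hw s, mul_sub, Complex.sub_re, mul_assoc B L]
    ring
  have hexp : ∀ s : ℝ, HasDerivAt (fun s : ℝ => (B * L / z * Complex.exp (z * s)).re)
      ((B * L * Complex.exp (z * s)).re) s := by
    intro s
    have h1 : HasDerivAt (fun s : ℝ => z * (s : ℂ)) z s := by
      simpa using (Complex.ofRealCLM.hasDerivAt (x := s)).const_mul z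
    have h2 : HasDerivAt (fun s : ℝ => B * L / z * Complex.exp (z * s))
        (B * L * Complex.exp (z * s)) s := by
      refine (h1.cexp.const_mul (B * L / z)).congr_deriv ?_
      field_simp
    exact Complex.reCLM.hasFDerivAt.comp_hasDerivAt s h2
  have lim0 : Tendsto (fun s : ℝ => (B * L / z * Complex.exp (z * s)).re) atTop (𝓝 0) := by
    have h1 : Tendsto (fun s : ℝ => Real.exp (z.re * s)) atTop (𝓝 0) :=
      Real.tendsto_exp_atBot.comp (tendsto_id.const_mul_atTop_of_neg hzr)
    have h2 : (fun s : ℝ => B * L / z * Complex.exp (z * s)) =O[atTop]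
        fun s => Real.exp (z.re * s) := by
      refine IsBigO.of_bound ‖B * L / z‖ (Eventually.of_forall fun s => ?_)
      rw [norm_mul, Complex.norm_exp, Real.norm_of_nonneg (Real.exp_pos _).le]
      simp
    exact (isBigO_re h2).trans_tendsto h1
  have hfin := isBigO_exp_of_deriv_of_tendsto_zero (δ := 2 * q) (by linarith)
    (fun s => ((H.hv s).sub_const a).fun_sub (hexp s)) hw'
    (by simpa using (H.lim.sub_const a).sub lim0)
  refine ⟨B * L / z, ?_⟩
  have h3 : (fun s : ℝ => Real.exp (-(2 * q) * s)) =o[atTop] fun s => Real.exp (z.re * s) := by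
    refine Real.isLittleO_exp_comp_exp_comp.mpr ?_
    have : Tendsto (fun s : ℝ => (z.re + 2 * q) * s) atTop atTop :=
      tendsto_id.const_mul_atTop (by simp only [q]; linarith)
    refine this.congr fun s => ?_
    ring
  refine (hfin.trans_isLittleO h3).congr_left fun s => ?_
  ring

end IsLogSystem

end LogSystem

/-! ### One-sided and iterated derivatives. -/

section Derivatives

lemma contDiffOn_Ici_succ_of_hasDerivAt {n : ℕ} {F F' : ℝ → ℝ}
    (hd : ∀ y, 0 ≤ y → HasDerivAt F (F' y) y) (h : ContDiffOn ℝ n F' (Ici 0)) :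
    ContDiffOn ℝ (n + 1 : ℕ) F (Ici 0) := by
  have hu := uniqueDiffOn_Ici (0 : ℝ)
  push_cast
  rw [contDiffOn_succ_iff_derivWithin hu]
  refine ⟨fun y hy => (hd y hy).differentiableAt.differentiableWithinAt, by simp, h.congr fun y hy => ?_⟩
  exact (hd y hy).hasDerivWithinAt.derivWithin (hu y hy)

lemma iteratedDerivWithin_Ici_succ_eqOn {n : ℕ} {F Fn Fn' : ℝ → ℝ}
    (hd : ∀ y, 0 ≤ y → HasDerivAt Fn (Fn' y) y)
    (h : EqOn (iteratedDerivWithin n F (Ici 0)) Fn (Ici 0)) :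
    EqOn (iteratedDerivWithin (n + 1) F (Ici 0)) Fn' (Ici 0) := fun y hy => by
  rw [iteratedDerivWithin_succ, derivWithin_congr h (h hy)]
  exact (hd y hy).hasDerivWithinAt.derivWithin (uniqueDiffOn_Ici (0 : ℝ) y hy)

lemma iteratedDeriv_succ_eqOn_Ioi {n : ℕ} {F Fn Fn' : ℝ → ℝ}
    (hd : ∀ y, 0 ≤ y → HasDerivAt Fn (Fn' y) y) (h : EqOn (iteratedDeriv n F) Fn (Ioi 0)) :
    EqOn (iteratedDeriv (n + 1) F) Fn' (Ioi 0) := fun y hy => by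
  rw [iteratedDeriv_succ, (h.eventuallyEq_of_mem (Ioi_mem_nhds hy)).deriv_eq]
  exact (hd y (le_of_lt hy)).deriv

end Derivatives

/-! ### Rescaling and the return to the variable `y`. -/

namespace IsNeutral

variable {m κ a l : ℝ} {f p u g h r : ℝ → ℝ} {t : ℝ}

lemma contDiffOn (H : IsNeutral m κ f p u g h r) : ContDiffOn ℝ 4 f (Ici 0) := by
  have ch : ContDiffOn ℝ (0 : ℕ) h (Ici 0) := contDiffOn_zero.mpr fun y hy =>
    (H.hh hy).continuousAt.continuousWithinAt
  have cp : ContDiffOn ℝ (0 : ℕ) p (Ici 0) := contDiffOn_zero.mpr fun y hy =>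
    (H.hp y hy).continuousAt.continuousWithinAt
  have cg := contDiffOn_Ici_succ_of_hasDerivAt H.hg ch
  have cf := contDiffOn_Ici_succ_of_hasDerivAt H.hf cp
  have cr : ContDiffOn ℝ (0 + 1 : ℕ) r (Ici 0) := by
    refine (cf.rpow_const_of_ne (p := -m) fun y hy => ?_).congr fun y _ => H.r_eq y
    linarith [H.one_le_f (show 0 ≤ y from hy)]
  exact contDiffOn_Ici_succ_of_hasDerivAt H.hf (contDiffOn_Ici_succ_of_hasDerivAt H.hp
    (contDiffOn_Ici_succ_of_hasDerivAt H.hu (cg.mul cr)))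

lemma hasDerivAt_comp_mul {φ φ' : ℝ → ℝ} (hl : 0 < l) (hd : ∀ t, 0 ≤ t → HasDerivAt φ (φ' t) t)
    (k : ℝ) (y : ℝ) (hy : 0 ≤ y) :
    HasDerivAt (fun y => k * φ (l * y)) (l * k * φ' (l * y)) y := by
  have h1 : HasDerivAt (fun y : ℝ => l * y) l y := by simpa using (hasDerivAt_id y).const_mul l
  refine ((hd (l * y) (by positivity)).comp y h1 |>.const_mul k).congr_deriv ?_
  ring

/-- The rescaled trajectory is a self-similar profile. -/
lemma isSelfSimilarProfile (H : IsNeutral m κ f p u g h r) (ha : Tendsto p atTop (𝓝 a))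
    (hl : 0 < l) :
    IsSelfSimilarProfile (l ^ 4) m (l ^ 2 * κ) (l * a) fun y => f (l * y) := by
  have d0 : ∀ y, 0 ≤ y → HasDerivAt (fun y => f (l * y)) (l * p (l * y)) y := fun y hy => by
    simpa using hasDerivAt_comp_mul hl H.hf 1 y hy
  have d1 := hasDerivAt_comp_mul hl H.hp l
  have d2 := hasDerivAt_comp_mul hl H.hu (l * l)
  have d3 := hasDerivAt_comp_mul hl H.hg (l * (l * l))
  have w0 : EqOn (iteratedDerivWithin 0 (fun y => f (l * y)) (Ici 0)) (fun y => f (l * y)) (Ici 0) :=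
    fun y _ => by simp
  have w1 := iteratedDerivWithin_Ici_succ_eqOn d0 w0
  have w2 := iteratedDerivWithin_Ici_succ_eqOn d1 w1
  have w3 := iteratedDerivWithin_Ici_succ_eqOn d2 w2
  have i0 : EqOn (iteratedDeriv 0 fun y => f (l * y)) (fun y => f (l * y)) (Ioi 0) :=
    fun y _ => by simp
  have i3 := iteratedDeriv_succ_eqOn_Ioi d2 (iteratedDeriv_succ_eqOn_Ioi d1
    (iteratedDeriv_succ_eqOn_Ioi d0 i0))
  have mem0 : (0 : ℝ) ∈ Ici (0 : ℝ) := self_mem_Ici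
  refine ⟨?_, fun y hy => ?_, fun y hy => ?_, ?_, ?_, ?_, ?_, ?_⟩
  · refine H.contDiffOn.comp (contDiff_const.mul contDiff_id).contDiffOn fun y hy => ?_
    have hy : 0 ≤ y := hy
    show 0 ≤ l * y
    positivity
  · linarith [H.one_le_f (show 0 ≤ l * y by positivity)]
  · have e : (fun s => f (l * s) ^ m * iteratedDeriv 3 (fun y => f (l * y)) s) =ᶠ[𝓝 y]
        fun s => l * (l * l) * g (l * s) := by
      filter_upwards [Ioi_mem_nhds hy] with s hs
      have hs0 : 0 < s := hs
      have hf := H.one_le_f (show 0 ≤ l * s by positivity)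
      rw [i3 hs]
      simp only [H.r_eq]
      have : f (l * s) ^ m * f (l * s) ^ (-m) = 1 := by
        rw [← Real.rpow_add (by linarith)]
        simp
      linear_combination (l * (l * l) * g (l * s)) * this
    rw [e.deriv_eq, (d3 y hy.le).deriv, (d0 y hy.le).deriv, H.h_eq]
    ring
  · simp [H.f0]
  · rw [w1 mem0]; simp [H.p0]
  · rw [w2 mem0]
    simp only [mul_zero, H.u0]
    ring
  · rw [w3 mem0]; simp [H.g0]
  · have h1 : Tendsto (fun y : ℝ => l * y) atTop atTop := tendsto_id.const_mul_atTop hl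
    have h2 := ((tendsto_div_id_of_tendsto_deriv (T := 0) (fun t ht => H.hf t ht) ha).comp
      h1).const_mul l
    refine h2.congr' ?_
    filter_upwards [eventually_gt_atTop 0] with y hy
    simp only [Function.comp]
    field_simp

/-- The profile in logarithmic variables. -/
lemma isLogSystem (H : IsNeutral 4 κ f p u g h r) (ha0 : 0 < a) (ha : Tendsto p atTop (𝓝 a)) :
    IsLogSystem a (fun s => f (Real.exp s) / Real.exp s) (fun s => h (Real.exp s) / Real.exp s)
      (fun s => Real.exp s * u (Real.exp s)) (fun s => g (Real.exp s) / Real.exp s ^ 2) where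
  ha := ha0
  hv s := by
    refine ((H.hasDerivAt_f_div (Real.exp_pos s)).comp s (Real.hasDerivAt_exp s)).congr_deriv ?_
    field_simp
  hw s := by
    have hy := Real.exp_pos s
    refine (((H.hh hy.le).comp s (Real.hasDerivAt_exp s)).fun_div (Real.hasDerivAt_exp s)
      hy.ne').congr_deriv ?_
    simp only [Function.comp]
    field_simp
  hU s := by
    have hy := Real.exp_pos s
    have hf := H.one_le_f hy.le
    refine ((Real.hasDerivAt_exp s).fun_mul
      ((H.hu _ hy.le).comp s (Real.hasDerivAt_exp s))).congr_deriv ?_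
    simp only [Function.comp]
    rw [H.r_eq_inv hy.le]
    field_simp
  hG s := by
    have hy := Real.exp_pos s
    refine (((H.hg _ hy.le).comp s (Real.hasDerivAt_exp s)).fun_div
      ((Real.hasDerivAt_exp s).fun_pow 2) (by positivity)).congr_deriv ?_
    simp only [Function.comp]
    push_cast
    field_simp
  lim := (H.tendsto_f_div ha).comp Real.tendsto_exp_atTop

lemma isBigO_exp_of_sq_le_div {φ : ℝ → ℝ} {C : ℝ} (h : ∀ᶠ t in atTop, φ t ^ 2 ≤ C / t) :
    (fun s => φ (Real.exp s)) =O[atTop] fun s => Real.exp (-(1 / 2) * s) := by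
  refine IsBigO.of_bound (Real.sqrt C) ?_
  filter_upwards [Real.tendsto_exp_atTop.eventually h] with s hs
  rw [Real.norm_eq_abs, Real.norm_of_nonneg (Real.exp_pos _).le]
  have h1 := Real.abs_le_sqrt hs
  have e : C / Real.exp s = C * Real.exp (-(1 / 2) * s) ^ 2 := by
    rw [← Real.exp_nat_mul, div_eq_mul_inv, ← Real.exp_neg]
    congr 2
    push_cast
    ring
  rwa [e, Real.sqrt_mul' _ (by positivity), Real.sqrt_sq (Real.exp_pos _).le] at h1

/-- The expansion of the profile at infinity. -/
lemma exists_expansion (H : IsNeutral 4 κ f p u g h r) (ha0 : 0 < a) (ha : Tendsto p atTop (𝓝 a)) :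
    ∃ z K : ℂ, IsLeadingRoot (1 / a ^ 4) z ∧ z.re < -1 ∧
      (fun y : ℝ => f y - (a * y + (K * (y : ℂ) ^ (1 + z)).re)) =o[atTop]
        fun y : ℝ => y ^ (1 + z.re) := by
  have hc : 1 / 1.58 ≤ 1 / a ^ 4 :=
    one_div_le_one_div_of_le (by positivity) (H.limit_pow_four_le ha0 ha)
  obtain ⟨μ, hμ1, hμc, hμ⟩ := exists_unstable_root hc
  obtain ⟨C, hC⟩ := H.exists_decay ha0 ha
  have rate : HasRate (fun s => h (Real.exp s) / Real.exp s)
      (fun s => Real.exp s * u (Real.exp s)) (fun s => g (Real.exp s) / Real.exp s ^ 2) (1 / 2) :=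
    ⟨isBigO_exp_of_sq_le_div (φ := fun t => h t / t) (hC.mono fun t ht => ht.1),
      isBigO_exp_of_sq_le_div (φ := fun t => t * u t) (hC.mono fun t ht => ht.2.1),
      isBigO_exp_of_sq_le_div (φ := fun t => g t / t ^ 2) (hC.mono fun t ht => ht.2.2)⟩
  have hre : (stableRoot μ).re = -(2 + μ) / 2 := rfl
  obtain ⟨K, hK⟩ := (H.isLogSystem ha0 ha).exists_expansion (z := stableRoot μ) (one_div _)
    (by linarith) hμc (stableRoot_cubic hμ hμc)
    (Real.sqrt_pos.mpr (by linarith)) (by rw [hre]; linarith) (by norm_num) rate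
  refine ⟨stableRoot μ, K, stableRoot_isLeadingRoot hμ1 hμ hμc, by rw [hre]; linarith, ?_⟩
  set z := stableRoot μ
  have h1 := (isBigO_refl (fun y : ℝ => y) atTop).mul_isLittleO (hK.comp_tendsto Real.tendsto_log_atTop)
  refine h1.congr' ?_ ?_
  · filter_upwards [eventually_gt_atTop 0] with y hy
    have hy' : (y : ℂ) ≠ 0 := by exact_mod_cast hy.ne'
    simp only [Function.comp, Real.exp_log hy]
    rw [Complex.cpow_add _ _ hy', Complex.cpow_one, Complex.cpow_def_of_ne_zero hy',
      ← Complex.ofReal_log hy.le, mul_left_comm K (y : ℂ), Complex.re_ofReal_mul,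
      mul_comm z]
    field_simp
  · filter_upwards [eventually_gt_atTop 0] with y hy
    simp only [Function.comp]
    rw [Real.rpow_add hy, Real.rpow_one, Real.rpow_def_of_pos hy, mul_comm z.re]

lemma expansion_comp_mul {z K : ℂ} (hl : 0 < l)
    (hK : (fun y : ℝ => f y - (a * y + (K * (y : ℂ) ^ (1 + z)).re)) =o[atTop]
      fun y : ℝ => y ^ (1 + z.re)) :
    (fun y : ℝ => f (l * y) - (l * a * y + (K * (l : ℂ) ^ (1 + z) * (y : ℂ) ^ (1 + z)).re)) =o[atTop]
      fun y : ℝ => y ^ (1 + z.re) := by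
  have h1 := hK.comp_tendsto (tendsto_id.const_mul_atTop hl : Tendsto (fun y : ℝ => l * y) atTop atTop)
  have h2 : (fun y : ℝ => (l * y) ^ (1 + z.re)) =O[atTop] fun y : ℝ => y ^ (1 + z.re) := by
    refine IsBigO.of_bound (l ^ (1 + z.re)) ?_
    filter_upwards [eventually_gt_atTop 0] with y hy
    rw [Real.mul_rpow hl.le hy.le, norm_mul, Real.norm_of_nonneg (Real.rpow_nonneg hl.le _)]
  refine (h1.trans_isBigO h2).congr' ?_ EventuallyEq.rfl
  filter_upwards [eventually_gt_atTop 0] with y hy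
  simp only [Function.comp]
  rw [Complex.ofReal_mul, Complex.mul_cpow_ofReal_nonneg hl.le hy.le]
  ring_nf

end IsNeutral

/-! ### The main theorem. -/

section Main

lemma exists_pos_pow_four_eq {α : ℝ} (hα : 0 < α) : ∃ l : ℝ, 0 < l ∧ l ^ 4 = α :=
  ⟨α ^ (1 / 4 : ℝ), Real.rpow_pos_of_pos hα _, by
    rw [← Real.rpow_natCast, ← Real.rpow_mul hα.le]; norm_num⟩

lemma sq_mul_mem_Ioo {l κ : ℝ} (hl : 0 < l) (hκ : κ ∈ Ioo 0 (Real.sqrt 12)) :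
    l ^ 2 * κ ∈ Ioo 0 (Real.sqrt (12 * l ^ 4)) := by
  have e : l ^ 4 = (l ^ 2) ^ 2 := by ring
  have h1 := hκ.1
  rw [Real.sqrt_mul (by norm_num), e, Real.sqrt_sq (by positivity), mul_comm (Real.sqrt 12)]
  exact ⟨by positivity, mul_lt_mul_of_pos_left hκ.2 (by positivity)⟩

theorem mainTheorem1 :
    (∀ m : ℝ, 0 < m → m < 4 →
      ∃ κ ∈ Ioo (0 : ℝ) (Real.sqrt (12 * (1 / (4 - m)))), ∃ a : ℝ, 0 < a ∧
        ∃ f : ℝ → ℝ, IsSelfSimilarProfile (1 / (4 - m)) m κ a f) ∧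
    (∀ b : ℝ, 0 < b →
      ∃ κ ∈ Ioo (0 : ℝ) (Real.sqrt (12 * b)), ∃ a : ℝ, 0 < a ∧
        ∃ f : ℝ → ℝ, IsSelfSimilarProfile b 4 κ a f ∧
          ∃ z₀ K : ℂ, IsLeadingRoot (b / a ^ 4) z₀ ∧ z₀.re < -1 ∧
            (fun y : ℝ => f y - (a * y + (K * (y : ℂ) ^ (1 + z₀)).re))
              =o[atTop] fun y : ℝ => y ^ (1 + z₀.re)) := by
  constructor
  · intro m hm hm4
    obtain ⟨κ, hκ, f, p, u, g, h, r, H⟩ := exists_isNeutral hm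
    obtain ⟨a, ha0, ha⟩ := H.exists_tendsto_p
    obtain ⟨l, hl, hl4⟩ := exists_pos_pow_four_eq (show 0 < 1 / (4 - m) from
      one_div_pos.mpr (by linarith))
    rw [← hl4]
    exact ⟨_, sq_mul_mem_Ioo hl hκ, _, mul_pos hl ha0, _, H.isSelfSimilarProfile ha hl⟩
  · intro b hb
    obtain ⟨κ, hκ, f, p, u, g, h, r, H⟩ := exists_isNeutral (show (0 : ℝ) < 4 by norm_num)
    obtain ⟨a, ha0, ha⟩ := H.exists_tendsto_p
    obtain ⟨l, hl, rfl⟩ := exists_pos_pow_four_eq hb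
    obtain ⟨z, K, hz, hz1, hK⟩ := H.exists_expansion ha0 ha
    refine ⟨_, sq_mul_mem_Ioo hl hκ, _, mul_pos hl ha0, _, H.isSelfSimilarProfile ha hl, z, _, ?_,
      hz1, IsNeutral.expansion_comp_mul hl hK⟩
    have e : l ^ 4 / (l * a) ^ 4 = 1 / a ^ 4 := by field_simp
    rwa [e]

end Main
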